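/- **Definitions.** A *family* over a category $\mathcal{C}$ is a presheaf $\mathsf{Ty}$ on $\mathcal{C}$ with a dependent presheaf $\mathsf{Tm}$ over $\mathsf{Ty}$, i.e. a presheaf on the category of elements of $\mathsf{Ty}$. A *category with families* (CwF) is a (small) category $\mathcal{C}$ with a chosen terminal object and a family $(\mathsf{Ty}_{\mathcal C},\mathsf{Tm}_{\mathcal C})$ such that for every object $\Gamma$ and $A\in\mathsf{Ty}_{\mathcal C}(\Gamma)$ the presheaf $(\rho:\Delta\to\Gamma)\mapsto \mathsf{Tm}_{\mathcal C}(A[\rho])$ on $\mathcal{C}/\Gamma$ is represented by a chosen $p_A:\Gamma.A\to\Gamma$. Let $\mathbf{CwF}$ be the category of CwFs and morphisms that strictly preserve all of this structure, with initial object $\mathbf 0$. Let $I=\{I^{\mathsf{ty}},I^{\mathsf{tm}}\}$ consist of the evident maps $\mathsf{Free}(\Gamma)\to\mathsf{Free}(\Gamma\vdash A)$ and $\mathsf{Free}(\Gamma\vdash A)\to\mathsf{Free}(\Gamma\vdash a:A)$ between the CwFs freely generated by an object, by a type over an object, and by a term of a type over an object. A CwF $\mathcal C$ is *freely generated* ($I$-cellular)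 if $\mathbf 0\to\mathcal C$ is the composition of an $\omega$-sequence of pushouts in $\mathbf{CwF}$ of small coproducts of maps in $I$. A presheaf $X$ on a category is *familially representable* if every element $x\in X(\Gamma)$ can be equipped with a *most general generalization* $x_0\in X(\Gamma_0)$ such that there is a unique $f:\Gamma\to\Gamma_0$ with $x=x_0[f]$, and such that $(\Gamma_0,x_0)$ is strictly natural: for every $\sigma:\Delta\to\Gamma$, the elements $x$ and $x[\sigma]$ have the same $(\Gamma_0,x_0)$. (Equivalently, $X$ is a coproduct of representable presheaves.) A dependent presheaf $Y$ over $X$ is *locally familially representable* if for every $\Gamma$ and $x\in X(\Gamma)$ the presheaf $(\rho:\Delta\to\Gamma)\mapsto Y(x[\rho])$ on $\mathcal C/\Gamma$ is familially representable. The family of *telescopes* $(X^\star,Y^\star)$ of a family $(X,Y)$ is defined, internally to presheaves on $\mathcal C$, inductively: there is an empty telescope $\diamond$ with $Y^\star(\diamond)=\top$, and for a telescope $\Delta$ and $A:Y^\star(\Delta)\to X$ there is a telescope $\Delta.A$ with $Y^\star(\Delta.A)=(\delta:Y^\star(\Delta))\times Y(A(\delta))$. For a CwF $\mathcal C$, a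 *basic sort* is either $\mathbb{ty}$, with $\mathsf{Elem}(\mathbb{ty})=\mathsf{Ty}_{\mathcal C}$, or $\mathbb{tm}(A)$ for a type $A$, with $\mathsf{Elem}(\mathbb{tm}(A))=\mathsf{Tm}_{\mathcal C}(A)$; a *monomial sort* $[\Delta\vdash A]$ consists of a telescope of types $\Delta$ and a family of basic sorts $A$ over $\mathsf{Tm}^\star_{\mathcal C}(\Delta)$, with $\mathsf{Elem}([\Delta\vdash A])=(\delta:\mathsf{Tm}^\star_{\mathcal C}(\Delta))\to\mathsf{Elem}(A(\delta))$; and the family of *polynomial sorts*, with its elements $\mathsf{Elem}$, is the family of telescopes of monomial sorts. **Theorem.** Let $\mathcal C$ be a freely generated CwF. Then the family of polynomial sorts of $\mathcal C$ is locally familially representable: for every object $\Gamma$ and polynomial sort $P$ over $\Gamma$, the presheaf $(\rho:\Delta\to\Gamma)\mapsto\mathsf{Elem}(P[\rho])$ on $\mathcal C/\Gamma$ is familially representable. In particular, for every closed polynomial sort $P$ (a global element of the presheaf of polynomial sorts), the presheaf $\mathsf{Elem}(P)$ on $\mathcal C$ is familially representable. -/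

import Mathlib

open CategoryTheory Opposite Limits

universe u

/-! ### Familially representable presheaves -/

/-- A presheaf `X` is familially representable if every element `x` of `X` over `Γ` has a most
general generalization `mgg Γ x = ⟨Γ₀, x₀⟩`, which depends strictly naturally on `Γ`, and such that
there is a unique `f : Γ ⟶ Γ₀` with `x₀[f] = x`. -/
def IsFamiliallyRepresentable {C : Type u} [Category.{u} C] (X : Cᵒᵖ ⥤ Type u) : Prop :=
  ∃ mgg : ∀ Γ : C, X.obj (op Γ) → Σ Γ₀ : C, X.obj (op Γ₀),
    (∀ (Γ Δ : C) (f : Δ ⟶ Γ) (x : X.obj (op Γ)), mgg Δ (X.map f.op x) = mgg Γ x) ∧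
    ∀ (Γ : C) (x : X.obj (op Γ)), ∃! f : Γ ⟶ (mgg Γ x).1, X.map f.op (mgg Γ x).2 = x

/-! ### Dependent presheaves -/

theorem map_comp_op {C : Type u} [Category.{u} C] {X : Cᵒᵖ ⥤ Type u}
    {Γ Δ Θ : C} {f : Δ ⟶ Γ} {g : Θ ⟶ Δ} {x : X.obj (op Γ)} {y : X.obj (op Δ)}
    {z : X.obj (op Θ)} (hf : X.map f.op x = y) (hg : X.map g.op y = z) :
    X.map (g ≫ f).op x = z := by
  rw [op_comp, Functor.map_comp_apply, hf, hg]

theorem map_id_op {C : Type u} [Category.{u} C] {X : Cᵒᵖ ⥤ Type u} {Γ : C} (x : X.obj (op Γ)) :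
    X.map (𝟙 Γ).op x = x := by
  rw [op_id, Functor.map_id_apply]

/-- A dependent presheaf over `X`, i.e. a presheaf over the category of elements of `X`, whose
morphisms `⟨Δ, y⟩ ⟶ ⟨Γ, x⟩` are the morphisms `f : Δ ⟶ Γ` such that `x[f] = y`. -/
structure DepPresheaf {C : Type u} [Category.{u} C] (X : Cᵒᵖ ⥤ Type u) where
  obj : ∀ {Γ : C}, X.obj (op Γ) → Type u
  map : ∀ {Γ Δ : C} (f : Δ ⟶ Γ) {x : X.obj (op Γ)} {y : X.obj (op Δ)},
    X.map f.op x = y → obj x → obj y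
  map_id : ∀ {Γ : C} {x : X.obj (op Γ)} (h : X.map (𝟙 Γ).op x = x) (t : obj x),
    map (𝟙 Γ) h t = t
  map_map : ∀ {Γ Δ Θ : C} (f : Δ ⟶ Γ) (g : Θ ⟶ Δ) {x : X.obj (op Γ)} {y : X.obj (op Δ)}
    {z : X.obj (op Θ)} (hf : X.map f.op x = y) (hg : X.map g.op y = z) (t : obj x),
    map g hg (map f hf t) = map (g ≫ f) (map_comp_op hf hg) t

section Restriction

variable {C : Type u} [Category.{u} C] {X : Cᵒᵖ ⥤ Type u}

theorem DepPresheaf.map_congr (Y : DepPresheaf X) {Γ Δ : C} {f g : Δ ⟶ Γ} (hfg : f = g)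
    {x : X.obj (op Γ)} {y : X.obj (op Δ)} (hf : X.map f.op x = y) (hg : X.map g.op x = y)
    (t : Y.obj x) : Y.map f hf t = Y.map g hg t := by
  subst hfg
  rfl

/-- The restriction of a dependent presheaf `Y` over `X` to an element `x` of `X` over `Γ`:
the presheaf on `C / Γ` sending `ρ : Δ ⟶ Γ` to `Y(x[ρ])`. -/
def DepPresheaf.restrict (Y : DepPresheaf X) {Γ : C} (x : X.obj (op Γ)) :
    (Over Γ)ᵒᵖ ⥤ Type u where
  obj ρ := Y.obj (X.map ρ.unop.hom.op x)
  map f := ↾fun t ↦ Y.map f.unop.left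
    (by rw [← Functor.map_comp_apply, ← op_comp, Over.w]) t
  map_id ρ := by
    ext t
    exact Y.map_id _ t
  map_comp f g := by
    ext t
    exact (Y.map_map _ _ _ _ t).symm

/-- A dependent presheaf is locally familially representable if all its restrictions to elements
of the base are familially representable. -/
def DepPresheaf.IsLocallyFamiliallyRepresentable (Y : DepPresheaf X) : Prop :=
  ∀ (Γ : C) (x : X.obj (op Γ)), IsFamiliallyRepresentable (Y.restrict x)

/-- The presheaf `Γ ↦ Y(s(Γ))`, for a global element `s` of `X`. -/
def DepPresheaf.atGlobal (Y : DepPresheaf X) (s : X.sections) : Cᵒᵖ ⥤ Type u where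
  obj Γ := Y.obj (Γ := Γ.unop) (s.1 Γ)
  map f := ↾fun t ↦ Y.map f.unop (s.2 f) t
  map_id Γ := by
    ext t
    exact Y.map_id _ t
  map_comp f g := by
    ext t
    exact (Y.map_map _ _ _ _ t).symm

end Restriction

/-! ### Families and telescopes -/

/-- A family over `C`: a presheaf `Ty` and a dependent presheaf `Tm` over `Ty`. -/
structure Family (C : Type u) [Category.{u} C] where
  Ty : Cᵒᵖ ⥤ Type u
  Tm : DepPresheaf Ty

namespace Family

variable {C : Type u} [Category.{u} C]

/-- For an element `x` of `F.Ty` over `Γ`, an element over `Γ` of the exponential presheaf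
`F.Tm(x) → B`: a natural operation which sends every `ρ : Δ ⟶ Γ` and every element of
`F.Tm(y)`, where `y = x[ρ]`, to an element of `B` over `Δ`. -/
@[ext]
structure Arrow (F : Family C) (B : Cᵒᵖ ⥤ Type u) {Γ : C} (x : F.Ty.obj (op Γ)) where
  app : ∀ {Δ : C} (ρ : Δ ⟶ Γ) {y : F.Ty.obj (op Δ)}, F.Ty.map ρ.op x = y →
    F.Tm.obj y → B.obj (op Δ)
  naturality : ∀ {Δ Θ : C} (ρ : Δ ⟶ Γ) (σ : Θ ⟶ Δ) {y : F.Ty.obj (op Δ)} {z : F.Ty.obj (op Θ)}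
    (hρ : F.Ty.map ρ.op x = y) (hσ : F.Ty.map σ.op y = z) (t : F.Tm.obj y),
    app (σ ≫ ρ) (map_comp_op hρ hσ) (F.Tm.map σ hσ t) = B.map σ.op (app ρ hρ t)

/-- Restriction of `A : F.Tm(x) → B` along a substitution `f`. -/
def Arrow.subst {F : Family C} {B : Cᵒᵖ ⥤ Type u} {Γ Δ : C} {x : F.Ty.obj (op Γ)}
    (A : F.Arrow B x) (f : Δ ⟶ Γ) : F.Arrow B (F.Ty.map f.op x) where
  app ρ _ h t := A.app (ρ ≫ f) (map_comp_op rfl h) t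
  naturality ρ σ _ _ hρ hσ t := by
    rw [← A.naturality (ρ ≫ f) σ _ hσ t]
    simp only [Category.assoc]

theorem Arrow.app_congr {F : Family C} {B : Cᵒᵖ ⥤ Type u} {Γ Δ : C} {x : F.Ty.obj (op Γ)}
    (A : F.Arrow B x) {ρ ρ' : Δ ⟶ Γ} (hρ : ρ = ρ') {y : F.Ty.obj (op Δ)}
    (h : F.Ty.map ρ.op x = y) (h' : F.Ty.map ρ'.op x = y) (t : F.Tm.obj y) :
    A.app ρ h t = A.app ρ' h' t := by
  subst hρ
  rfl

theorem Arrow.sigma_ext {F : Family C} {B : Cᵒᵖ ⥤ Type u} {Γ : C}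
    {P Q : Σ x : F.Ty.obj (op Γ), F.Arrow B x} (h : P.1 = Q.1)
    (h' : ∀ (Δ : C) (ρ : Δ ⟶ Γ) (y : F.Ty.obj (op Δ)) (h₁ : F.Ty.map ρ.op P.1 = y)
      (h₂ : F.Ty.map ρ.op Q.1 = y) (t : F.Tm.obj y), P.2.app ρ h₁ t = Q.2.app ρ h₂ t) :
    P = Q := by
  obtain ⟨x, A⟩ := P
  obtain ⟨y, B⟩ := Q
  dsimp only at h
  subst h
  congr 1
  ext Δ ρ y hy t
  exact h' Δ ρ y hy hy t

/-- The presheaf `(x : F.Ty) × (F.Tm(x) → B)`. -/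
def arrow (F : Family C) (B : Cᵒᵖ ⥤ Type u) : Cᵒᵖ ⥤ Type u where
  obj Γ := Σ x : F.Ty.obj (op Γ.unop), F.Arrow B x
  map f := ↾fun P ↦ ⟨F.Ty.map f.unop.op P.1, P.2.subst f.unop⟩
  map_id Γ := by
    refine ConcreteCategory.hom_ext _ _ fun P ↦ ?_
    refine Arrow.sigma_ext (F := F) (B := B) ?_ fun Δ ρ y h₁ h₂ t ↦ ?_
    · exact map_id_op P.1
    · exact P.2.app_congr (Category.comp_id ρ) _ _ t
  map_comp f g := by
    refine ConcreteCategory.hom_ext _ _ fun P ↦ ?_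
    refine Arrow.sigma_ext (F := F) (B := B) ?_ fun Δ ρ y h₁ h₂ t ↦ ?_
    · exact map_comp_op rfl rfl
    · exact P.2.app_congr (Category.assoc _ _ _).symm _ _ t

theorem arrow_fst {F : Family C} {B : Cᵒᵖ ⥤ Type u} {Γ Δ : C} {f : Δ ⟶ Γ}
    {P : (F.arrow B).obj (op Γ)} {Q : (F.arrow B).obj (op Δ)}
    (h : (F.arrow B).map f.op P = Q) : F.Ty.map f.op P.1 = Q.1 :=
  congrArg Sigma.fst h

theorem arrow_snd {F : Family C} {B : Cᵒᵖ ⥤ Type u} {Γ Δ : C} {f : Δ ⟶ Γ}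
    {P : (F.arrow B).obj (op Γ)} {Q : (F.arrow B).obj (op Δ)}
    (h : (F.arrow B).map f.op P = Q) {Θ : C} (ρ : Θ ⟶ Δ) {y : F.Ty.obj (op Θ)}
    (hy : F.Ty.map ρ.op Q.1 = y) (t : F.Tm.obj y) :
    P.2.app (ρ ≫ f) (map_comp_op (arrow_fst h) hy) t = Q.2.app ρ hy t := by
  subst h
  rfl

/-- An element over `Γ` of the dependent product `(t : F.Tm(x)) → G.Tm(A(t))`. -/
@[ext]
structure Pi {F G : Family C} {Γ : C} {x : F.Ty.obj (op Γ)} (A : F.Arrow G.Ty x) where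
  app : ∀ {Δ : C} (ρ : Δ ⟶ Γ) {y : F.Ty.obj (op Δ)} (h : F.Ty.map ρ.op x = y) (t : F.Tm.obj y),
    G.Tm.obj (A.app ρ h t)
  naturality : ∀ {Δ Θ : C} (ρ : Δ ⟶ Γ) (σ : Θ ⟶ Δ) {y : F.Ty.obj (op Δ)} {z : F.Ty.obj (op Θ)}
    (hρ : F.Ty.map ρ.op x = y) (hσ : F.Ty.map σ.op y = z) (t : F.Tm.obj y),
    app (σ ≫ ρ) (map_comp_op hρ hσ) (F.Tm.map σ hσ t) =
      G.Tm.map σ (A.naturality ρ σ hρ hσ t).symm (app ρ hρ t)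

theorem Pi.app_congr {F G : Family C} {Γ Δ : C} {x : F.Ty.obj (op Γ)} {A : F.Arrow G.Ty x}
    (s : Pi A) {ρ ρ' : Δ ⟶ Γ} (hρ : ρ = ρ') {y : F.Ty.obj (op Δ)}
    (h : F.Ty.map ρ.op x = y) (h' : F.Ty.map ρ'.op x = y) (t : F.Tm.obj y) :
    s.app ρ h t = G.Tm.map (𝟙 Δ) ((map_id_op _).trans (A.app_congr hρ.symm h' h t))
      (s.app ρ' h' t) := by
  subst hρ
  exact (G.Tm.map_id _ _).symm

/-- The family with index presheaf `(x : F.Ty) × (A : F.Tm(x) → G.Ty)` and elements the dependent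
products `(t : F.Tm(x)) → G.Tm(A(t))`. In the definition of `s[f]`, the restriction along `𝟙` is
a transport along the equality of types `A(f ∘ ρ, t) = A[f](ρ, t)`. -/
def pi (F G : Family C) : Family C where
  Ty := F.arrow G.Ty
  Tm :=
    { obj P := Pi P.2
      map f _ _ h s :=
        { app ρ _ hy t := G.Tm.map (𝟙 _) ((map_id_op _).trans (arrow_snd h ρ hy t))
            (s.app (ρ ≫ f) (map_comp_op (arrow_fst h) hy) t)
          naturality ρ σ _ _ hρ hσ t := by
            rw [s.app_congr (Category.assoc σ ρ f) _
                (map_comp_op (map_comp_op (arrow_fst h) hρ) hσ),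
              s.naturality (ρ ≫ f) σ _ hσ]
            simp only [G.Tm.map_map]
            exact G.Tm.map_congr (by simp) _ _ _ }
      map_id h s := by
        refine Pi.ext ?_
        funext Δ ρ y hy t
        dsimp only
        rw [s.app_congr (Category.comp_id ρ) _ hy, G.Tm.map_map]
        exact (G.Tm.map_congr (Category.comp_id _) _ (map_id_op _) _).trans (G.Tm.map_id _ _)
      map_map f g _ _ _ hf hg s := by
        refine Pi.ext ?_
        funext Δ ρ y hy t
        dsimp only
        rw [s.app_congr (Category.assoc ρ g f) _
          (map_comp_op (map_comp_op (arrow_fst hf) (arrow_fst hg)) hy)]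
        simp only [G.Tm.map_map]
        exact G.Tm.map_congr (by simp) _ _ _ }

theorem sigma_ext (G : Family C) {Γ : C} {T : Type u} (A : T → G.Ty.obj (op Γ))
    {s s' : Σ t : T, G.Tm.obj (A t)} (h : s.1 = s'.1)
    (h' : G.Tm.map (𝟙 Γ) (by rw [map_id_op, h]) s.2 = s'.2) : s = s' := by
  obtain ⟨t, a⟩ := s
  obtain ⟨t', a'⟩ := s'
  dsimp only at h
  subst h
  congr 1
  exact (G.Tm.map_id _ _).symm.trans h'

theorem sigma_aux {F G : Family C} {Γ Δ : C} {f : Δ ⟶ Γ}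
    {P : (F.arrow G.Ty).obj (op Γ)} {Q : (F.arrow G.Ty).obj (op Δ)}
    (h : (F.arrow G.Ty).map f.op P = Q) (t : F.Tm.obj P.1) :
    G.Ty.map f.op (P.2.app (𝟙 Γ) (map_id_op _) t) =
      Q.2.app (𝟙 Δ) (map_id_op _) (F.Tm.map f (arrow_fst h) t) := by
  rw [← P.2.naturality, ← arrow_snd h]
  exact P.2.app_congr (by simp) _ _ _

/-- The family with index presheaf `(x : F.Ty) × (A : F.Tm(x) → G.Ty)` and elements the dependent
sums `(t : F.Tm(x)) × G.Tm(A(t))`. -/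
def sigma (F G : Family C) : Family C where
  Ty := F.arrow G.Ty
  Tm :=
    { obj P := Σ t : F.Tm.obj P.1, G.Tm.obj (P.2.app (𝟙 _) (map_id_op _) t)
      map f _ _ h s := ⟨F.Tm.map f (arrow_fst h) s.1, G.Tm.map f (sigma_aux h s.1) s.2⟩
      map_id h s := by
        refine G.sigma_ext _ (F.Tm.map_id _ _) ?_
        rw [G.Tm.map_map]
        exact (G.Tm.map_congr (Category.comp_id _) _ (map_id_op _) _).trans (G.Tm.map_id _ _)
      map_map f g _ _ _ hf hg s := by
        refine G.sigma_ext _ (F.Tm.map_map ..) ?_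
        simp only [G.Tm.map_map]
        exact G.Tm.map_congr (by simp) _ _ _ }

/-- The coproduct of a collection of families. -/
def sum {ι : Type} (F : ι → Family C) : Family C where
  Ty :=
    { obj Γ := Σ i, (F i).Ty.obj Γ
      map f := ↾fun x ↦ ⟨x.1, (F x.1).Ty.map f x.2⟩ }
  Tm :=
    { obj x := (F x.1).Tm.obj x.2
      map f x _ h t :=
        Eq.rec (motive := fun y _ ↦ (F y.1).Tm.obj y.2) ((F x.1).Tm.map f rfl t) h
      map_id {Γ x} h t := by
        have key : ∀ (y : (F x.1).Ty.obj (op Γ)) (h' : (F x.1).Ty.map (𝟙 Γ).op x.2 = y)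
            (h : (⟨x.1, (F x.1).Ty.map (𝟙 Γ).op x.2⟩ : Σ i, (F i).Ty.obj (op Γ)) = ⟨x.1, y⟩),
            Eq.rec (motive := fun y _ ↦ (F y.1).Tm.obj y.2) ((F x.1).Tm.map (𝟙 Γ) rfl t) h =
              (F x.1).Tm.map (𝟙 Γ) h' t := by
          intro y h' h
          subst h'
          rfl
        exact (key x.2 (map_id_op _) h).trans ((F x.1).Tm.map_id _ _)
      map_map {Γ Δ Θ} f g x y z hf hg t := by
        subst hf
        subst hg
        have key : ∀ (y : (F x.1).Ty.obj (op Θ)) (h' : (F x.1).Ty.map (g ≫ f).op x.2 = y)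
            (h : (⟨x.1, (F x.1).Ty.map (g ≫ f).op x.2⟩ : Σ i, (F i).Ty.obj (op Θ)) = ⟨x.1, y⟩),
            Eq.rec (motive := fun y _ ↦ (F y.1).Tm.obj y.2) ((F x.1).Tm.map (g ≫ f) rfl t) h =
              (F x.1).Tm.map (g ≫ f) h' t := by
          intro y h' h
          subst h'
          rfl
        exact ((F x.1).Tm.map_map f g rfl rfl t).trans
          (key _ (map_comp_op rfl rfl) (by rw [map_comp_op rfl rfl])).symm }

/-- The family with a single index, whose elements are those of `X`. -/
def single (X : Cᵒᵖ ⥤ Type u) : Family C where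
  Ty := (Functor.const _).obj PUnit
  Tm :=
    { obj {Γ} _ := X.obj (op Γ)
      map f _ _ _ t := X.map f.op t
      map_id _ t := map_id_op t
      map_map _ _ _ _ _ _ _ _ := (map_comp_op rfl rfl).symm }

/-- The telescopes of length `n` of the family `F`. -/
def telescopeOfLength (F : Family C) : ℕ → Family C
  | 0 => single ((Functor.const _).obj PUnit)
  | n + 1 => (F.telescopeOfLength n).sigma F

/-- The family of telescopes of the family `F`. -/
def telescope (F : Family C) : Family C :=
  sum F.telescopeOfLength

end Family

/-! ### Categories with families -/

/-- A category with families: a category with a (chosen) terminal object and a family whose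
dependent presheaf of terms is locally representable, i.e. such that for every type `A` over `Γ` the
presheaf `(ρ : Δ ⟶ Γ) ↦ Tm(A[ρ])` on the slice over `Γ` is represented by (a chosen)
`p A : Γ.A ⟶ Γ`. -/
structure CwF where
  Ob : Type u
  [category : Category.{u} Ob]
  empty : Ob
  isTerminal : IsTerminal empty
  fam : Family Ob
  ext : ∀ {Γ : Ob}, fam.Ty.obj (op Γ) → Ob
  p : ∀ {Γ : Ob} (A : fam.Ty.obj (op Γ)), ext A ⟶ Γ
  extRepresents : ∀ {Γ : Ob} (A : fam.Ty.obj (op Γ)),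
    (fam.Tm.restrict A).RepresentableBy (Over.mk (p A))

namespace CwF

attribute [instance] CwF.category

/-- The types over `Γ`. -/
abbrev Ty (C : CwF.{u}) (Γ : C.Ob) : Type u := C.fam.Ty.obj (op Γ)

/-- The terms of type `A`. -/
abbrev Tm (C : CwF.{u}) {Γ : C.Ob} (A : C.Ty Γ) : Type u := C.fam.Tm.obj A

/-- The type `A[σ]`. -/
abbrev tySub (C : CwF.{u}) {Γ Δ : C.Ob} (σ : Δ ⟶ Γ) (A : C.Ty Γ) : C.Ty Δ :=
  C.fam.Ty.map σ.op A

/-- The variable term `q` of type `A[p]` over `Γ.A`, i.e. the universal element. -/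
def q (C : CwF.{u}) {Γ : C.Ob} (A : C.Ty Γ) : C.Tm (C.tySub (C.p A) A) :=
  (C.extRepresents A).homEquiv (𝟙 (Over.mk (C.p A)))

/-- Strict morphisms of CwFs: they preserve the terminal object, the context
extensions, the projections `p` and the variables `q` on the nose. -/
@[ext]
structure Hom (C D : CwF.{u}) where
  functor : C.Ob ⥤ D.Ob
  ty : ∀ {Γ : C.Ob}, C.Ty Γ → D.Ty (functor.obj Γ)
  tm : ∀ {Γ : C.Ob} {A : C.Ty Γ}, C.Tm A → D.Tm (ty A)
  ty_sub : ∀ {Γ Δ : C.Ob} (σ : Δ ⟶ Γ) (A : C.Ty Γ),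
    D.tySub (functor.map σ) (ty A) = ty (C.tySub σ A)
  tm_sub : ∀ {Γ Δ : C.Ob} (σ : Δ ⟶ Γ) {A : C.Ty Γ} {B : C.Ty Δ} (h : C.tySub σ A = B)
    (a : C.Tm A),
    D.fam.Tm.map (functor.map σ) ((ty_sub σ A).trans (congrArg ty h)) (tm a) =
      tm (C.fam.Tm.map σ h a)
  map_empty : functor.obj C.empty = D.empty
  map_ext : ∀ {Γ : C.Ob} (A : C.Ty Γ), functor.obj (C.ext A) = D.ext (ty A)
  map_p : ∀ {Γ : C.Ob} (A : C.Ty Γ),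
    eqToHom (map_ext A) ≫ D.p (ty A) = functor.map (C.p A)
  map_q : ∀ {Γ : C.Ob} (A : C.Ty Γ),
    D.fam.Tm.map (eqToHom (map_ext A))
      ((map_comp_op rfl rfl).symm.trans
        ((congrArg (fun f ↦ D.tySub f (ty A)) (map_p A)).trans (ty_sub (C.p A) A)))
      (D.q (ty A)) = tm (C.q A)

/-- The identity morphism. -/
def Hom.id (C : CwF.{u}) : Hom C C where
  functor := 𝟭 _
  ty A := A
  tm a := a
  ty_sub _ _ := rfl
  tm_sub _ _ _ _ _ := rfl
  map_empty := rfl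
  map_ext _ := rfl
  map_p A := by simp
  map_q A := C.fam.Tm.map_id _ _

/-- Composition of morphisms. -/
def Hom.comp {C D E : CwF.{u}} (F : Hom C D) (G : Hom D E) : Hom C E where
  functor := F.functor ⋙ G.functor
  ty A := G.ty (F.ty A)
  tm a := G.tm (F.tm a)
  ty_sub σ A := (G.ty_sub _ _).trans (congrArg G.ty (F.ty_sub σ A))
  tm_sub σ A B h a := (G.tm_sub _ ((F.ty_sub σ A).trans (congrArg F.ty h)) _).trans
    (congrArg G.tm (F.tm_sub σ h a))
  map_empty := (congrArg G.functor.obj F.map_empty).trans G.map_empty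
  map_ext A := (congrArg G.functor.obj (F.map_ext A)).trans (G.map_ext (F.ty A))
  map_p A := by
    rw [Functor.comp_map, ← F.map_p A, Functor.map_comp, ← G.map_p (F.ty A), eqToHom_map,
      ← Category.assoc, eqToHom_trans]
  map_q A := by
    rw [← F.map_q A, ← G.tm_sub, ← G.map_q, E.fam.Tm.map_map]
    exact E.fam.Tm.map_congr (by simp [eqToHom_map]) _ _ _

/-- The category of CwFs and strict morphisms. -/
instance : Category CwF.{u} where
  Hom := Hom
  id := Hom.id
  comp := Hom.comp
  id_comp _ := rfl
  comp_id _ := rfl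
  assoc _ _ _ := rfl

/-! ### Freely generated CwFs -/

/-- The functor sending a CwF to its set of objects. -/
def obFunctor : CwF.{u} ⥤ Type u where
  obj C := C.Ob
  map F := ↾F.functor.obj

/-- The functor sending a CwF to its set of pairs `(Γ, A)`, with `A` a type over `Γ`. -/
def tyFunctor : CwF.{u} ⥤ Type u where
  obj C := Σ Γ : C.Ob, C.Ty Γ
  map F := ↾fun A ↦ ⟨F.functor.obj A.1, F.ty A.2⟩

/-- The functor sending a CwF to its set of triples `(Γ, A, a)`, with `A` a type over `Γ` and `a`
a term of type `A`. -/
def tmFunctor : CwF.{u} ⥤ Type u where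
  obj C := Σ (Γ : C.Ob) (A : C.Ty Γ), C.Tm A
  map F := ↾fun a ↦ ⟨F.functor.obj a.1, F.ty a.2.1, F.tm a.2.2⟩

/-- The index type of the generating maps. The CwFs freely generated by an object, by a type (over
an object) and by a term (of a type over an object) are determined up to isomorphism by their
universal property, that of corepresenting the functors above, and every choice of them is
allowed. -/
inductive GeneratingMap : Type (u + 1)
  | ty (S T : CwF.{u}) (hS : obFunctor.CorepresentableBy S) (hT : tyFunctor.CorepresentableBy T)
  | tm (S T : CwF.{u}) (hS : tyFunctor.CorepresentableBy S) (hT : tmFunctor.CorepresentableBy T)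

/-- The source of a generating map: `Free(Γ : Ob)`, respectively `Free(A : Ty Γ)`. -/
def GeneratingMap.source : GeneratingMap.{u} → CwF.{u}
  | ty S _ _ _ => S
  | tm S _ _ _ => S

/-- The target of a generating map: `Free(A : Ty Γ)`, respectively `Free(a : Tm A)`. -/
def GeneratingMap.target : GeneratingMap.{u} → CwF.{u}
  | ty _ T _ _ => T
  | tm _ T _ _ => T

/-- The generating maps: the map `Free(Γ : Ob) ⟶ Free(A : Ty Γ)` sending the generating object to
the object underlying the generating type, and the map `Free(A : Ty Γ) ⟶ Free(a : Tm A)` sending the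
generating type to the type of the generating term. -/
def GeneratingMap.hom : (i : GeneratingMap.{u}) → (i.source ⟶ i.target)
  | ty _ T hS hT => hS.homEquiv.symm (hT.homEquiv (𝟙 T)).1
  | tm _ T hS hT => hS.homEquiv.symm ⟨(hT.homEquiv (𝟙 T)).1, (hT.homEquiv (𝟙 T)).2.1⟩

/-- A CwF `C` is freely generated if the map from the initial CwF to `C` is the composition of a
sequence, indexed by the natural numbers, of pushouts of (small) coproducts of generating maps. -/
def IsCellular (C : CwF.{u}) : Prop :=
  ∃ (Z : CwF.{u}) (hZ : IsInitial Z),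
    Nonempty (HomotopicalAlgebra.RelativeCellComplex.{u} (J := ℕ)
      (fun _ ↦ GeneratingMap.hom.{u}) (hZ.to C))

/-! ### Polynomial sorts -/

/-- The two kinds of basic sorts. -/
inductive BasicSortKind
  | ty
  | tm

/-- The family of basic sorts: a basic sort is either the sort `ty`, whose elements are the types,
or a sort `tm(A)` for a type `A`, whose elements are the terms of type `A`. -/
def basicSort (C : CwF.{u}) : Family C.Ob :=
  Family.sum fun k : BasicSortKind ↦
    match k with
    | .ty => Family.single C.fam.Ty
    | .tm => C.fam

/-- The family of monomial sorts `[Δ ⊢ A]`, where `Δ` is a telescope of types and `A` a basic sort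
depending on `Δ`; its elements are the dependent functions `(δ : Tm⋆(Δ)) → Elem(A(δ))`. -/
def monomialSort (C : CwF.{u}) : Family C.Ob :=
  C.fam.telescope.pi C.basicSort

/-- The family of polynomial sorts: the telescopes of monomial sorts. -/
def polynomialSort (C : CwF.{u}) : Family C.Ob :=
  C.monomialSort.telescope

/-- Familial representability of `Elem(P)` for all closed polynomial sorts `P`. -/
def HasFamiliallyRepresentablePolynomialSorts (C : CwF.{u}) : Prop :=
  ∀ P : C.polynomialSort.Ty.sections, IsFamiliallyRepresentable (C.polynomialSort.Tm.atGlobal P)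

/-- Local familial representability of the family of polynomial sorts. -/
def HasLocallyFamiliallyRepresentablePolynomialSorts (C : CwF.{u}) : Prop :=
  C.polynomialSort.Tm.IsLocallyFamiliallyRepresentable

end CwF

/-! In a freely generated CwF, types and terms are first-order expressions over a signature with one
symbol per generator, and two of them are equal only if the expressions are. An element over Θ of a
monomial sort [Δ ⊢ A] is a type or term in the extension of Θ by Δ, that is, an expression in two
kinds of variables: those of Θ, which substitutions may change, and those of Δ, which they leave
fixed and which are called parameters.

To generalize such an expression, every maximal parameter-free subterm is replaced by a fresh
variable, while parameters, symbols governing parameters and heads of types are kept. Keeping a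
parameter or a term symbol requires its type to agree with the prescribed one. The given expression
shows that these two types are unifiable, so first-order unification with an occurs check
(`exists_isUniversal_unifier`) solves the constraint in the most general way. This gives
`exists_isGeneric`.

The syntax is obtained without constructing free CwFs. Contexts, types and terms of C equipped with
raw expressions representing them form a CwF over C, to which the generators lift: a generator is
represented by its symbol applied to all variables. Cellularity then provides a section
(`exists_presentation`), that is, a strictly natural choice of expressions. The choice is faithful
because an expression represents at most one thing, and every well-sorted expression is realized
(`exists_of_hasSort`).

Unification eliminates variables without regard to their order, so it works with unordered contexts.
Order is restored by a weight for which a term outweighs its arguments and its type: pulled back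
along a morphism from an actual context, it decreases strictly from a variable to the variables in
its type (`exists_rank`, `exists_iso`).

Strict naturality comes from asking generic elements to be universal for all elements having a
common instance with them. The set of generic generalizations is then the same for x and x[σ], and
choosing from the set is strictly natural (`isFamiliallyRepresentable_of_exists`). Finally, generic
elements pass to dependent sums (`hasGenerics_sigma`), hence from monomial to polynomial sorts. -/

section CellLifting

-- Lifting against relative cell complexes.

universe w v v' t

variable {E : Type v'} [Category.{v} E] {α : Type t} {A B : α → E} {cell : ∀ i, A i ⟶ B i}

/-- Lifting through a map along the attachment of cells, keeping track of the lifts of the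
cells. -/
theorem HomotopicalAlgebra.AttachCells.exists_lift {X₁ X₂ D Y : E} {f : X₁ ⟶ X₂}
    (c : AttachCells.{w} cell f) (p : D ⟶ Y) (y : X₂ ⟶ Y) (s : X₁ ⟶ D) (hs : s ≫ p = f ≫ y)
    (Q : ∀ i : c.ι, (B (c.π i) ⟶ D) → Prop)
    (H : ∀ (i : c.ι) (v : A (c.π i) ⟶ D), v ≫ p = cell (c.π i) ≫ c.cell i ≫ y →
      ∃ w, cell (c.π i) ≫ w = v ∧ w ≫ p = c.cell i ≫ y ∧ Q i w) :
    ∃ s' : X₂ ⟶ D, f ≫ s' = s ∧ s' ≫ p = y ∧ ∀ i, Q i (c.cell i ≫ s') := by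
  have hcell (i : c.ι) : cell (c.π i) ≫ c.cell i = c.cofan₁.inj i ≫ c.g₁ ≫ f := by
    rw [AttachCells.cell_def, c.isPushout.w, ← Category.assoc, ← c.hm, Category.assoc]
  choose w hw₁ hw₂ hw₃ using fun i ↦ H i (c.cofan₁.inj i ≫ c.g₁ ≫ s) (by
    rw [← Category.assoc (cell _), hcell]
    simp only [Category.assoc, hs])
  -- The chosen lifts of the cells agree with `s` on the boundaries, so they glue along the pushout.
  have hsq : c.g₁ ≫ s = c.m ≫ Cofan.IsColimit.desc c.isColimit₂ w := by
    refine Cofan.IsColimit.hom_ext c.isColimit₁ _ _ fun i ↦ ?_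
    rw [← Category.assoc (Cofan.inj c.cofan₁ i) c.m, c.hm, Category.assoc,
      Cofan.IsColimit.fac, hw₁]
  refine ⟨c.isPushout.desc s _ hsq, c.isPushout.inl_desc _ _ _, ?_, fun i ↦ ?_⟩
  · refine c.hom_ext ?_ fun i ↦ ?_
    · rw [← Category.assoc, c.isPushout.inl_desc, hs]
    · rw [← hw₂ i, c.cell_def, Category.assoc, ← Category.assoc c.g₂, c.isPushout.inr_desc,
        ← Category.assoc, Cofan.IsColimit.fac]
  · rw [c.cell_def, Category.assoc, c.isPushout.inr_desc, Cofan.IsColimit.fac]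
    exact hw₃ i

/-- A map to the target of a relative cell complex has a section as soon as its source and its
cells lift; the section restricts on the cells to such lifts. -/
theorem HomotopicalAlgebra.RelativeCellComplex.exists_section {X Y D : E} {f : X ⟶ Y}
    (c : RelativeCellComplex.{w} (J := ℕ) (fun _ ↦ cell) f) (p : D ⟶ Y) (u : X ⟶ D)
    (hu : u ≫ p = f) (Q : ∀ γ : c.Cells, (B γ.i ⟶ D) → Prop)
    (H : ∀ (γ : c.Cells) (v : A γ.i ⟶ D), v ≫ p = cell γ.i ≫ γ.ι →
      ∃ w, cell γ.i ≫ w = v ∧ w ≫ p = γ.ι ∧ Q γ w) :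
    ∃ s : Y ⟶ D, s ≫ p = 𝟙 Y ∧ ∀ γ, Q γ (γ.ι ≫ s) := by
  have hmax (n : ℕ) : ¬ IsMax n := not_isMax n
  have hincl (m n : ℕ) (h : m ≤ n) : c.F.map (homOfLE h) ≫ c.incl.app n = c.incl.app m :=
    (c.incl.naturality (homOfLE h)).trans (Category.comp_id _)
  have step (n : ℕ) (s : c.F.obj n ⟶ D) (hs : s ≫ p = c.incl.app n) :
      ∃ s' : c.F.obj (n + 1) ⟶ D, s' ≫ p = c.incl.app (n + 1) ∧
        c.F.map (homOfLE (Nat.le_succ n)) ≫ s' = s ∧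
        ∀ k, Q ⟨n, hmax n, k⟩ ((c.attachCells n (hmax n)).cell k ≫ s') := by
    obtain ⟨s', h₁, h₂, h₃⟩ := (c.attachCells n (hmax n)).exists_lift p (c.incl.app (n + 1)) s
      (hs.trans (hincl n (n + 1) (Nat.le_succ n)).symm)
      (fun k ↦ Q ⟨n, hmax n, k⟩) fun i v hv ↦ H ⟨n, hmax n, i⟩ v hv
    exact ⟨s', h₂, h₁, h₃⟩
  choose next hn₁ hn₂ hn₃ using step
  -- Each lift extends the previous one, so the lifts form a cocone on the sequence.
  let S : ∀ n : ℕ, {s : c.F.obj n ⟶ D // s ≫ p = c.incl.app n} := fun n ↦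
    Nat.rec ⟨c.isoBot.hom ≫ u, by
      rw [Category.assoc, hu]
      exact (congrArg (c.isoBot.hom ≫ ·) c.fac).symm.trans (Iso.hom_inv_id_assoc _ _)⟩
      (fun n s ↦ ⟨next n s.1 s.2, hn₁ n s.1 s.2⟩) n
  have hS (m n : ℕ) (h : m ≤ n) : c.F.map (homOfLE h) ≫ (S n).1 = (S m).1 := by
    induction n, h using Nat.le_induction with
    | base => exact (congrArg (· ≫ (S m).1) (c.F.map_id m)).trans (Category.id_comp _)
    | succ n h ih =>
      rw [← ih, ← hn₂ n (S n).1 (S n).2, ← Category.assoc, ← Functor.map_comp]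
      rfl
  let cc : Cocone c.F :=
    { pt := D
      ι := { app := fun n ↦ (S n).1
             naturality := fun m n h ↦ (hS m n (leOfHom h)).trans (Category.comp_id _).symm } }
  have hfac (n : ℕ) : c.incl.app n ≫ c.isColimit.desc cc = (S n).1 := c.isColimit.fac cc n
  refine ⟨c.isColimit.desc cc, ?_, fun ⟨n, hn, k⟩ ↦ ?_⟩
  · refine c.isColimit.hom_ext fun n ↦ ?_
    change c.incl.app n ≫ c.isColimit.desc cc ≫ p = c.incl.app n ≫ 𝟙 Y
    rw [← Category.assoc, hfac, (S n).2]
    exact (Category.comp_id _).symm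
  · have := hn₃ n (S n).1 (S n).2 k
    have h2 : ((c.attachCells n hn).cell k ≫ c.incl.app (n + 1)) ≫ c.isColimit.desc cc =
        (c.attachCells n hn).cell k ≫ (S (n + 1)).1 :=
      (Category.assoc _ _ _).trans (congrArg _ (hfac (n + 1)))
    exact h2 ▸ this

end CellLifting

/-! ### Generators of a freely generated CwF. -/

namespace CwF

/-- Lifting property of a map of CwFs `p : D ⟶ C` with respect to a set of types of `C`, with lifts
required to be `good`. -/
def LiftsTypes {C D : CwF.{u}} (p : D ⟶ C) (gen : Set (tyFunctor.obj C))
    (good : tyFunctor.obj D → Prop) : Prop :=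
  ∀ y ∈ gen, ∀ x : D.Ob, p.functor.obj x = y.1 →
    ∃ z : tyFunctor.obj D, z.1 = x ∧ tyFunctor.map p z = y ∧ good z

/-- Lifting property of a map of CwFs `p : D ⟶ C` with respect to a set of terms of `C`, with lifts
required to be `good`. -/
def LiftsTerms {C D : CwF.{u}} (p : D ⟶ C) (gen : Set (tmFunctor.obj C))
    (good : tmFunctor.obj D → Prop) : Prop :=
  ∀ y ∈ gen, ∀ x : tyFunctor.obj D, tyFunctor.map p x = ⟨y.1, y.2.1⟩ →
    ∃ z : tmFunctor.obj D, (⟨z.1, z.2.1⟩ : tyFunctor.obj D) = x ∧ tmFunctor.map p z = y ∧ good z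

/-- By corepresentability a map out of `S` is an object and a map out of `T` is a type.
Precomposition with the generating map reads off the underlying object (`key`), so a lifting problem
against it amounts to lifting one type over a prescribed object. -/
theorem LiftsTypes.exists_lift {C D S T : CwF.{u}} {p : D ⟶ C} {gen : Set (tyFunctor.obj C)}
    {good : tyFunctor.obj D → Prop} (l : LiftsTypes p gen good)
    (hS : obFunctor.CorepresentableBy S) (hT : tyFunctor.CorepresentableBy T) (e : T ⟶ C)
    (he : hT.homEquiv e ∈ gen) (v : S ⟶ D)
    (hv : v ≫ p = GeneratingMap.hom (.ty S T hS hT) ≫ e) :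
    ∃ w : T ⟶ D, GeneratingMap.hom (.ty S T hS hT) ≫ w = v ∧ w ≫ p = e ∧
      good (hT.homEquiv w) := by
  have key {X : CwF.{u}} (g : T ⟶ X) : hS.homEquiv (GeneratingMap.hom (.ty S T hS hT) ≫ g) =
      (hT.homEquiv g).1 := by
    have h₁ : hS.homEquiv (GeneratingMap.hom (.ty S T hS hT)) = (hT.homEquiv (𝟙 T)).1 :=
      hS.homEquiv.apply_symm_apply _
    have h₂ := hT.homEquiv_comp g (𝟙 T)
    rw [Category.id_comp] at h₂
    refine ((hS.homEquiv_comp g _).trans (congrArg _ h₁)).trans ?_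
    rw [h₂]
    rfl
  obtain ⟨z, hz₁, hz₂, hz₃⟩ := l _ he (hS.homEquiv v)
    ((hS.homEquiv_comp p v).symm.trans ((congrArg hS.homEquiv hv).trans (key e)))
  refine ⟨hT.homEquiv.symm z, hS.homEquiv.injective ?_, hT.homEquiv.injective ?_, ?_⟩
  · refine (key _).trans ?_
    rw [Equiv.apply_symm_apply, hz₁]
  · rw [hT.homEquiv_comp, Equiv.apply_symm_apply, hz₂]
  · rwa [Equiv.apply_symm_apply]

theorem LiftsTerms.exists_lift {C D S T : CwF.{u}} {p : D ⟶ C} {gen : Set (tmFunctor.obj C)}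
    {good : tmFunctor.obj D → Prop} (l : LiftsTerms p gen good)
    (hS : tyFunctor.CorepresentableBy S) (hT : tmFunctor.CorepresentableBy T) (e : T ⟶ C)
    (he : hT.homEquiv e ∈ gen) (v : S ⟶ D)
    (hv : v ≫ p = GeneratingMap.hom (.tm S T hS hT) ≫ e) :
    ∃ w : T ⟶ D, GeneratingMap.hom (.tm S T hS hT) ≫ w = v ∧ w ≫ p = e ∧
      good (hT.homEquiv w) := by
  have key {X : CwF.{u}} (g : T ⟶ X) : hS.homEquiv (GeneratingMap.hom (.tm S T hS hT) ≫ g) =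
      ⟨(hT.homEquiv g).1, (hT.homEquiv g).2.1⟩ := by
    have h₁ : hS.homEquiv (GeneratingMap.hom (.tm S T hS hT)) =
        ⟨(hT.homEquiv (𝟙 T)).1, (hT.homEquiv (𝟙 T)).2.1⟩ :=
      hS.homEquiv.apply_symm_apply _
    have h₂ := hT.homEquiv_comp g (𝟙 T)
    rw [Category.id_comp] at h₂
    refine ((hS.homEquiv_comp g _).trans (congrArg _ h₁)).trans ?_
    rw [h₂]
    rfl
  obtain ⟨z, hz₁, hz₂, hz₃⟩ := l _ he (hS.homEquiv v)
    ((hS.homEquiv_comp p v).symm.trans ((congrArg hS.homEquiv hv).trans (key e)))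
  refine ⟨hT.homEquiv.symm z, hS.homEquiv.injective ?_, hT.homEquiv.injective ?_, ?_⟩
  · refine (key _).trans ?_
    rw [Equiv.apply_symm_apply, hz₁]
  · rw [hT.homEquiv_comp, Equiv.apply_symm_apply, hz₂]
  · rwa [Equiv.apply_symm_apply]

/-- A freely generated CwF has generating types and terms, along which sections can be built. -/
theorem IsCellular.exists_generators {C : CwF.{u}} (hC : C.IsCellular) :
    ∃ (genTy : Set (tyFunctor.obj C)) (genTm : Set (tmFunctor.obj C)),
      ∀ (D : CwF.{u}) (p : D ⟶ C) (goodTy : tyFunctor.obj D → Prop)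
        (goodTm : tmFunctor.obj D → Prop),
        LiftsTypes p genTy goodTy → LiftsTerms p genTm goodTm →
        ∃ s : C ⟶ D, s ≫ p = 𝟙 C ∧ (∀ y ∈ genTy, goodTy (tyFunctor.map s y)) ∧
          ∀ y ∈ genTm, goodTm (tmFunctor.map s y) := by
  obtain ⟨Z, hZ, ⟨c⟩⟩ := hC
  let genTy : Set (tyFunctor.obj C) := {y | ∃ (γ : c.Cells) (S T : CwF.{u})
    (hS : obFunctor.CorepresentableBy S) (hT : tyFunctor.CorepresentableBy T)
    (h : γ.i = .ty S T hS hT), y = hT.homEquiv (eqToHom (by rw [h]; rfl) ≫ γ.ι)}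
  let genTm : Set (tmFunctor.obj C) := {y | ∃ (γ : c.Cells) (S T : CwF.{u})
    (hS : tyFunctor.CorepresentableBy S) (hT : tmFunctor.CorepresentableBy T)
    (h : γ.i = .tm S T hS hT), y = hT.homEquiv (eqToHom (by rw [h]; rfl) ≫ γ.ι)}
  refine ⟨genTy, genTm, fun D p goodTy goodTm lTy lTm ↦ ?_⟩
  obtain ⟨s, hs, hQ⟩ := c.exists_section p (hZ.to D) (hZ.hom_ext _ _)
    (fun γ w ↦
      (∀ S T hS hT (h : γ.i = .ty S T hS hT), goodTy (hT.homEquiv (eqToHom (by rw [h]; rfl) ≫ w))) ∧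
      ∀ S T hS hT (h : γ.i = .tm S T hS hT), goodTm (hT.homEquiv (eqToHom (by rw [h]; rfl) ≫ w)))
    (fun γ v hv ↦ by
      have hTy : ∀ S T hS hT (h : γ.i = .ty S T hS hT),
        hT.homEquiv (eqToHom (by rw [h]; rfl) ≫ γ.ι) ∈ genTy :=
        fun S T hS hT h ↦ ⟨γ, S, T, hS, hT, h, rfl⟩
      have hTm : ∀ S T hS hT (h : γ.i = .tm S T hS hT),
        hT.homEquiv (eqToHom (by rw [h]; rfl) ≫ γ.ι) ∈ genTm :=
        fun S T hS hT h ↦ ⟨γ, S, T, hS, hT, h, rfl⟩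
      -- Once the index of the cell is a free variable, case analysis on it turns the `eqToHom`
      -- casts into identities.
      revert v hTy hTm
      generalize γ.ι = e
      revert e
      generalize γ.i = i
      intro e v hv hTy hTm
      cases i with
      | ty S T hS hT =>
        obtain ⟨w, h₁, h₂, h₃⟩ := lTy.exists_lift hS hT e
          ((Category.id_comp e) ▸ (hTy S T hS hT rfl :)) v hv
        refine ⟨w, h₁, h₂, fun _ _ _ _ h ↦ ?_, (fun _ _ _ _ h ↦ by cases h)⟩
        cases h
        exact (Category.id_comp w).symm ▸ h₃
      | tm S T hS hT =>
        obtain ⟨w, h₁, h₂, h₃⟩ := lTm.exists_lift hS hT e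
          ((Category.id_comp e) ▸ (hTm S T hS hT rfl :)) v hv
        refine ⟨w, h₁, h₂, (fun _ _ _ _ h ↦ by cases h), fun _ _ _ _ h ↦ ?_⟩
        cases h
        exact (Category.id_comp w).symm ▸ h₃)
  refine ⟨s, hs, ?_, ?_⟩
  · rintro _ ⟨γ, S, T, hS, hT, h, rfl⟩
    rw [← hT.homEquiv_comp, Category.assoc]
    exact (hQ γ).1 S T hS hT h
  · rintro _ ⟨γ, S, T, hS, hT, h, rfl⟩
    rw [← hT.homEquiv_comp, Category.assoc]
    exact (hQ γ).2 S T hS hT h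

end CwF

/-! ### Raw expressions -/

/-- Raw expressions over a set of symbols `K`, with variables in `V`. A symbol is applied to
a sequence of arguments, which are expected to be `bad` beyond the arity of the symbol. -/
inductive Raw (K : Type u) (V : Type) : Type u
  | bad : Raw K V
  | var (v : V) : Raw K V
  | app (k : K) (args : ℕ → Raw K V) : Raw K V

namespace Raw

variable {K : Type u} {V W X : Type}

/-- Simultaneous substitution. -/
def subst (f : V → Raw K W) : Raw K V → Raw K W
  | bad => bad
  | var v => f v
  | app k args => app k fun i ↦ (args i).subst f

/-- The variable `v` occurs in an expression. -/
def Occurs (v : V) : Raw K V → Prop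
  | bad => False
  | var w => w = v
  | app _ args => ∃ i, (args i).Occurs v

/-- The evaluation of an expression into natural numbers. -/
def eval (F : K → (ℕ → ℕ) → ℕ) (m : V → ℕ) : Raw K V → ℕ
  | bad => 0
  | var v => m v
  | app k args => F k fun i ↦ (args i).eval F m

@[simp] theorem subst_bad (f : V → Raw K W) : bad.subst f = bad := rfl
@[simp] theorem subst_var (f : V → Raw K W) (v : V) : (var v).subst f = f v := rfl
@[simp] theorem subst_app (f : V → Raw K W) (k : K) (args : ℕ → Raw K V) :
    (app k args).subst f = app k fun i ↦ (args i).subst f := rfl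

theorem subst_subst (f : V → Raw K W) (g : W → Raw K X) (r : Raw K V) :
    (r.subst f).subst g = r.subst fun v ↦ (f v).subst g := by
  induction r with
  | bad => rfl
  | var v => rfl
  | app k args ih => simp [ih]

theorem subst_congr {f g : V → Raw K W} {r : Raw K V} (h : ∀ v, r.Occurs v → f v = g v) :
    r.subst f = r.subst g := by
  induction r with
  | bad => rfl
  | var v => exact h v rfl
  | app k args ih =>
    simp only [subst_app, app.injEq, true_and]
    funext i
    exact ih i fun v hv ↦ h v ⟨i, hv⟩

theorem subst_eq_self {f : V → Raw K V} {r : Raw K V} (h : ∀ v, r.Occurs v → f v = var v) :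
    r.subst f = r := by
  induction r with
  | bad => rfl
  | var v => exact h v rfl
  | app k args ih =>
    simp only [subst_app, app.injEq, true_and]
    funext i
    exact ih i fun v hv ↦ h v ⟨i, hv⟩

theorem occurs_subst {f : V → Raw K W} {r : Raw K V} {w : W} :
    (r.subst f).Occurs w ↔ ∃ v, r.Occurs v ∧ (f v).Occurs w := by
  induction r with
  | bad => simp [Occurs]
  | var v => simp [Occurs]
  | app k args ih =>
    simp only [subst_app, Occurs, ih]
    grind

theorem eval_subst (F : K → (ℕ → ℕ) → ℕ) (m : W → ℕ) (f : V → Raw K W) (r : Raw K V) :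
    (r.subst f).eval F m = r.eval F fun v ↦ (f v).eval F m := by
  induction r with
  | bad => rfl
  | var v => rfl
  | app k args ih => simp [eval, ih]

theorem eval_congr (F : K → (ℕ → ℕ) → ℕ) {m m' : V → ℕ} {r : Raw K V}
    (h : ∀ v, r.Occurs v → m v = m' v) : r.eval F m = r.eval F m' := by
  induction r with
  | bad => rfl
  | var v => exact h v rfl
  | app k args ih =>
    simp only [eval]
    congr 1
    funext i
    exact ih i fun v hv ↦ h v ⟨i, hv⟩

/-- The relation of being a direct subexpression. -/
def DirectSub (r s : Raw K V) : Prop :=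
  ∃ k args i, s = app k args ∧ r = args i

/-- Raw expressions may branch infinitely and have no size in ℕ, so the occurs check rests on
well-foundedness instead. -/
theorem wellFounded_directSub : WellFounded (DirectSub (K := K) (V := V)) := by
  refine ⟨fun r ↦ ?_⟩
  induction r with
  | bad => exact ⟨_, fun _ ⟨_, _, _, h, _⟩ ↦ by cases h⟩
  | var v => exact ⟨_, fun _ ⟨_, _, _, h, _⟩ ↦ by cases h⟩
  | app k args ih =>
    refine ⟨_, fun r ⟨k', args', i, h, h'⟩ ↦ ?_⟩
    cases h
    exact h' ▸ ih i

theorem subst_transGen {f : V → Raw K W} {x : V} {s : Raw K V} (hx : s.Occurs x)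
    (hs : s ≠ var x) : Relation.TransGen DirectSub (f x) (s.subst f) := by
  induction s with
  | bad => exact hx.elim
  | var v => exact absurd (congrArg var hx) hs
  | app k args ih =>
    obtain ⟨i, hi⟩ := hx
    have hd : DirectSub ((args i).subst f) ((app k args).subst f) := ⟨k, _, i, rfl, rfl⟩
    by_cases h : args i = var x
    · exact .single (by simpa [h] using hd)
    · exact (ih i hi h).tail hd

/-- The occurs check. -/
theorem subst_ne_of_occurs {f : V → Raw K W} {x : V} {s : Raw K V} (hx : s.Occurs x)
    (hs : s ≠ var x) : f x ≠ s.subst f := fun h ↦ by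
  have h₁ := subst_transGen (f := f) hx hs
  rw [← h] at h₁
  exact (wellFounded_directSub.transGen).irrefl.irrefl _ h₁

end Raw

/-! ### Sorted expressions -/

/-- A signature: every valid symbol has an arity, types for its arguments, and either is
a type symbol or has a type. -/
structure Signature (K : Type u) where
  valid : K → Prop
  arity : K → ℕ
  ar : K → ℕ → Raw K ℕ
  out : K → Option (Raw K ℕ)

namespace Signature

open Raw

variable {K : Type u} (Sg : Signature K) {V W X : Type}

/-- `Sg.HasSort Γ r none` states that `r` is a type in the context `Γ` and
`Sg.HasSort Γ r (some A)` states that it is a term of type `A`. Contexts are unordered. -/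
inductive HasSort (Γ : V → Option (Raw K V)) : Raw K V → Option (Raw K V) → Prop
  | var {v : V} {A : Raw K V} : Γ v = some A → HasSort Γ (var v) (some A)
  | app {k : K} {args : ℕ → Raw K V} {S : Option (Raw K V)} : Sg.valid k →
      (∀ i < Sg.arity k, HasSort Γ (args i) (some ((Sg.ar k i).subst args))) →
      (∀ i, Sg.arity k ≤ i → args i = bad) →
      S = (Sg.out k).map (subst args) → HasSort Γ (app k args) S

/-- The context of the arguments of a symbol. -/
def argCtx (k : K) (i : ℕ) : Option (Raw K ℕ) := if i < Sg.arity k then some (Sg.ar k i) else none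

/-- The conditions on a signature, which involve a measure `F`. -/
structure IsWf (F : K → (ℕ → ℕ) → ℕ) : Prop where
  ar_occurs {k : K} {i j : ℕ} : Sg.valid k → i < Sg.arity k → (Sg.ar k i).Occurs j → j < i
  out_occurs {k : K} {A : Raw K ℕ} {j : ℕ} : Sg.valid k → Sg.out k = some A → A.Occurs j →
    j < Sg.arity k
  ar_hasSort {k : K} {i : ℕ} : Sg.valid k → i < Sg.arity k →
    Sg.HasSort (Sg.argCtx k) (Sg.ar k i) none
  out_hasSort {k : K} {A : Raw K ℕ} : Sg.valid k → Sg.out k = some A →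
    Sg.HasSort (Sg.argCtx k) A none
  arg_lt {k : K} {i : ℕ} (m : ℕ → ℕ) : Sg.valid k → i < Sg.arity k → m i < F k m
  out_lt {k : K} {A : Raw K ℕ} (m : ℕ → ℕ) : Sg.valid k → Sg.out k = some A → A.eval F m < F k m

variable {Sg}

/-- Only the variables occurring in `r` have to be sent to well-typed terms. This also covers
substitutions that discard the parameters, applied to parameter-free expressions. -/
theorem HasSort.subst {Γ : V → Option (Raw K V)} {Δ : W → Option (Raw K W)} {r : Raw K V}
    {S : Option (Raw K V)} {f : V → Raw K W} (hr : Sg.HasSort Γ r S)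
    (hf : ∀ v, r.Occurs v → ∀ A, Γ v = some A → Sg.HasSort Δ (f v) (some (A.subst f))) :
    Sg.HasSort Δ (r.subst f) (S.map (Raw.subst f)) := by
  induction hr with
  | var h => exact hf _ rfl _ h
  | @app k args S hk _ hbad hS ih =>
    refine .app hk (fun i hi ↦ ?_) (fun i hi ↦ by simp [hbad i hi]) ?_
    · have := ih i hi fun v hv ↦ hf v ⟨i, hv⟩
      simpa [subst_subst] using this
    · subst hS
      simp [Function.comp_def, subst_subst]

theorem HasSort.exists_of_occurs {Γ : V → Option (Raw K V)} {r : Raw K V}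
    {S : Option (Raw K V)} (hr : Sg.HasSort Γ r S) {v : V} (hv : r.Occurs v) :
    ∃ A, Γ v = some A := by
  induction hr with
  | var h => exact ⟨_, hv ▸ h⟩
  | @app k args S hk _ hbad hS ih =>
    obtain ⟨i, hi⟩ := hv
    by_cases h : i < Sg.arity k
    · exact ih i h hi
    · rw [hbad i (not_lt.1 h)] at hi
      exact hi.elim

/-- For a variable this is the hypothesis on `m`, for an application it is `out_lt`. That terms
outweigh their types is what later excludes cyclic dependencies between variables. -/
theorem HasSort.eval_lt {F : K → (ℕ → ℕ) → ℕ} (hSg : Sg.IsWf F) {Γ : V → Option (Raw K V)}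
    {m : V → ℕ} (hm : ∀ v A, Γ v = some A → A.eval F m < m v) {r A : Raw K V}
    (hr : Sg.HasSort Γ r (some A)) : A.eval F m < r.eval F m := by
  cases hr with
  | var h => exact hm _ _ h
  | @app k args _ hk _ _ hS =>
    obtain ⟨B, hB, rfl⟩ : ∃ B, Sg.out k = some B ∧ A = B.subst args := by
      cases h : Sg.out k <;> simp_all
    rw [eval_subst]
    exact hSg.out_lt _ hk hB

theorem HasSort.le_eval {F : K → (ℕ → ℕ) → ℕ} (hSg : Sg.IsWf F) {Γ : V → Option (Raw K V)}
    {m : V → ℕ} {r : Raw K V} {S : Option (Raw K V)}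
    (hr : Sg.HasSort Γ r S) {v : V} (hv : r.Occurs v) : m v ≤ r.eval F m := by
  induction hr with
  | var h => exact hv ▸ le_rfl
  | @app k args S hk _ hbad hS ih =>
    obtain ⟨i, hi⟩ := hv
    by_cases h : i < Sg.arity k
    · exact (ih i h hi).trans (hSg.arg_lt (fun i ↦ (args i).eval F m) hk h).le
    · rw [hbad i (not_lt.1 h)] at hi
      exact hi.elim

end Signature

namespace Signature

open Raw

variable {K : Type u} (Sg : Signature K) {V : Type} (P : Set V)

/-! ### Contexts with parameters

We fix a set `P` of variables, the parameters, which substitutions are not allowed to change or to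
introduce. -/

/-- The expression `r` does not depend on the parameters. -/
def Base (r : Raw K V) : Prop := ∀ v, r.Occurs v → v ∉ P

/-- The substitution `f` fixes the parameters and does not introduce new ones. -/
structure PSub (f : V → Raw K V) : Prop where
  param : ∀ v ∈ P, f v = var v
  base : ∀ v ∉ P, Base P (f v)

/-- The substitution `f` is a morphism from `Δ` to `Γ`: it maps every variable of `Γ` to a term in
`Δ` of the correct type, and identifies the parameters of `Δ` and of `Γ`. -/
structure Mor (Δ Γ : V → Option (Raw K V)) (f : V → Raw K V) : Prop extends PSub P f where
  eq_bad : ∀ v ∉ P, Γ v = none → f v = bad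
  hasSort' : ∀ v ∉ P, ∀ A, Γ v = some A → Sg.HasSort Δ (f v) (some (A.subst f))
  map_param : ∀ v ∈ P, Δ v = (Γ v).map (subst f)

/-- A context with parameters is well formed if it has finitely many variables and well-formed
types, such that the types of the variables do not depend on the parameters. -/
structure WfCtx (Γ : V → Option (Raw K V)) : Prop where
  finite : {v | v ∉ P ∧ Γ v ≠ none}.Finite
  hasSort : ∀ v A, Γ v = some A → Sg.HasSort Γ A none
  base : ∀ v ∉ P, ∀ A, Γ v = some A → Base P A

/-- The composition of substitutions. -/
def comp (g f : V → Raw K V) (v : V) : Raw K V := (g v).subst f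

open Classical in
/-- The identity substitution of a context. -/
noncomputable def idSub (Γ : V → Option (Raw K V)) (v : V) : Raw K V :=
  if v ∈ P ∨ Γ v ≠ none then var v else bad

variable {Sg P}

theorem subst_comp (g f : V → Raw K V) (r : Raw K V) :
    r.subst (comp g f) = (r.subst g).subst f := (subst_subst _ _ _).symm

theorem comp_assoc (h g f : V → Raw K V) : comp (comp h g) f = comp h (comp g f) :=
  funext fun _ ↦ subst_subst _ _ _

theorem Base.subst {f : V → Raw K V} (hf : PSub P f) {r : Raw K V} (hr : Base P r) :
    Base P (r.subst f) := by
  intro w hw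
  obtain ⟨v, hv, hw⟩ := occurs_subst.1 hw
  exact hf.base v (hr v hv) w hw

/-- Parameters are fixed by `f`, so a parameter occurring in `r` survives in the substituted
expression. -/
theorem PSub.base_of_subst {f : V → Raw K V} (hf : PSub P f) {r : Raw K V}
    (hr : Base P (r.subst f)) : Base P r := by
  intro v hv hvP
  refine hr v (occurs_subst.2 ⟨v, hv, ?_⟩) hvP
  rw [hf.param v hvP]
  rfl

theorem PSub.comp {f g : V → Raw K V} (hg : PSub P g) (hf : PSub P f) : PSub P (comp g f) where
  param v hv := by simp [Signature.comp, hg.param v hv, hf.param v hv]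
  base v hv := (hg.base v hv).subst hf

variable {Γ Δ Θ : V → Option (Raw K V)} {f g : V → Raw K V}

theorem Mor.hasSort (hf : Sg.Mor P Δ Γ f) {v : V} {A : Raw K V} (h : Γ v = some A) :
    Sg.HasSort Δ (f v) (some (A.subst f)) := by
  by_cases hv : v ∈ P
  · rw [hf.param v hv]
    exact .var (by rw [hf.map_param v hv, h]; rfl)
  · exact hf.hasSort' v hv A h

theorem HasSort.map {r : Raw K V} {S : Option (Raw K V)} (hr : Sg.HasSort Γ r S)
    (hf : Sg.Mor P Δ Γ f) : Sg.HasSort Δ (r.subst f) (S.map (Raw.subst f)) :=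
  hr.subst fun _ _ _ h ↦ hf.hasSort h

theorem Mor.comp (hg : Sg.Mor P Δ Γ g) (hf : Sg.Mor P Θ Δ f) : Sg.Mor P Θ Γ (comp g f) where
  toPSub := hg.toPSub.comp hf.toPSub
  eq_bad v hv h := by simp [Signature.comp, hg.eq_bad v hv h]
  hasSort' v hv A h := by
    rw [subst_comp]
    exact (hg.hasSort h).map hf
  map_param v hv := by
    rw [hf.map_param v hv, hg.map_param v hv, Option.map_map]
    congr 1
    funext r
    exact (subst_comp _ _ _).symm

theorem HasSort.subst_idSub {r : Raw K V} {S : Option (Raw K V)} (hr : Sg.HasSort Γ r S) :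
    r.subst (idSub P Γ) = r :=
  subst_eq_self fun v hv ↦ by
    obtain ⟨A, hA⟩ := hr.exists_of_occurs hv
    simp [idSub, hA]

theorem Mor.id (hΓ : Sg.WfCtx P Γ) : Sg.Mor P Γ Γ (idSub P Γ) where
  param v hv := by simp [idSub, hv]
  base v hv := by
    intro w hw
    unfold idSub at hw
    split_ifs at hw
    · exact (show v = w from hw) ▸ hv
    · exact hw.elim
  eq_bad v hv h := by simp [idSub, hv, h]
  hasSort' v hv A h := by
    rw [(hΓ.hasSort v A h).subst_idSub]
    simpa [idSub, h] using HasSort.var h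
  map_param v hv := by
    cases h : Γ v with
    | none => rfl
    | some A => simp [(hΓ.hasSort v A h).subst_idSub]

theorem Mor.idSub_comp (hf : Sg.Mor P Δ Γ f) : Signature.comp (idSub P Γ) f = f := by
  funext v
  unfold Signature.comp idSub
  split_ifs with h
  · rfl
  · push Not at h
    exact (hf.eq_bad v h.1 h.2).symm

/-- The type of an application is built from its arguments and mentions no other variables; for a
variable the claim is part of well-formedness of the context. -/
theorem HasSort.base_sort (hΓ : Sg.WfCtx P Γ)
    {r A : Raw K V} (hr : Sg.HasSort Γ r (some A)) (h : Base P r) : Base P A := by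
  cases hr with
  | @var v _ hv => exact hΓ.base v (h v rfl) A hv
  | @app k args _ hk _ _ hS =>
    obtain ⟨B, hB, rfl⟩ : ∃ B, Sg.out k = some B ∧ A = B.subst args := by
      cases h : Sg.out k <;> simp_all
    intro w hw
    obtain ⟨j, _, hw⟩ := occurs_subst.1 hw
    exact h w ⟨j, hw⟩

/-! ### Unification -/

variable (Sg P) in
/-- `ι : Γ₀ ⟶ Γ` is universal among the morphisms to `Γ` satisfying the condition `E`. -/
structure IsUniversal (Γ : V → Option (Raw K V)) (E : (V → Raw K V) → Prop)
    (Γ₀ : V → Option (Raw K V)) (ι : V → Raw K V) : Prop where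
  wf : Sg.WfCtx P Γ₀
  mor : Sg.Mor P Γ₀ Γ ι
  cond : E ι
  univ : ∀ W g, Sg.Mor P W Γ g → E g → ∃! k, Sg.Mor P W Γ₀ k ∧ g = comp ι k

theorem isUniversal_id (hΓ : Sg.WfCtx P Γ) {E : (V → Raw K V) → Prop}
    (hE : ∀ W g, Sg.Mor P W Γ g → E g) : Sg.IsUniversal P Γ E Γ (idSub P Γ) where
  wf := hΓ
  mor := .id hΓ
  cond := hE _ _ (.id hΓ)
  univ W g hg _ := ⟨g, ⟨hg, hg.idSub_comp.symm⟩, fun k ⟨hk, h⟩ ↦ by rw [h, hk.idSub_comp]⟩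

/-- Constraints can be solved one after the other, the second being imposed on morphisms into the
solution of the first. Since `E` is arbitrary, its stability under `ι₂` has to be supplied as `hE`.
-/
theorem IsUniversal.trans {E E' : (V → Raw K V) → Prop}
    {Γ₁ Γ₂ : V → Option (Raw K V)} {ι₁ ι₂ : V → Raw K V} (h₁ : Sg.IsUniversal P Γ E Γ₁ ι₁)
    (h₂ : Sg.IsUniversal P Γ₁ (fun g ↦ E' (comp ι₁ g)) Γ₂ ι₂) (hE : E (comp ι₁ ι₂)) :
    Sg.IsUniversal P Γ (fun g ↦ E g ∧ E' g) Γ₂ (comp ι₁ ι₂) where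
  wf := h₂.wf
  mor := h₁.mor.comp h₂.mor
  cond := ⟨hE, h₂.cond⟩
  univ W g hg hEg := by
    obtain ⟨k₁, ⟨hk₁, rfl⟩, u₁⟩ := h₁.univ W g hg hEg.1
    obtain ⟨k₂, ⟨hk₂, rfl⟩, u₂⟩ := h₂.univ W k₁ hk₁ hEg.2
    refine ⟨k₂, ⟨hk₂, (comp_assoc _ _ _).symm⟩, fun k ⟨hk, h⟩ ↦ u₂ k ⟨hk, ?_⟩⟩
    exact (u₁ _ ⟨h₂.mor.comp hk, by rw [h, comp_assoc]⟩).symm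

open Classical in
/-- Elimination of a variable. -/
theorem exists_isUniversal_elim (hΓ : Sg.WfCtx P Γ) {x : V} (hx : x ∉ P) {s A : Raw K V}
    (hA : Γ x = some A) (hs : Sg.HasSort Γ s (some A)) (hb : Base P s) (hxs : ¬ s.Occurs x) :
    ∃ Γ₀ ι, Sg.IsUniversal P Γ (fun g ↦ g x = s.subst g) Γ₀ ι := by
  -- The variable `x` leaves the context and `s` takes its place. The variables of `s` may well have
  -- been declared after `x`; this is harmless as contexts are unordered.
  let θ : V → Raw K V := fun v ↦ if v = x then s else idSub P Γ v
  let Γ₀ : V → Option (Raw K V) := fun v ↦ if v = x then none else (Γ v).map (subst θ)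
  have hθx : θ x = s := by simp [θ]
  have hθ {v : V} (hv : v ≠ x) : θ v = idSub P Γ v := by simp [θ, hv]
  have hθs : s.subst θ = s := subst_eq_self fun v hv ↦ by
    obtain ⟨B, hB⟩ := hs.exists_of_occurs hv
    rw [hθ fun h ↦ hxs (h ▸ hv)]
    simp [idSub, hB]
  have htyped {v : V} {B : Raw K V} (hv : v ≠ x) (hB : Γ v = some B) :
      Sg.HasSort Γ₀ (θ v) (some (B.subst θ)) := by
    rw [hθ hv, idSub, if_pos (.inr (by simp [hB]))]
    exact .var (by simp [Γ₀, hv, hB])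
  have hps : PSub P θ := by
    refine ⟨fun v hv ↦ ?_, fun v hv ↦ ?_⟩
    · have : v ≠ x := fun h ↦ hx (h ▸ hv)
      rw [hθ this, (Mor.id hΓ).param v hv]
    · by_cases h : v = x
      · rw [h, hθx]
        exact hb
      · rw [hθ h]
        exact (Mor.id hΓ).base v hv
  have hmor : Sg.Mor P Γ₀ Γ θ :=
    { toPSub := hps
      eq_bad := fun v hv h ↦ by
        have : v ≠ x := fun h' ↦ by rw [h', hA] at h; cases h
        rw [hθ this, (Mor.id hΓ).eq_bad v hv h]
      hasSort' := fun v hv B hB ↦ by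
        by_cases h : v = x
        · subst h
          obtain rfl : A = B := by rw [hA] at hB; exact Option.some.inj hB
          rw [hθx]
          have := hs.subst (f := θ) (Δ := Γ₀) fun w hw C hC ↦ htyped (fun h ↦ hxs (h ▸ hw)) hC
          rwa [hθs] at this
        · exact htyped h hB
      map_param := fun v hv ↦ by
        have : v ≠ x := fun h ↦ hx (h ▸ hv)
        simp [Γ₀, this] }
  refine ⟨Γ₀, θ, ⟨?_, hmor, ?_, fun W g hg hE ↦ ?_⟩⟩
  · refine ⟨hΓ.finite.subset fun v ⟨hv, h⟩ ↦ ⟨hv, fun h' ↦ h (by simp [Γ₀, h'])⟩, fun v B h ↦ ?_,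
      fun v hv B h ↦ ?_⟩
    · by_cases hvx : v = x
      · simp [Γ₀, hvx] at h
      · simp only [Γ₀, hvx, if_false, Option.map_eq_some_iff] at h
        obtain ⟨B', hB', rfl⟩ := h
        exact (hΓ.hasSort v B' hB').map hmor
    · by_cases hvx : v = x
      · simp [Γ₀, hvx] at h
      · simp only [Γ₀, hvx, if_false, Option.map_eq_some_iff] at h
        obtain ⟨B', hB', rfl⟩ := h
        exact (hΓ.base v hv B' hB').subst hps
  · rw [hθx, hθs]
  -- The factorization is `g` itself, except at `x`, which is no longer a variable of `Γ₀` and must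
  -- be sent to `bad`.
  · let k : V → Raw K V := fun v ↦ if v = x then bad else g v
    have hk {v : V} (hv : v ≠ x) : k v = g v := by simp [k, hv]
    have hgk : g = comp θ k := by
      funext v
      by_cases hv : v = x
      · subst hv
        change g v = (θ v).subst k
        rw [hθx, hE]
        exact subst_congr fun w hw ↦ (hk fun h ↦ hxs (h ▸ hw)).symm
      · change g v = (θ v).subst k
        rw [hθ hv]
        unfold idSub
        split_ifs with h
        · exact (hk hv).symm
        · push Not at h
          exact hg.eq_bad v h.1 h.2
    refine ⟨k, ⟨⟨⟨fun v hv ↦ ?_, fun v hv ↦ ?_⟩, fun v hv h ↦ ?_, fun v hv B h ↦ ?_,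
      fun v hv ↦ ?_⟩, hgk⟩, fun k' ⟨hk', h⟩ ↦ ?_⟩
    · rw [hk fun h ↦ hx (h ▸ hv), hg.param v hv]
    · by_cases h : v = x
      · simp only [k, h, if_true]
        exact fun _ h ↦ h.elim
      · rw [hk h]
        exact hg.base v hv
    · by_cases hvx : v = x
      · simp [k, hvx]
      · rw [hk hvx]
        exact hg.eq_bad v hv (by simpa [Γ₀, hvx] using h)
    · by_cases hvx : v = x
      · simp [Γ₀, hvx] at h
      · simp only [Γ₀, hvx, if_false, Option.map_eq_some_iff] at h
        obtain ⟨B', hB', rfl⟩ := h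
        rw [hk hvx, ← subst_comp, ← hgk]
        exact hg.hasSort hB'
    · have hvx : v ≠ x := fun h ↦ hx (h ▸ hv)
      simp only [Γ₀, hvx, if_false, Option.map_map]
      rw [hg.map_param v hv]
      congr 1
      funext r
      rw [hgk, subst_comp]
      rfl
    · funext v
      by_cases hv : v = x
      · subst hv
        simp only [k, if_true]
        exact hk'.eq_bad v hx (by simp [Γ₀])
      · rw [hk hv, h]
        change _ = (θ v).subst k'
        rw [hθ hv]
        unfold idSub
        split_ifs with h'
        · rfl
        · push Not at h'
          exact hk'.eq_bad v h'.1 (by simp [Γ₀, hv, h'.2])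

/-- The unifier `f` guarantees both side conditions of the elimination: `x` cannot occur properly in
`s`, by the occurs check, and `s` contains no parameter because `f x` contains none. -/
theorem exists_isUniversal_var (hΓ : Sg.WfCtx P Γ) {x : V} (hx : x ∉ P) {s A : Raw K V}
    (hA : Γ x = some A) (hs : Sg.HasSort Γ s (some A)) (hf : Sg.Mor P Δ Γ f)
    (h : f x = s.subst f) :
    ∃ Γ₀ ι, Sg.IsUniversal P Γ (fun g ↦ g x = s.subst g) Γ₀ ι := by
  by_cases hsx : s = var x
  · exact ⟨_, _, isUniversal_id hΓ fun W g _ ↦ by rw [hsx]; rfl⟩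
  · refine exists_isUniversal_elim hΓ hx hA hs ?_ fun hocc ↦ subst_ne_of_occurs hocc hsx h
    exact hf.toPSub.base_of_subst (h ▸ hf.base x hx)

/-- Unifiable expressions of the same sort have a most general unifier. -/
theorem exists_isUniversal_unifier {F : K → (ℕ → ℕ) → ℕ} (hSg : Sg.IsWf F) (hΓ : Sg.WfCtx P Γ)
    {s s' : Raw K V}
    {S : Option (Raw K V)} (hs : Sg.HasSort Γ s S) (hs' : Sg.HasSort Γ s' S)
    (hf : Sg.Mor P Δ Γ f) (h : s.subst f = s'.subst f) :
    ∃ Γ₀ ι, Sg.IsUniversal P Γ (fun g ↦ s.subst g = s'.subst g) Γ₀ ι := by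
  -- The induction is on the common instance. Unlike `s` and `s'`, which grow under the
  -- substitutions computed on the way, its subexpressions stay the same.
  obtain ⟨u, hu⟩ : ∃ u, u = s.subst f := ⟨_, rfl⟩
  induction u generalizing Γ s s' S f with
  | bad =>
    have := (hs.map hf)
    rw [← hu] at this
    cases this
  | var y =>
    cases hs with
    | app => cases hu
    | @var v A hv =>
      cases hs' with
      | app => exact absurd (hu.trans h) (by simp)
      | @var v' _ hv' =>
        simp only [subst_var] at hu h
        by_cases hvP : v ∈ P
        · by_cases hvP' : v' ∈ P
          · rw [hf.param v hvP, hf.param v' hvP'] at h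
            cases h
            exact ⟨_, _, isUniversal_id hΓ fun W g _ ↦ rfl⟩
          -- This branch is vacuous, since a parameter and a variable have no common instance, but
          -- the general lemma applies all the same.
          · obtain ⟨Γ₀, ι, H⟩ := exists_isUniversal_var hΓ hvP' hv' (.var hv) hf h.symm
            exact ⟨Γ₀, ι, by simpa only [subst_var, eq_comm] using H⟩
        · exact exists_isUniversal_var hΓ hvP hv (.var hv') hf h
  | app k args ih =>
    cases hs with
    | @var v A hv =>
      by_cases hvP : v ∈ P
      · simp [hf.param v hvP] at hu
      · exact exists_isUniversal_var hΓ hvP hv hs' hf h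
    | @app k₁ a _ hk ha hbad hS =>
      cases hs' with
      | @var v A hv =>
        by_cases hvP : v ∈ P
        · simp [hf.param v hvP] at h
        · obtain ⟨Γ₀, ι, H⟩ := exists_isUniversal_var hΓ hvP hv (.app hk ha hbad hS) hf h.symm
          exact ⟨Γ₀, ι, by simpa only [subst_var, eq_comm] using H⟩
      | @app k₂ b _ hk' hb hbad' hS' =>
        simp only [subst_app, app.injEq] at hu h
        obtain ⟨rfl, hu⟩ := hu
        obtain ⟨rfl, h⟩ := h
        have key (n : ℕ) (hn : n ≤ Sg.arity k) : ∃ Γ₀ ι, Sg.IsUniversal P Γ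
            (fun g ↦ ∀ i < n, (a i).subst g = (b i).subst g) Γ₀ ι := by
          induction n with
          | zero => exact ⟨_, _, isUniversal_id hΓ fun _ _ _ i hi ↦ by omega⟩
          | succ n ihn =>
            obtain ⟨Γ₁, ι₁, H₁⟩ := ihn (by omega)
            obtain ⟨e, ⟨he, rfl⟩, -⟩ := H₁.univ _ f hf fun i _ ↦ congrFun h i
            have h₁ := (ha n hn).map H₁.mor
            have h₂ := (hb n hn).map H₁.mor
            simp only [Option.map_some, subst_subst] at h₁ h₂
            -- The type of the n-th argument depends only on earlier arguments, which `ι₁` has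
            -- identified. Both n-th arguments thus acquire the same sort and can be unified.
            rw [subst_congr (g := fun v ↦ (a v).subst ι₁) fun i hi ↦
              (H₁.cond i (hSg.ar_occurs hk hn hi)).symm] at h₂
            obtain ⟨Γ₂, ι₂, H₂⟩ := ih n H₁.wf h₁ h₂ he
              (by simpa only [subst_comp] using congrFun h n)
              (by simpa only [subst_comp] using congrFun hu n)
            simp only [← subst_comp] at H₂
            have H := H₁.trans (E' := fun g ↦ (a n).subst g = (b n).subst g) H₂
              (fun i hi ↦ by rw [subst_comp, subst_comp, H₁.cond i hi])
            refine ⟨_, _, ⟨H.wf, H.mor, fun i hi ↦ ?_, fun W g hg hE ↦ H.univ W g hg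
              ⟨fun i hi ↦ hE i (by omega), hE n (by omega)⟩⟩⟩
            rcases Nat.lt_succ_iff_lt_or_eq.1 hi with hi | rfl
            exacts [H.cond.1 i hi, H.cond.2]
        obtain ⟨Γ₀, ι, H⟩ := key _ le_rfl
        refine ⟨Γ₀, ι, ⟨H.wf, H.mor, ?_, fun W g hg hE ↦ H.univ W g hg fun i _ ↦ ?_⟩⟩
        · simp only [subst_app, app.injEq, true_and]
          funext i
          by_cases hi : i < Sg.arity k
          · exact H.cond i hi
          · rw [hbad i (not_lt.1 hi), hbad' i (not_lt.1 hi)]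
        · simp only [subst_app, app.injEq, true_and] at hE
          exact congrFun hE i

end Signature

namespace Signature

open Raw

variable {K : Type u} {Sg : Signature K} {V : Type} {P : Set V}
  {Γ Δ Θ : V → Option (Raw K V)} {f g : V → Raw K V}

/-! ### Most general generalizations -/

variable (P) in
/-- Two expressions are similar if they have a common instance. -/
def Similar (r s : Raw K V) : Prop := ∃ f g, PSub P f ∧ PSub P g ∧ r.subst f = s.subst g

variable (Sg P) in
/-- `(Γ₀, g, r₀)`, where `g : Γ₀ ⟶ Γ` and `r₀` is an expression of sort `S[g]`, is a most general
such triple. -/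
structure IsGeneric (Γ : V → Option (Raw K V)) (S : Option (Raw K V))
    (Γ₀ : V → Option (Raw K V)) (g : V → Raw K V) (r₀ : Raw K V) : Prop where
  wf : Sg.WfCtx P Γ₀
  mor : Sg.Mor P Γ₀ Γ g
  hasSort : Sg.HasSort Γ₀ r₀ (S.map (subst g))
  univ : ∀ W ρ w, Sg.WfCtx P W → Sg.Mor P W Γ ρ → Sg.HasSort W w (S.map (subst ρ)) →
    Similar P w r₀ → ∃! k, Sg.Mor P W Γ₀ k ∧ ρ = comp g k ∧ r₀.subst k = w

variable (Sg P) in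
/-- The analogue of `IsGeneric` for a sequence of `n` arguments of the symbol `s`. -/
structure IsGenericArgs (s : K) (n : ℕ) (Γ Γ₀ : V → Option (Raw K V)) (g : V → Raw K V)
    (a₀ : ℕ → Raw K V) : Prop where
  wf : Sg.WfCtx P Γ₀
  mor : Sg.Mor P Γ₀ Γ g
  hasSort : ∀ i < n, Sg.HasSort Γ₀ (a₀ i) (some ((Sg.ar s i).subst a₀))
  eq_bad : ∀ i, n ≤ i → a₀ i = bad
  univ : ∀ W ρ a, Sg.WfCtx P W → Sg.Mor P W Γ ρ →
    (∀ i < n, Sg.HasSort W (a i) (some ((Sg.ar s i).subst a))) →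
    (∃ f f', PSub P f ∧ PSub P f' ∧ ∀ i < n, (a i).subst f = (a₀ i).subst f') →
    ∃! k, Sg.Mor P W Γ₀ k ∧ ρ = comp g k ∧ ∀ i < n, (a₀ i).subst k = a i

open Classical in
/-- A term which does not depend on the parameters is generalized by a fresh variable. -/
theorem exists_isGeneric_of_base (hP : ∀ s : Set V, s.Finite → ∃ z ∉ P, z ∉ s)
    (hΓ : Sg.WfCtx P Γ) {A : Raw K V} (hA : Sg.HasSort Γ A none) (hb : Base P A)
    (hf : Sg.Mor P Θ Γ f) {r : Raw K V} (hr : Sg.HasSort Θ r (some (A.subst f)))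
    (hrb : Base P r) :
    ∃ Γ₀ g r₀ h, Sg.IsGeneric P Γ (some A) Γ₀ g r₀ ∧ Sg.Mor P Θ Γ₀ h ∧ f = comp g h ∧
      r = r₀.subst h := by
  obtain ⟨z, hzP, hz⟩ := hP _ hΓ.finite
  have hz : Γ z = none := by
    by_contra h
    exact hz ⟨hzP, h⟩
  have hne {v : V} {B : Raw K V} (h : Γ v = some B) : v ≠ z := by
    rintro rfl
    rw [hz] at h
    cases h
  let Γ₀ : V → Option (Raw K V) := fun v ↦ if v = z then some A else Γ v
  have hΓ₀ {v : V} (h : v ≠ z) : Γ₀ v = Γ v := by simp [Γ₀, h]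
  have hΓ₀z : Γ₀ z = some A := by simp [Γ₀]
  have weaken {r : Raw K V} {S} (hr : Sg.HasSort Γ r S) : Sg.HasSort Γ₀ r S := by
    induction hr with
    | var h => exact .var (by rw [hΓ₀ (hne h), h])
    | app hk _ hbad hS ih => exact .app hk ih hbad hS
  have hid := Mor.id hΓ
  have hmor : Sg.Mor P Γ₀ Γ (idSub P Γ) :=
    { toPSub := hid.toPSub
      eq_bad := hid.eq_bad
      hasSort' := fun v hv B hB ↦ weaken (hid.hasSort' v hv B hB)
      map_param := fun v hv ↦ by
        rw [hΓ₀ fun h ↦ hzP (h ▸ hv)]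
        exact hid.map_param v hv }
  have extend {W : V → Option (Raw K V)} {ρ : V → Raw K V} {w : Raw K V} (hρ : Sg.Mor P W Γ ρ)
      (hw : Sg.HasSort W w (some (A.subst ρ))) (hwb : Base P w) :
      Sg.Mor P W Γ₀ (fun v ↦ if v = z then w else ρ v) ∧
        ρ = comp (idSub P Γ) (fun v ↦ if v = z then w else ρ v) := by
    have key {B : Raw K V} {S} (hB : Sg.HasSort Γ B S) :
        B.subst (fun v ↦ if v = z then w else ρ v) = B.subst ρ :=
      subst_congr fun v hv ↦ by
        obtain ⟨C, hC⟩ := hB.exists_of_occurs hv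
        simp [hne hC]
    refine ⟨⟨⟨fun v hv ↦ ?_, fun v hv ↦ ?_⟩, fun v hv h ↦ ?_, fun v hv B h ↦ ?_, fun v hv ↦ ?_⟩, ?_⟩
    · have : v ≠ z := fun h ↦ hzP (h ▸ hv)
      simp [this, hρ.param v hv]
    · by_cases h : v = z
      · simpa [h] using hwb
      · simpa [h] using hρ.base v hv
    · by_cases hvz : v = z
      · simp [Γ₀, hvz] at h
      · simp only [hvz, if_false]
        exact hρ.eq_bad v hv (by rwa [hΓ₀ hvz] at h)
    · by_cases hvz : v = z
      · subst hvz
        rw [hΓ₀z] at h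
        cases h
        simpa [key hA] using hw
      · rw [hΓ₀ hvz] at h
        simpa [hvz, key (hΓ.hasSort v B h)] using hρ.hasSort h
    · have : v ≠ z := fun h ↦ hzP (h ▸ hv)
      rw [hΓ₀ this, hρ.map_param v hv]
      cases h : Γ v with
      | none => rfl
      | some B => simp [key (hΓ.hasSort v B h)]
    · funext v
      unfold comp idSub
      split_ifs with h
      · have : v ≠ z := by
          rintro rfl
          exact h.elim hzP fun h ↦ h hz
        simp [this]
      · push Not at h
        exact hρ.eq_bad v h.1 h.2
  refine ⟨Γ₀, idSub P Γ, var z, fun v ↦ if v = z then r else f v, ⟨?_, hmor, ?_, ?_⟩,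
    (extend hf hr hrb).1, (extend hf hr hrb).2, by simp⟩
  · refine ⟨(hΓ.finite.union (Set.finite_singleton z)).subset fun v ⟨hv, h⟩ ↦ ?_, fun v B h ↦ ?_,
      fun v hv B h ↦ ?_⟩
    · by_cases hvz : v = z
      · exact .inr hvz
      · exact .inl ⟨hv, by rwa [hΓ₀ hvz] at h⟩
    · by_cases hvz : v = z
      · rw [hvz, hΓ₀z] at h
        cases h
        exact weaken hA
      · rw [hΓ₀ hvz] at h
        exact weaken (hΓ.hasSort v B h)
    · by_cases hvz : v = z
      · rw [hvz, hΓ₀z] at h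
        cases h
        exact hb
      · rw [hΓ₀ hvz] at h
        exact hΓ.base v hv B h
  · refine .var ?_
    rw [hΓ₀z, hA.subst_idSub]
  · rintro W ρ w hW hρ hw ⟨f', g', hf', hg', h⟩
    -- An instance of `w` is an instance of the variable `z`, which has no parameters; and a
    -- parameter in `w` would persist.
    have hwb : Base P w := hf'.base_of_subst (h ▸ hg'.base z hzP)
    refine ⟨_, ⟨(extend hρ hw hwb).1, (extend hρ hw hwb).2, by simp⟩, fun k ⟨hk, h₁, h₂⟩ ↦ ?_⟩
    funext v
    by_cases hvz : v = z
    · simpa [hvz] using h₂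
    · simp only [hvz, if_false]
      rw [h₁]
      unfold comp idSub
      split_ifs with h'
      · rfl
      · push Not at h'
        exact hk.eq_bad v h'.1 (by rw [hΓ₀ hvz, h'.2])

theorem args_congr {F : K → (ℕ → ℕ) → ℕ} (hSg : Sg.IsWf F) {k : K} (hk : Sg.valid k) {i : ℕ}
    (hi : i < Sg.arity k) {W : Type} {a b : ℕ → Raw K W} (h : ∀ j < i, a j = b j) :
    (Sg.ar k i).subst a = (Sg.ar k i).subst b :=
  subst_congr fun _ hj ↦ h _ (hSg.ar_occurs hk hi hj)

/-- Every expression is an instance of a generic one. -/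
theorem exists_isGeneric {F : K → (ℕ → ℕ) → ℕ} (hSg : Sg.IsWf F)
    (hP : ∀ s : Set V, s.Finite → ∃ z ∉ P, z ∉ s) (hΓ : Sg.WfCtx P Γ) {S : Option (Raw K V)}
    (hS : ∀ A, S = some A → Sg.HasSort Γ A none) (hΘ : Sg.WfCtx P Θ) (hf : Sg.Mor P Θ Γ f)
    {r : Raw K V} (hr : Sg.HasSort Θ r (S.map (subst f))) :
    ∃ Γ₀ g r₀ h, Sg.IsGeneric P Γ S Γ₀ g r₀ ∧ Sg.Mor P Θ Γ₀ h ∧ f = comp g h ∧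
      r = r₀.subst h := by
  -- Context and sort vary, because each argument is generalized over the context produced by the
  -- preceding ones.
  induction r generalizing Γ S f with
  | bad => cases hr
  | var y =>
    cases S with
    | none => cases hr
    | some A =>
    by_cases hy : y ∈ P
    -- A parameter is only generalized by itself. What remains is to unify its type in `Γ` with the
    -- prescribed type `A`.
    · have hA := hS A rfl
      cases hr with
      | var hr =>
      have hr' := hf.map_param y hy
      rw [hr] at hr'
      obtain ⟨B, hB, hAB⟩ : ∃ B, Γ y = some B ∧ A.subst f = B.subst f := by
        cases h : Γ y <;> simp_all
      obtain ⟨Γ₀, ι, H⟩ := exists_isUniversal_unifier hSg hΓ hA (hΓ.hasSort y B hB) hf hAB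
      obtain ⟨h, ⟨hh, e⟩, -⟩ := H.univ _ f hf hAB
      refine ⟨Γ₀, ι, var y, h, ⟨H.wf, H.mor, ?_, ?_⟩, hh, e, (hh.param y hy).symm⟩
      · refine .var ?_
        rw [H.mor.map_param y hy, hB, H.cond]
        rfl
      · rintro W ρ w hW hρ hw ⟨f', g', hf', hg', e'⟩
        -- Applications stay applications, and other variables are sent to parameter-free
        -- expressions, so only the parameter `y` has `y` as an instance.
        have hwy : w = var y := by
          simp only [subst_var, hg'.param y hy] at e'
          cases hw with
          | app => simp at e'
          | @var v _ hv =>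
            by_cases hvP : v ∈ P
            · simpa [hf'.param v hvP] using e'
            · exact absurd hy (hf'.base v hvP y (by rw [show f' v = var y from e']; rfl))
        subst hwy
        have hwA : A.subst ρ = B.subst ρ := by
          cases hw with
          | var hw =>
          rw [hρ.map_param y hy, hB] at hw
          exact (Option.some.inj hw).symm
        obtain ⟨k, ⟨hk, e₁⟩, u⟩ := H.univ W ρ hρ hwA
        exact ⟨k, ⟨hk, e₁, hk.param y hy⟩, fun k' h' ↦ u k' ⟨h'.1, h'.2.1⟩⟩
    · have hb : Base P (var y : Raw K V) := fun v hv ↦ (show y = v from hv) ▸ hy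
      exact exists_isGeneric_of_base hP hΓ (hS A rfl)
        (hf.toPSub.base_of_subst (hr.base_sort hΘ hb)) hf hr hb
  | app s args ih =>
    -- A parameter-free term becomes a fresh variable. Otherwise the expression is a type or
    -- involves a parameter; no variable can stand for it and its head symbol is kept.
    by_cases hbase : S ≠ none ∧ Base P (app s args)
    · obtain ⟨A, rfl⟩ := Option.ne_none_iff_exists'.1 hbase.1
      exact exists_isGeneric_of_base hP hΓ (hS A rfl)
        (hf.toPSub.base_of_subst (hr.base_sort hΘ hbase.2)) hf hr hbase.2
    cases hr with
    | app hk hargs hbad hout =>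
    have key (n : ℕ) (hn : n ≤ Sg.arity s) : ∃ Γ₀ g a₀ h, Sg.IsGenericArgs P s n Γ Γ₀ g a₀ ∧
        Sg.Mor P Θ Γ₀ h ∧ f = comp g h ∧ ∀ i < n, args i = (a₀ i).subst h := by
      induction n with
      | zero =>
        refine ⟨Γ, idSub P Γ, fun _ ↦ bad, f, ⟨hΓ, .id hΓ, fun i hi ↦ by omega, fun _ _ ↦ rfl, ?_⟩,
          hf, hf.idSub_comp.symm, fun i hi ↦ by omega⟩
        intro W ρ a hW hρ _ _
        exact ⟨ρ, ⟨hρ, hρ.idSub_comp.symm, fun i hi ↦ by omega⟩,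
          fun k ⟨hk, e, _⟩ ↦ by rw [e, hk.idSub_comp]⟩
      | succ n ihn =>
        obtain ⟨Γ₁, g₁, a₁, h₁, H₁, hh₁, rfl, e₁⟩ := ihn (by omega)
        have hT : Sg.HasSort Γ₁ ((Sg.ar s n).subst a₁) none := by
          refine (hSg.ar_hasSort hk hn).subst (f := a₁) fun i hi A hA ↦ ?_
          have hin := hSg.ar_occurs hk hn hi
          simp only [argCtx, show i < Sg.arity s by omega, if_true, Option.some.injEq] at hA
          exact hA ▸ H₁.hasSort i hin
        obtain ⟨Γ₂, g₂, r₂, h₂, H₂, hh₂, rfl, e₂⟩ := ih n H₁.wf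
          (S := some ((Sg.ar s n).subst a₁)) (by rintro _ ⟨⟩; exact hT) hh₁ (by
            have := hargs n hn
            rw [args_congr hSg hk hn (b := fun j ↦ (a₁ j).subst h₁) e₁] at this
            rwa [Option.map_some, subst_subst])
        -- The earlier arguments are moved along `g₂` into the context where the n-th one has been
        -- generalized.
        let a₂ : ℕ → Raw K V := fun i ↦ if i = n then r₂ else (a₁ i).subst g₂
        have ha₂ {i : ℕ} (hi : i < n) : a₂ i = (a₁ i).subst g₂ := by simp [a₂, hi.ne]
        have ha₂n : a₂ n = r₂ := by simp [a₂]
        refine ⟨Γ₂, comp g₁ g₂, a₂, h₂, ⟨H₂.wf, H₁.mor.comp H₂.mor, fun i hi ↦ ?_, fun i hi ↦ ?_,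
          ?_⟩, hh₂, comp_assoc _ _ _ |>.symm, fun i hi ↦ ?_⟩
        · rw [args_congr hSg hk (show i < Sg.arity s by omega)
            (b := fun j ↦ (a₁ j).subst g₂) fun j hj ↦ ha₂ (by omega), ← subst_subst]
          rcases Nat.lt_succ_iff_lt_or_eq.1 hi with hi | rfl
          · rw [ha₂ hi]
            exact (H₁.hasSort i hi).map H₂.mor
          · rw [ha₂n]
            exact H₂.hasSort
        · simp [a₂, show i ≠ n by omega, H₁.eq_bad i (by omega)]
        · rintro W ρ a hW hρ ha ⟨f', g', hf', hg', e'⟩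
          obtain ⟨k₁, ⟨hk₁, rfl, e₃⟩, u₁⟩ := H₁.univ W ρ a hW hρ (fun i hi ↦ ha i (by omega))
            ⟨f', comp g₂ g', hf', H₂.mor.toPSub.comp hg', fun i hi ↦ by
              rw [e' i (by omega), ha₂ hi, subst_comp]⟩
          obtain ⟨k₂, ⟨hk₂, rfl, e₄⟩, u₂⟩ := H₂.univ W k₁ (a n) hW hk₁ (by
              have := ha n (by omega)
              rw [args_congr hSg hk hn (b := fun j ↦ (a₁ j).subst k₁)
                fun j hj ↦ (e₃ j hj).symm] at this
              rwa [Option.map_some, subst_subst])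
            ⟨f', g', hf', hg', by rw [e' n (by omega), ha₂n]⟩
          refine ⟨k₂, ⟨hk₂, (comp_assoc _ _ _).symm, fun i hi ↦ ?_⟩, fun k ⟨hk, e₅, e₆⟩ ↦ ?_⟩
          · rcases Nat.lt_succ_iff_lt_or_eq.1 hi with hi | rfl
            · rw [ha₂ hi, ← subst_comp, e₃ i hi]
            · rw [ha₂n, e₄]
          · refine u₂ k ⟨hk, (u₁ _ ⟨H₂.mor.comp hk, ?_, fun i hi ↦ ?_⟩).symm, ?_⟩
            · rw [e₅, comp_assoc]
            · rw [subst_comp, ← ha₂ hi, e₆ i (by omega)]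
            · rw [← ha₂n, e₆ n (by omega)]
        · rcases Nat.lt_succ_iff_lt_or_eq.1 hi with hi | rfl
          · rw [ha₂ hi, ← subst_comp, e₁ i hi]
          · rw [ha₂n, e₂]
    obtain ⟨Γ₁, g₁, a₁, h₁, H₁, hh₁, rfl, e₁⟩ := key _ le_rfl
    have e₁' : args = fun i ↦ (a₁ i).subst h₁ := by
      funext i
      by_cases hi : i < Sg.arity s
      · exact e₁ i hi
      · rw [hbad i (not_lt.1 hi), H₁.eq_bad i (not_lt.1 hi)]
        rfl
    -- An expression sharing an instance with the kept application has the same head. It cannot be a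
    -- parameter, which is rigid; another variable would make the kept term parameter-free; and a
    -- variable is never a type.
    have invert {W : V → Option (Raw K V)} {ρ : V → Raw K V} {w : Raw K V}
        (hw : Sg.HasSort W w (S.map (subst ρ))) {g₀ : V → Raw K V}
        (hw₀ : S ≠ none → ¬ Base P ((app s a₁).subst g₀))
        (hsim : Similar P w ((app s a₁).subst g₀)) :
        ∃ a, w = app s a ∧ ∃ f f', PSub P f ∧ PSub P f' ∧
          ∀ i, (a i).subst f = ((a₁ i).subst g₀).subst f' := by
      obtain ⟨f', g', hf', hg', e'⟩ := hsim
      generalize hS' : S.map (subst ρ) = T at hw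
      cases hw with
      | @app k a _ _ _ _ _ =>
        simp only [subst_app, app.injEq] at e'
        obtain ⟨rfl, e'⟩ := e'
        exact ⟨a, rfl, f', g', hf', hg', fun i ↦ congrFun e' i⟩
      | @var v _ hv =>
        exfalso
        have hSne : S ≠ none := by
          rintro rfl
          cases hS'
        by_cases hvP : v ∈ P
        · simp [hf'.param v hvP] at e'
        · refine hw₀ hSne (hg'.base_of_subst ?_)
          rw [← e']
          exact hf'.base v hvP
    have hnb : S ≠ none → ∀ g₀ h₀, PSub P h₀ →
        app s args = ((app s a₁).subst g₀).subst h₀ → ¬ Base P ((app s a₁).subst g₀) := by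
      intro hSne g₀ h₀ hh₀ e hb
      exact hbase ⟨hSne, by rw [e]; exact hb.subst hh₀⟩
    cases S with
    | none =>
      have hout' : Sg.out s = none := by
        cases h : Sg.out s <;> simp_all
      refine ⟨Γ₁, g₁, app s a₁, h₁, ⟨H₁.wf, H₁.mor,
        .app hk H₁.hasSort H₁.eq_bad (by simp [hout']), ?_⟩, hh₁, rfl, by simp [e₁']⟩
      intro W ρ w hW hρ hw hsim
      obtain ⟨a, rfl, f', g', hf', hg', e'⟩ := invert hw (g₀ := var)
        (fun h ↦ absurd rfl h) (by rwa [subst_eq_self fun _ _ ↦ rfl])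
      cases hw with
      | app _ ha hbad' _ =>
      obtain ⟨k, ⟨hk, e₁, e₂⟩, u⟩ := H₁.univ W ρ a hW hρ ha
        ⟨f', g', hf', hg', fun i _ ↦ by rw [e' i, subst_eq_self (f := var) fun _ _ ↦ rfl]⟩
      refine ⟨k, ⟨hk, e₁, ?_⟩, fun k' ⟨hk', e₁', e₂'⟩ ↦ u k' ⟨hk', e₁', fun i _ ↦ ?_⟩⟩
      · simp only [subst_app, app.injEq, true_and]
        funext i
        by_cases hi : i < Sg.arity s
        · exact e₂ i hi
        · rw [hbad' i (not_lt.1 hi), H₁.eq_bad i (not_lt.1 hi)]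
          rfl
      · simp only [subst_app, app.injEq, true_and] at e₂'
        exact congrFun e₂' i
    | some A =>
      obtain ⟨B, hB, hAB⟩ : ∃ B, Sg.out s = some B ∧ A.subst (comp g₁ h₁) = B.subst args := by
        cases h : Sg.out s <;> simp_all
      have hBs : Sg.HasSort Γ₁ (B.subst a₁) none := by
        refine (hSg.out_hasSort hk hB).subst (f := a₁) fun i hi A hA ↦ ?_
        have hin := hSg.out_occurs hk hB hi
        simp only [argCtx, hin, if_true, Option.some.injEq] at hA
        exact hA ▸ H₁.hasSort i hin
      have hAB' : (A.subst g₁).subst h₁ = (B.subst a₁).subst h₁ := by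
        rw [← subst_comp, hAB, e₁', subst_subst]
      -- With generalized arguments the symbol has type `B.subst a₁`, while `A.subst g₁` is
      -- required. The original term shows that `h₁` unifies them.
      obtain ⟨Γ₂, g₂, H₂⟩ := exists_isUniversal_unifier hSg H₁.wf
        ((hS A rfl).map H₁.mor) hBs hh₁ hAB'
      obtain ⟨h₂, ⟨hh₂, rfl⟩, -⟩ := H₂.univ _ h₁ hh₁ hAB'
      have hcond : A.subst (comp g₁ g₂) = B.subst fun i ↦ (a₁ i).subst g₂ := by
        rw [subst_comp, H₂.cond, subst_subst]
      have hargs₂ : app s args = ((app s a₁).subst g₂).subst h₂ := by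
        rw [e₁', ← subst_comp]
        rfl
      refine ⟨Γ₂, comp g₁ g₂, (app s a₁).subst g₂, h₂, ⟨H₂.wf, H₁.mor.comp H₂.mor,
        .app hk (fun i hi ↦ ?_) (fun i hi ↦ by simp [H₁.eq_bad i hi]) (by simp [hB, hcond]), ?_⟩,
        hh₂, (comp_assoc _ _ _).symm, hargs₂⟩
      · rw [← subst_subst]
        exact (H₁.hasSort i hi).map H₂.mor
      · intro W ρ w hW hρ hw hsim
        obtain ⟨a, rfl, f', g', hf', hg', e'⟩ := invert hw (g₀ := g₂)
          (fun h ↦ hnb h g₂ h₂ hh₂.toPSub hargs₂) hsim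
        cases hw with
        | app _ ha hbad' hout' =>
        obtain ⟨k₁, ⟨hk₁, rfl, e₃⟩, u₁⟩ := H₁.univ W ρ a hW hρ ha
          ⟨f', comp g₂ g', hf', H₂.mor.toPSub.comp hg', fun i _ ↦ by rw [e' i, subst_comp]⟩
        have e₃' : a = fun i ↦ (a₁ i).subst k₁ := by
          funext i
          by_cases hi : i < Sg.arity s
          · exact (e₃ i hi).symm
          · rw [hbad' i (not_lt.1 hi), H₁.eq_bad i (not_lt.1 hi)]
            rfl
        rw [hB] at hout'
        simp only [Option.map_some, Option.some.injEq] at hout'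
        obtain ⟨k₂, ⟨hk₂, rfl⟩, u₂⟩ := H₂.univ W k₁ hk₁ (by
          rw [← subst_comp, hout', subst_subst, e₃'])
        refine ⟨k₂, ⟨hk₂, (comp_assoc _ _ _).symm, ?_⟩, fun k ⟨hk, e₅, e₆⟩ ↦ u₂ k ⟨hk,
          (u₁ _ ⟨H₂.mor.comp hk, ?_, fun i _ ↦ ?_⟩).symm⟩⟩
        · rw [← subst_comp, e₃']
          rfl
        · rw [e₅, comp_assoc]
        · rw [← subst_comp] at e₆
          simp only [subst_app, app.injEq, true_and] at e₆
          exact congrFun e₆ i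

end Signature

/-- Representability of the restriction of a dependent presheaf, from a universal element. -/
noncomputable def DepPresheaf.representableByOfUnique {C : Type u} [Category.{u} C]
    {X : Cᵒᵖ ⥤ Type u} (Y : DepPresheaf X) {Γ E : C} (x : X.obj (op Γ)) (p : E ⟶ Γ)
    (q : Y.obj (X.map p.op x))
    (H : ∀ {Δ : C} (ρ : Δ ⟶ Γ) (t : Y.obj (X.map ρ.op x)), ∃! h : Δ ⟶ E,
      ∃ e : h ≫ p = ρ, Y.map h (by rw [← e, map_comp_op rfl rfl]) q = t) :
    (Y.restrict x).RepresentableBy (Over.mk p) where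
  homEquiv {ρ} := Equiv.ofBijective (fun f ↦ (Y.restrict x).map f.op q) (by
    constructor
    · intro f g hfg
      ext
      obtain ⟨h, -, hu⟩ := H ρ.hom ((Y.restrict x).map f.op q)
      exact (hu f.left ⟨Over.w f, rfl⟩).trans (hu g.left ⟨Over.w g, hfg.symm⟩).symm
    · intro t
      obtain ⟨h, ⟨e, he⟩, -⟩ := H ρ.hom t
      exact ⟨Over.homMk h e, he⟩)
  homEquiv_comp f g := by
    exact Functor.map_comp_apply (Y.restrict x) g.op f.op q

theorem DepPresheaf.representableByOfUnique_id {C : Type u} [Category.{u} C]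
    {X : Cᵒᵖ ⥤ Type u} (Y : DepPresheaf X) {Γ E : C} (x : X.obj (op Γ)) (p : E ⟶ Γ)
    (q : Y.obj (X.map p.op x)) (H) :
    (Y.representableByOfUnique x p q H).homEquiv (𝟙 (Over.mk p)) = q :=
  Y.map_id _ q

namespace CwF

variable {C : CwF.{u}}

/-! ### Terms of arbitrary types -/

variable (C) in
/-- The terms over `Γ`, of arbitrary types. -/
abbrev El (Γ : C.Ob) : Type u := Σ A : C.Ty Γ, C.Tm A

/-- Substitution in a term. -/
def El.sub {Γ Δ : C.Ob} (σ : Δ ⟶ Γ) (e : C.El Γ) : C.El Δ :=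
  ⟨C.tySub σ e.1, C.fam.Tm.map σ rfl e.2⟩

/-- Pairing a term with its type absorbs the transport along `h`, so that equations between
substituted terms can be stated without casts. -/
theorem El.mk_map {Γ Δ : C.Ob} (σ : Δ ⟶ Γ) {A : C.Ty Γ} {B : C.Ty Δ} (h : C.tySub σ A = B)
    (a : C.Tm A) : (⟨B, C.fam.Tm.map σ h a⟩ : C.El Δ) = El.sub σ ⟨A, a⟩ := by
  subst h
  rfl

theorem El.sub_id {Γ : C.Ob} (e : C.El Γ) : e.sub (𝟙 Γ) = e := by
  obtain ⟨A, a⟩ := e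
  rw [← El.mk_map (𝟙 Γ) (map_id_op A) a, C.fam.Tm.map_id]

theorem El.sub_comp {Γ Δ Θ : C.Ob} (f : Δ ⟶ Γ) (g : Θ ⟶ Δ) (e : C.El Γ) :
    e.sub (g ≫ f) = (e.sub f).sub g := by
  obtain ⟨A, a⟩ := e
  rw [← El.mk_map (g ≫ f) (map_comp_op rfl rfl) a, ← C.fam.Tm.map_map f g rfl rfl]
  rfl

variable (C) in
/-- The variable of a context extension. -/
def qEl {Γ : C.Ob} (A : C.Ty Γ) : C.El (C.ext A) := ⟨_, C.q A⟩

theorem extRepresents_homEquiv {Γ Δ : C.Ob} {A : C.Ty Γ} {σ : Δ ⟶ Γ}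
    (f : Over.mk σ ⟶ Over.mk (C.p A)) (b : C.Tm (C.tySub σ A)) :
    (C.extRepresents A).homEquiv f = b ↔ (C.qEl A).sub f.left = ⟨_, b⟩ := by
  have hw : f.left ≫ C.p A = σ := Over.w f
  have h : (C.extRepresents A).homEquiv f = C.fam.Tm.map f.left
      ((map_comp_op rfl rfl).symm.trans (congrArg (fun g ↦ C.tySub g A) hw)) (C.q A) :=
    (C.extRepresents A).homEquiv_eq f
  constructor
  · intro h'
    exact (El.mk_map f.left _ _).symm.trans (congrArg (Sigma.mk _) (h.symm.trans h'))
  · intro hq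
    exact h.trans (eq_of_heq (Sigma.mk.inj ((El.mk_map f.left _ _).trans hq)).2)

/-- The universal property of context extensions. -/
theorem existsUnique_ext {Γ Δ : C.Ob} (A : C.Ty Γ) (σ : Δ ⟶ Γ) (e : C.El Δ)
    (he : e.1 = C.tySub σ A) : ∃! h : Δ ⟶ C.ext A, h ≫ C.p A = σ ∧ (C.qEl A).sub h = e := by
  obtain ⟨B, b⟩ := e
  dsimp only at he
  subst he
  let k : Over.mk σ ⟶ Over.mk (C.p A) := (C.extRepresents A).homEquiv.symm b
  refine ⟨k.left, ⟨Over.w k, ?_⟩, ?_⟩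
  · exact (extRepresents_homEquiv k b).1 ((C.extRepresents A).homEquiv.apply_symm_apply _)
  · rintro h ⟨hh, h'⟩
    have := (extRepresents_homEquiv (Over.homMk h hh : Over.mk σ ⟶ Over.mk (C.p A)) b).2 h'
    exact congrArg (fun f : Over.mk σ ⟶ Over.mk (C.p A) ↦ f.left)
      ((C.extRepresents A).homEquiv.eq_symm_apply.2 this)

theorem ext_hom_ext {Γ Δ : C.Ob} {A : C.Ty Γ} {f g : Δ ⟶ C.ext A} (hp : f ≫ C.p A = g ≫ C.p A)
    (hq : (C.qEl A).sub f = (C.qEl A).sub g) : f = g :=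
  (existsUnique_ext A (g ≫ C.p A) ((C.qEl A).sub g) (map_comp_op rfl rfl).symm).unique
    ⟨hp, hq⟩ ⟨rfl, rfl⟩

/-! ### Contexts as iterated extensions -/

variable (C) in
/-- A presentation of an object as an iterated extension of the empty context. -/
inductive Tower : C.Ob → Type u
  | nil : Tower C.empty
  | snoc {Γ : C.Ob} (t : Tower Γ) (A : C.Ty Γ) : Tower (C.ext A)

namespace Tower

/-- The length of a context. -/
def len : {Γ : C.Ob} → Tower C Γ → ℕ
  | _, nil => 0
  | _, snoc t _ => t.len + 1

/-- The variables of a context. -/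
def lookup : {Γ : C.Ob} → Tower C Γ → ℕ → Option (C.El Γ)
  | _, nil, _ => none
  | _, snoc t A, i => if i = t.len then some (C.qEl A) else (t.lookup i).map (El.sub (C.p A))

theorem lookup_snoc_len {Γ : C.Ob} (t : Tower C Γ) (A : C.Ty Γ) :
    (t.snoc A).lookup t.len = some (C.qEl A) := by simp [lookup]

theorem lookup_eq_none {Γ : C.Ob} {t : Tower C Γ} {i : ℕ} : t.lookup i = none ↔ t.len ≤ i := by
  induction t with
  | nil => simp [lookup, len]
  | snoc t A ih =>
    simp only [lookup, len]
    split_ifs with h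
    · simp [h]
    · simp only [Option.map_eq_none_iff, ih]
      omega

theorem lookup_snoc_of_lt {Γ : C.Ob} {t : Tower C Γ} {A : C.Ty Γ} {i : ℕ} (h : i < t.len) :
    (t.snoc A).lookup i = (t.lookup i).map (El.sub (C.p A)) := by simp [lookup, h.ne]

theorem lt_of_lookup {Γ : C.Ob} {t : Tower C Γ} {i : ℕ} {e : C.El Γ} (h : t.lookup i = some e) :
    i < t.len := by
  by_contra h'
  rw [lookup_eq_none.2 (not_lt.1 h')] at h
  cases h

theorem exists_lookup {Γ : C.Ob} {t : Tower C Γ} {i : ℕ} (h : i < t.len) :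
    ∃ e, t.lookup i = some e :=
  Option.ne_none_iff_exists'.1 fun h' ↦ absurd (lookup_eq_none.1 h') (not_le.2 h)

/-- Morphisms are determined by their components. -/
theorem hom_ext {Γ Δ : C.Ob} (t : Tower C Γ) {σ σ' : Δ ⟶ Γ}
    (h : ∀ i e, t.lookup i = some e → e.sub σ = e.sub σ') : σ = σ' := by
  induction t with
  | nil => exact C.isTerminal.hom_ext _ _
  | snoc t A ih =>
    refine ext_hom_ext (ih fun i e hi ↦ ?_) (h _ _ (lookup_snoc_len t A))
    rw [El.sub_comp, El.sub_comp]
    refine h i _ ?_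
    rw [lookup_snoc_of_lt (lt_of_lookup hi), hi]
    rfl

end Tower

/-! ### Representations by raw expressions -/

variable (C) in
/-- Symbols labelled by the types and terms of `C`, and by a measure. -/
inductive Label : Type u
  | ty {Γ : C.Ob} (t : Tower C Γ) (A : C.Ty Γ) (F : (ℕ → ℕ) → ℕ)
  | tm {Γ : C.Ob} (t : Tower C Γ) (A : C.Ty Γ) (a : C.Tm A) (F : (ℕ → ℕ) → ℕ)

/-- The measure of a symbol. -/
def Label.measure : Label C → (ℕ → ℕ) → ℕ
  | ty _ _ F => F
  | tm _ _ _ F => F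

/-- The expressions for the identity substitution of a context of length `n`. -/
def idRaw {K : Type u} (n i : ℕ) : Raw K ℕ := if i < n then .var i else .bad

/-- The raw expression `r` represents the term `e`. -/
inductive RepTm (G : Set (tmFunctor.obj C)) {Γ : C.Ob} (t : Tower C Γ) :
    C.El Γ → Raw (Label C) ℕ → Prop
  | var {i : ℕ} {e : C.El Γ} : t.lookup i = some e → RepTm G t e (.var i)
  | app {Γ' : C.Ob} {t' : Tower C Γ'} {A : C.Ty Γ'} {a : C.Tm A} {F : (ℕ → ℕ) → ℕ} {σ : Γ ⟶ Γ'}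
      {args : ℕ → Raw (Label C) ℕ} : (⟨Γ', A, a⟩ : tmFunctor.obj C) ∈ G →
      (∀ i e, t'.lookup i = some e → RepTm G t (e.sub σ) (args i)) →
      (∀ i, t'.len ≤ i → args i = .bad) → RepTm G t (El.sub σ ⟨A, a⟩) (.app (.tm t' A a F) args)

/-- The sequence `args` of raw expressions represents the substitution `σ`. -/
structure RepSub (G : Set (tmFunctor.obj C)) {Γ Δ : C.Ob} (s : Tower C Δ) (t : Tower C Γ)
    (σ : Δ ⟶ Γ) (args : ℕ → Raw (Label C) ℕ) : Prop where
  repTm : ∀ i e, t.lookup i = some e → RepTm G s (e.sub σ) (args i)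
  eq_bad : ∀ i, t.len ≤ i → args i = .bad

/-- The raw expression `r` represents the type `A`. -/
def RepTy (Gty : Set (tyFunctor.obj C)) (G : Set (tmFunctor.obj C)) {Γ : C.Ob} (t : Tower C Γ)
    (A : C.Ty Γ) (r : Raw (Label C) ℕ) : Prop :=
  ∃ (Γ' : C.Ob) (t' : Tower C Γ') (B : C.Ty Γ') (F : (ℕ → ℕ) → ℕ) (σ : Γ ⟶ Γ')
    (args : ℕ → Raw (Label C) ℕ), (⟨Γ', B⟩ : tyFunctor.obj C) ∈ Gty ∧ RepSub G t t' σ args ∧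
    A = C.tySub σ B ∧ r = .app (.ty t' B F) args

variable {Gty : Set (tyFunctor.obj C)} {G : Set (tmFunctor.obj C)} {Γ Δ Θ : C.Ob}
  {t : Tower C Γ} {s : Tower C Δ} {w : Tower C Θ}

theorem RepTm.subst {e : C.El Γ} {r : Raw (Label C) ℕ} (hr : RepTm G t e r) {σ : Δ ⟶ Γ}
    {args : ℕ → Raw (Label C) ℕ} (hσ : RepSub G s t σ args) :
    RepTm G s (e.sub σ) (r.subst args) := by
  induction hr with
  | var h => exact hσ.repTm _ _ h
  | app hG _ hbad ih =>
    rw [← El.sub_comp]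
    exact .app hG (fun i e hi ↦ by rw [El.sub_comp]; exact ih i e hi)
      fun i hi ↦ by simp [hbad i hi]

theorem RepSub.comp {σ : Δ ⟶ Γ} {args : ℕ → Raw (Label C) ℕ} (hσ : RepSub G s t σ args)
    {τ : Θ ⟶ Δ} {args' : ℕ → Raw (Label C) ℕ} (hτ : RepSub G w s τ args') :
    RepSub G w t (τ ≫ σ) (fun i ↦ (args i).subst args') where
  repTm i e h := by
    rw [El.sub_comp]
    exact (hσ.repTm i e h).subst hτ
  eq_bad i hi := by simp [hσ.eq_bad i hi]

theorem RepTy.subst {A : C.Ty Γ} {r : Raw (Label C) ℕ} (hr : RepTy Gty G t A r) {σ : Δ ⟶ Γ}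
    {args : ℕ → Raw (Label C) ℕ} (hσ : RepSub G s t σ args) :
    RepTy Gty G s (C.tySub σ A) (r.subst args) := by
  obtain ⟨Γ', t', B, F, τ, args', hG, hτ, rfl, rfl⟩ := hr
  exact ⟨Γ', t', B, F, σ ≫ τ, _, hG, hτ.comp hσ, (map_comp_op rfl rfl).symm, rfl⟩

theorem repSub_id : RepSub G t t (𝟙 Γ) (idRaw t.len) where
  repTm i e h := by
    rw [El.sub_id, idRaw, if_pos (Tower.lt_of_lookup h)]
    exact .var h
  eq_bad i hi := by simp [idRaw, hi]

theorem repSub_p (A : C.Ty Γ) : RepSub G (t.snoc A) t (C.p A) (idRaw t.len) where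
  repTm i e h := by
    rw [idRaw, if_pos (Tower.lt_of_lookup h)]
    exact .var (by rw [Tower.lookup_snoc_of_lt (Tower.lt_of_lookup h), h]; rfl)
  eq_bad i hi := by simp [idRaw, hi]

/-- Although `idRaw` sends out-of-range variables to `bad`, it acts trivially here: represented
expressions only use variables of their context. The identity laws of `RepCtx` hold strictly because
of this. -/
theorem RepTm.subst_idRaw {e : C.El Γ} {r : Raw (Label C) ℕ} (hr : RepTm G t e r) :
    r.subst (idRaw t.len) = r := by
  induction hr with
  | var h => simp [idRaw, Tower.lt_of_lookup h]
  | @app Γ' t' A a F σ args hG _ hbad ih =>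
    simp only [Raw.subst_app, Raw.app.injEq, true_and]
    funext i
    by_cases hi : i < t'.len
    · obtain ⟨e, he⟩ := Tower.exists_lookup hi
      exact ih i e he
    · rw [hbad i (not_lt.1 hi), Raw.subst_bad]

theorem RepSub.subst_idRaw {σ : Δ ⟶ Γ} {args : ℕ → Raw (Label C) ℕ} (hσ : RepSub G s t σ args) :
    (fun i ↦ (args i).subst (idRaw s.len)) = args := by
  funext i
  by_cases hi : i < t.len
  · obtain ⟨e, he⟩ := Tower.exists_lookup hi
    exact (hσ.repTm i e he).subst_idRaw
  · rw [hσ.eq_bad i (not_lt.1 hi), Raw.subst_bad]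

theorem RepSub.idRaw_subst {σ : Δ ⟶ Γ} {args : ℕ → Raw (Label C) ℕ} (hσ : RepSub G s t σ args) :
    (fun i ↦ (idRaw t.len i).subst args) = args := by
  funext i
  unfold idRaw
  split_ifs with h
  · rfl
  · exact (hσ.eq_bad i (not_lt.1 h)).symm

theorem RepTy.subst_idRaw {A : C.Ty Γ} {r : Raw (Label C) ℕ} (hr : RepTy Gty G t A r) :
    r.subst (idRaw t.len) = r := by
  obtain ⟨Γ', t', B, F, τ, args', hG, hτ, rfl, rfl⟩ := hr
  simp only [Raw.subst_app, Raw.app.injEq, true_and]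
  exact hτ.subst_idRaw

theorem RepSub.snoc {A : C.Ty Γ} {h : Δ ⟶ C.ext A} {args : ℕ → Raw (Label C) ℕ}
    (hσ : RepSub G s t (h ≫ C.p A) args) {r : Raw (Label C) ℕ}
    (hr : RepTm G s ((C.qEl A).sub h) r) :
    RepSub G s (t.snoc A) h (fun i ↦ if i = t.len then r else args i) where
  repTm i e hi := by
    unfold Tower.lookup at hi
    split_ifs at hi ⊢ with h'
    · cases hi
      exact hr
    · obtain ⟨e', he', rfl⟩ := Option.map_eq_some_iff.1 hi
      rw [← El.sub_comp]
      exact hσ.repTm i e' he'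
  eq_bad i hi := by
    have : i ≠ t.len := by simp only [Tower.len] at hi; omega
    simp only [this, if_false]
    exact hσ.eq_bad i (by simp only [Tower.len] at hi; omega)

/-- A raw expression represents at most one term. -/
theorem RepTm.unique {e e' : C.El Γ} {r : Raw (Label C) ℕ} (h : RepTm G t e r)
    (h' : RepTm G t e' r) : e = e' := by
  induction h generalizing e' with
  | var h => cases h' with | var h' => exact Option.some.inj (h.symm.trans h')
  | @app Γ' t' A a F σ args hG _ _ ih =>
    cases h' with
    | @app _ _ _ _ _ σ' _ _ h' _ =>
    -- The label records the tower `t'`, so the arguments determine all components of the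
    -- substitution and hence the substitution.
    rw [t'.hom_ext fun i e hi ↦ ih i e hi (h' i e hi)]

theorem RepSub.unique {σ σ' : Δ ⟶ Γ} {args : ℕ → Raw (Label C) ℕ} (h : RepSub G s t σ args)
    (h' : RepSub G s t σ' args) : σ = σ' :=
  t.hom_ext fun i e hi ↦ (h.repTm i e hi).unique (h'.repTm i e hi)

theorem RepTy.unique {A A' : C.Ty Γ} {r : Raw (Label C) ℕ} (h : RepTy Gty G t A r)
    (h' : RepTy Gty G t A' r) : A = A' := by
  obtain ⟨Γ₁, t₁, B₁, F₁, τ₁, args₁, hG₁, hτ₁, rfl, rfl⟩ := h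
  obtain ⟨Γ₂, t₂, B₂, F₂, τ₂, args₂, hG₂, hτ₂, rfl, h⟩ := h'
  cases h
  rw [hτ₁.unique hτ₂]

end CwF

namespace CwF

variable {C : CwF.{u}}

/-! ### The CwF of represented contexts -/

/-- An object of `C` with a presentation as an iterated extension. -/
structure RepCtx (Gty : Set (tyFunctor.obj C)) (G : Set (tmFunctor.obj C)) : Type u where
  ob : C.Ob
  tower : Tower C ob

variable {Gty : Set (tyFunctor.obj C)} {G : Set (tmFunctor.obj C)}

namespace RepCtx

/-- A morphism of `C` with a representation. -/
@[ext]
structure Hom (x y : RepCtx Gty G) : Type u where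
  hom : x.ob ⟶ y.ob
  raw : ℕ → Raw (Label C) ℕ
  rep : RepSub G x.tower y.tower hom raw

instance : Category (RepCtx Gty G) where
  Hom := Hom
  id _ := ⟨𝟙 _, _, repSub_id⟩
  comp f g := ⟨f.hom ≫ g.hom, _, g.rep.comp f.rep⟩
  id_comp f := Hom.ext (Category.id_comp _) f.rep.subst_idRaw
  comp_id f := Hom.ext (Category.comp_id _) f.rep.idRaw_subst
  assoc _ _ _ := Hom.ext (Category.assoc _ _ _) (funext fun _ ↦ (Raw.subst_subst _ _ _).symm)

theorem hom_ext {x y : RepCtx Gty G} {f g : x ⟶ y} (h : f.hom = g.hom) (h' : f.raw = g.raw) :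
    f = g := Hom.ext h h'

variable (Gty G) in
/-- The family of represented types and terms. -/
def family : Family (RepCtx Gty G) where
  Ty :=
    { obj x := {a : C.Ty x.unop.ob × Raw (Label C) ℕ // RepTy Gty G x.unop.tower a.1 a.2}
      map f := ↾fun a ↦ ⟨(C.tySub f.unop.hom a.1.1, a.1.2.subst f.unop.raw), a.2.subst f.unop.rep⟩
      map_id x := by
        refine ConcreteCategory.hom_ext _ _ fun a ↦ Subtype.ext (Prod.ext ?_ ?_)
        · exact map_id_op a.1.1
        · exact a.2.subst_idRaw
      map_comp f g := by
        refine ConcreteCategory.hom_ext _ _ fun a ↦ Subtype.ext (Prod.ext ?_ ?_)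
        · exact map_comp_op rfl rfl
        · exact (Raw.subst_subst _ _ _).symm }
  Tm :=
    { obj {x} A := {a : C.Tm A.1.1 × Raw (Label C) ℕ // RepTm G x.tower ⟨A.1.1, a.1⟩ a.2}
      map f A B h a := ⟨(C.fam.Tm.map f.hom (congrArg (fun A ↦ A.1.1) h) a.1.1,
        a.1.2.subst f.raw), by
          rw [El.mk_map]
          exact a.2.subst f.rep⟩
      map_id h a := Subtype.ext (Prod.ext (C.fam.Tm.map_id _ _) a.2.subst_idRaw)
      map_map f g _ _ _ hf hg a :=
        Subtype.ext (Prod.ext (C.fam.Tm.map_map _ _ _ _ _) (Raw.subst_subst _ _ _)) }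

/-- Context extension. -/
def ext {x : RepCtx Gty G} (A : (family Gty G).Ty.obj (op x)) : RepCtx Gty G :=
  ⟨C.ext A.1.1, x.tower.snoc A.1.1⟩

/-- The projection from a context extension. -/
def p {x : RepCtx Gty G} (A : (family Gty G).Ty.obj (op x)) : ext A ⟶ x :=
  ⟨C.p A.1.1, _, repSub_p A.1.1⟩

/-- The variable of a context extension. -/
def q {x : RepCtx Gty G} (A : (family Gty G).Ty.obj (op x)) :
    (family Gty G).Tm.obj ((family Gty G).Ty.map (p A).op A) :=
  ⟨(C.q A.1.1, .var x.tower.len), .var (Tower.lookup_snoc_len _ _)⟩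

theorem raw_eq {x y : RepCtx Gty G} {A : (family Gty G).Ty.obj (op x)} (h : y ⟶ ext A) :
    h.raw = fun i ↦ if i = x.tower.len then h.raw x.tower.len else (h ≫ p A).raw i := by
  funext i
  split_ifs with hi
  · rw [hi]
  · change _ = (idRaw _ _).subst _
    unfold idRaw
    split_ifs with hi'
    · rfl
    · exact h.rep.eq_bad i (by change _ + 1 ≤ i; omega)

/-- The underlying morphism comes from the universal property in `C`; its raw form is that of `ρ`
with the raw form of `t` inserted at position `x.tower.len`. -/
theorem existsUnique_ext {x y : RepCtx Gty G} (A : (family Gty G).Ty.obj (op x)) (ρ : y ⟶ x)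
    (t : (family Gty G).Tm.obj ((family Gty G).Ty.map ρ.op A)) :
    ∃! h : y ⟶ ext A, ∃ e : h ≫ p A = ρ,
      (family Gty G).Tm.map h (by rw [← e, map_comp_op rfl rfl]) (q A) = t := by
  obtain ⟨k, ⟨hk, hk'⟩, hu⟩ := CwF.existsUnique_ext A.1.1 ρ.hom ⟨_, t.1.1⟩ rfl
  have hrep : RepSub G y.tower (x.tower.snoc A.1.1) k _ :=
    RepSub.snoc (hk.symm ▸ ρ.rep) (hk'.symm ▸ t.2)
  have hp : (⟨k, _, hrep⟩ : y ⟶ ext A) ≫ p A = ρ := by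
    refine hom_ext hk ?_
    funext i
    change (idRaw _ _).subst _ = _
    unfold idRaw
    split_ifs with hi
    · simp [hi.ne]
    · exact (ρ.rep.eq_bad i (not_lt.1 hi)).symm
  refine ⟨⟨k, _, hrep⟩, ⟨hp, ?_⟩, ?_⟩
  · refine Subtype.ext (Prod.ext ?_ ?_)
    · exact eq_of_heq (Sigma.mk.inj ((El.mk_map k _ _).trans hk')).2
    · exact if_pos rfl
  · rintro h ⟨rfl, h'⟩
    refine hom_ext (hu _ ⟨rfl, ?_⟩) ?_
    · exact (El.mk_map h.hom (map_comp_op rfl rfl).symm _).symm.trans (congrArg (Sigma.mk _)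
        (congrArg (fun t ↦ t.1.1) h'))
    · rw [raw_eq h]
      funext i
      have : h.raw x.tower.len = t.1.2 := congrArg (fun t ↦ t.1.2) h'
      simp [this]

variable (Gty G) in
/-- The CwF of represented contexts, types and terms of `C`. -/
noncomputable def cwf : CwF.{u} where
  Ob := RepCtx Gty G
  empty := ⟨C.empty, .nil⟩
  isTerminal := IsTerminal.ofUniqueHom
    (fun x ↦ Hom.mk (C.isTerminal.from _) (fun _ ↦ .bad)
      ⟨(fun i e h ↦ by cases h), fun _ _ ↦ rfl⟩)
    (fun x f ↦ hom_ext (C.isTerminal.hom_ext _ _) (funext fun i ↦ f.rep.eq_bad i (Nat.zero_le _)))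
  fam := family Gty G
  ext := ext
  p := p
  extRepresents A := DepPresheaf.representableByOfUnique _ A (p A) (q A) (existsUnique_ext A)

theorem cwf_q {x : RepCtx Gty G} (A : (family Gty G).Ty.obj (op x)) : (cwf Gty G).q A = q A :=
  DepPresheaf.representableByOfUnique_id _ _ _ _ (existsUnique_ext A)

variable (Gty G) in
/-- The projection to `C`. -/
noncomputable def proj : cwf Gty G ⟶ C :=
  show CwF.Hom _ _ from
  { functor := { obj := fun x ↦ x.ob, map := fun f ↦ f.hom }
    ty := fun A ↦ A.1.1
    tm := fun a ↦ a.1.1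
    ty_sub := fun _ _ ↦ rfl
    tm_sub := fun _ _ _ _ _ ↦ rfl
    map_empty := rfl
    map_ext := fun _ ↦ rfl
    map_p := fun _ ↦ Category.id_comp _
    map_q := fun {x} A ↦ (C.fam.Tm.map_id _ _).trans (congrArg (fun t ↦ t.1.1) (cwf_q A)).symm }

/-- The types represented by a symbol applied to all variables. -/
def IsGenTy (z : tyFunctor.obj (cwf Gty G)) : Prop :=
  z.2.1.2 = .app (.ty z.1.tower z.2.1.1 fun m ↦ 1 + ∑ i ∈ Finset.range z.1.tower.len, m i)
    (idRaw z.1.tower.len)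

/-- The terms represented by a symbol applied to all variables. -/
def IsGenTm (z : tmFunctor.obj (cwf Gty G)) : Prop :=
  z.2.2.1.2 = .app (.tm z.1.tower z.2.1.1.1 z.2.2.1.1 fun m ↦
    1 + ∑ i ∈ Finset.range z.1.tower.len, m i + z.2.1.1.2.eval Label.measure m)
    (idRaw z.1.tower.len)

theorem liftsTypes : LiftsTypes (proj Gty G) Gty IsGenTy := by
  rintro ⟨Γ, A⟩ hA ⟨Γ', t⟩ h
  obtain rfl : Γ' = Γ := h
  exact ⟨⟨⟨Γ', t⟩, ⟨(A, _), Γ', t, A, fun m ↦ 1 + ∑ i ∈ Finset.range t.len, m i, 𝟙 _, _,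
    hA, repSub_id, (map_id_op A).symm, rfl⟩⟩,
    rfl, rfl, rfl⟩

/-- The weight of the symbol involves the raw expression `r` of the type, which is known only at
this point. Labels therefore carry an arbitrary weight, and the lift selects the right one. -/
theorem liftsTerms : LiftsTerms (proj Gty G) G IsGenTm := by
  rintro ⟨Γ, A, a⟩ ha ⟨⟨Γ', t⟩, ⟨⟨A', r⟩, hA⟩⟩ h
  obtain ⟨rfl, h⟩ := Sigma.mk.inj h
  obtain rfl : A' = A := eq_of_heq h
  have hid : RepSub G t t (𝟙 Γ') _ := repSub_id
  have h := RepTm.app (t := t) (t' := t) (σ := 𝟙 Γ') (F := fun m ↦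
    1 + ∑ i ∈ Finset.range t.len, m i + r.eval Label.measure m) ha hid.repTm hid.eq_bad
  rw [El.sub_id] at h
  exact ⟨⟨⟨Γ', t⟩, ⟨⟨(A', r), hA⟩, ⟨(a, _), h⟩⟩⟩, rfl, rfl, rfl⟩

end RepCtx

end CwF

/-! ### Strict presentations of freely generated CwFs. -/

namespace CwF

variable {C : CwF.{u}}

/-- A strictly natural choice of representations of all objects, morphisms, types and terms of `C`
by raw expressions. -/
structure Presentation (Gty : Set (tyFunctor.obj C)) (G : Set (tmFunctor.obj C)) where
  tw : ∀ Γ, Tower C Γ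
  rTy : ∀ {Γ : C.Ob}, C.Ty Γ → Raw (Label C) ℕ
  rTm : ∀ {Γ : C.Ob} {A : C.Ty Γ}, C.Tm A → Raw (Label C) ℕ
  rHom : ∀ {Δ Γ : C.Ob}, (Δ ⟶ Γ) → ℕ → Raw (Label C) ℕ
  repTy : ∀ {Γ : C.Ob} (A : C.Ty Γ), RepTy Gty G (tw Γ) A (rTy A)
  repTm : ∀ {Γ : C.Ob} {A : C.Ty Γ} (a : C.Tm A), RepTm G (tw Γ) ⟨A, a⟩ (rTm a)
  repSub : ∀ {Δ Γ : C.Ob} (σ : Δ ⟶ Γ), RepSub G (tw Δ) (tw Γ) σ (rHom σ)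
  tw_empty : tw C.empty = .nil
  tw_ext : ∀ {Γ : C.Ob} (A : C.Ty Γ), tw (C.ext A) = (tw Γ).snoc A
  rTy_sub : ∀ {Δ Γ : C.Ob} (σ : Δ ⟶ Γ) (A : C.Ty Γ), rTy (C.tySub σ A) = (rTy A).subst (rHom σ)
  rTm_sub : ∀ {Δ Γ : C.Ob} (σ : Δ ⟶ Γ) {A : C.Ty Γ} {B : C.Ty Δ} (h : C.tySub σ A = B)
    (a : C.Tm A), rTm (C.fam.Tm.map σ h a) = (rTm a).subst (rHom σ)
  rHom_comp : ∀ {Θ Δ Γ : C.Ob} (τ : Θ ⟶ Δ) (σ : Δ ⟶ Γ) (i : ℕ),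
    rHom (τ ≫ σ) i = (rHom σ i).subst (rHom τ)
  rHom_p : ∀ {Γ : C.Ob} (A : C.Ty Γ), rHom (C.p A) = idRaw (tw Γ).len
  rTm_q : ∀ {Γ : C.Ob} (A : C.Ty Γ), rTm (C.q A) = .var (tw Γ).len
  gen_ty : ∀ {Γ : C.Ob} (A : C.Ty Γ), (⟨Γ, A⟩ : tyFunctor.obj C) ∈ Gty →
    rTy A = .app (.ty (tw Γ) A fun m ↦ 1 + ∑ i ∈ Finset.range (tw Γ).len, m i) (idRaw (tw Γ).len)
  gen_tm : ∀ {Γ : C.Ob} {A : C.Ty Γ} (a : C.Tm A), (⟨Γ, A, a⟩ : tmFunctor.obj C) ∈ G →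
    rTm a = .app (.tm (tw Γ) A a fun m ↦ 1 + ∑ i ∈ Finset.range (tw Γ).len, m i +
      (rTy A).eval Label.measure m) (idRaw (tw Γ).len)

/-- The section preserves projections up to an `eqToHom`, whose raw form is the identity of the
extended context; this absorbs it. -/
theorem idRaw_subst_idRaw {K : Type u} (n i : ℕ) :
    (idRaw n i : Raw K ℕ).subst (idRaw (n + 1)) = idRaw n i := by
  unfold idRaw
  split_ifs with h
  · simp [h.le]
  · rfl

theorem RepCtx.eqToHom_raw {Gty : Set (tyFunctor.obj C)} {G : Set (tmFunctor.obj C)}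
    {x y : RepCtx Gty G} (h : x = y) : (eqToHom h).raw = idRaw y.tower.len := by
  subst h
  rfl

/-- Freely generated CwFs can be presented by raw expressions. -/
theorem IsCellular.exists_presentation (hC : C.IsCellular) :
    ∃ (Gty : Set (tyFunctor.obj C)) (G : Set (tmFunctor.obj C)),
      Nonempty (Presentation Gty G) := by
  obtain ⟨Gty, G, H⟩ := hC.exists_generators
  refine ⟨Gty, G, ?_⟩
  obtain ⟨s, hs, hgTy, hgTm⟩ := H _ (RepCtx.proj Gty G) RepCtx.IsGenTy RepCtx.IsGenTm
    RepCtx.liftsTypes RepCtx.liftsTerms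
  have hfun : s.functor ⋙ (RepCtx.proj Gty G).functor = 𝟭 C.Ob := congrArg CwF.Hom.functor hs
  have hTy {Γ : C.Ob} (A : C.Ty Γ) :
      (⟨(s.functor.obj Γ).ob, (s.ty A).1.1⟩ : Σ Γ, C.Ty Γ) = ⟨Γ, A⟩ :=
    congrArg (fun f : C ⟶ C ↦ tyFunctor.map f ⟨Γ, A⟩) hs
  have hTm {Γ : C.Ob} {A : C.Ty Γ} (a : C.Tm A) :
      (⟨(s.functor.obj Γ).ob, (s.ty A).1.1, (s.tm a).1.1⟩ : Σ Γ, C.El Γ) = ⟨Γ, A, a⟩ :=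
    congrArg (fun f : C ⟶ C ↦ tmFunctor.map f ⟨Γ, A, a⟩) hs
  have hgTy (Γ : C.Ob) (A : C.Ty Γ) (h : (⟨Γ, A⟩ : tyFunctor.obj C) ∈ Gty) :
    RepCtx.IsGenTy (⟨s.functor.obj Γ, s.ty A⟩ : tyFunctor.obj (RepCtx.cwf Gty G)) := hgTy _ h
  have hgTm (Γ : C.Ob) (A : C.Ty Γ) (a : C.Tm A) (h : (⟨Γ, A, a⟩ : tmFunctor.obj C) ∈ G) :
    RepCtx.IsGenTm (⟨s.functor.obj Γ, s.ty A, s.tm a⟩ : tmFunctor.obj (RepCtx.cwf Gty G)) :=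
    hgTm _ h
  clear hs H
  obtain ⟨⟨obj, map, map_id, map_comp⟩, ty, tm, ty_sub, tm_sub, map_empty, map_ext, map_p,
    map_q⟩ := s
  -- The section equation gives `(obj Γ).ob = Γ` only propositionally. Rewriting `obj` as a choice
  -- of towers makes it definitional and removes the transports below.
  obtain ⟨tw, rfl⟩ : ∃ tw : ∀ Γ, Tower C Γ, obj = fun Γ ↦ (⟨Γ, tw Γ⟩ : RepCtx Gty G) := by
    have hob (Γ : C.Ob) : (obj Γ).ob = Γ := Functor.congr_obj hfun Γ
    refine ⟨fun Γ ↦ hob Γ ▸ (obj Γ).tower, funext fun Γ ↦ ?_⟩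
    have (x : RepCtx Gty G) (Γ : C.Ob) (h : x.ob = Γ) : x = ⟨Γ, h ▸ x.tower⟩ := by
      subst h
      rfl
    exact this _ _ _
  have hmap {Δ Γ : C.Ob} (σ : Δ ⟶ Γ) : (map σ).hom = σ := by
    have := Functor.congr_hom hfun σ
    exact this.trans ((Category.id_comp _).trans (Category.comp_id _))
  have hTy' {Γ : C.Ob} (A : C.Ty Γ) : (ty A).1.1 = A := eq_of_heq (Sigma.mk.inj (hTy A)).2
  have hTm' {Γ : C.Ob} {A : C.Ty Γ} (a : C.Tm A) :
      (⟨(ty A).1.1, (tm a).1.1⟩ : C.El Γ) = ⟨A, a⟩ := eq_of_heq (Sigma.mk.inj (hTm a)).2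
  have htw {Γ : C.Ob} (A : C.Ty Γ) : tw (C.ext A) = (tw Γ).snoc A := by
    have key (A' : C.Ty Γ) (h : A' = A) (h' : (⟨C.ext A, tw (C.ext A)⟩ : RepCtx Gty G) =
        ⟨C.ext A', (tw Γ).snoc A'⟩) : tw (C.ext A) = (tw Γ).snoc A := by
      subst h
      exact eq_of_heq (RepCtx.mk.inj h').2
    exact key _ (hTy' A) (map_ext A)
  refine ⟨⟨tw, fun A ↦ (ty A).1.2, fun a ↦ (tm a).1.2, fun σ ↦ (map σ).raw, fun A ↦ ?_, fun a ↦ ?_,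
    fun σ ↦ ?_, ?_, htw, fun σ A ↦ ?_, fun σ A B h a ↦ ?_, fun τ σ i ↦ ?_, fun A ↦ ?_, fun A ↦ ?_,
    fun A hA ↦ ?_, fun a ha ↦ ?_⟩⟩
  · have := (ty A).2
    rwa [hTy' A] at this
  · rw [← hTm' a]
    exact (tm a).2
  · have := (map σ).rep
    rwa [hmap σ] at this
  · exact eq_of_heq (RepCtx.mk.inj map_empty).2
  · exact (congrArg (fun z ↦ z.1.2) (ty_sub σ A)).symm
  · exact (congrArg (fun z ↦ z.1.2) (tm_sub σ h a)).symm
  · exact congrArg (fun z ↦ RepCtx.Hom.raw z i) (map_comp τ σ)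
  · refine (congrArg RepCtx.Hom.raw (map_p A)).symm.trans ?_
    funext i
    refine (congrArg (fun f ↦ (idRaw _ i).subst f) (RepCtx.eqToHom_raw (map_ext A))).trans ?_
    exact idRaw_subst_idRaw _ _
  · refine (congrArg (fun z ↦ z.1.2) (map_q A)).symm.trans ?_
    have hq := congrArg (fun z ↦ z.1.2) (RepCtx.cwf_q (ty A))
    refine (congrArg₂ (fun r f ↦ Raw.subst f r) hq (RepCtx.eqToHom_raw (map_ext A))).trans ?_
    exact if_pos (Nat.lt_succ_self _)
  · refine (hgTy _ A hA).trans ?_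
    dsimp only
    rw [hTy' A]
  · refine (hgTm _ _ a ha).trans ?_
    have {Γ : C.Ob} (e e' : C.El Γ) (h : e = e') (F) :
        (Raw.app (Label.tm (tw Γ) e.1 e.2 F) (idRaw (tw Γ).len) : Raw (Label C) ℕ) =
          Raw.app (Label.tm (tw Γ) e'.1 e'.2 F) (idRaw (tw Γ).len) := by rw [h]
    exact this _ _ (hTm' a) _

end CwF

/-! ### The signature of generators, with soundness and completeness of the syntax. -/

namespace CwF

variable {C : CwF.{u}}

/-- The object over which a symbol lives. -/
def Label.ob : Label C → C.Ob
  | @ty _ Γ _ _ _ => Γ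
  | @tm _ Γ _ _ _ _ => Γ

namespace Presentation

variable {Gty : Set (tyFunctor.obj C)} {G : Set (tmFunctor.obj C)} (T : Presentation Gty G)

/-- The presentation equips every object with a tower, so all objects are iterated extensions of the
empty context. -/
theorem ob_induction (T : Presentation Gty G) {motive : C.Ob → Prop} (empty : motive C.empty)
    (ext : ∀ (Γ : C.Ob) (A : C.Ty Γ), motive Γ → motive (C.ext A)) (Γ : C.Ob) : motive Γ := by
  have key {Γ : C.Ob} (t : Tower C Γ) : motive Γ := by
    induction t with
    | nil => exact empty
    | snoc t A ih => exact ext _ A ih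
  exact key (T.tw Γ)

/-- The length of a context. -/
def len (Γ : C.Ob) : ℕ := (T.tw Γ).len

/-- The raw context of an object. -/
def ctx (Γ : C.Ob) (i : ℕ) : Option (Raw (Label C) ℕ) :=
  ((T.tw Γ).lookup i).map fun e ↦ T.rTy e.1

theorem len_empty : T.len C.empty = 0 := by simp [len, T.tw_empty, Tower.len]

theorem len_ext {Γ : C.Ob} (A : C.Ty Γ) : T.len (C.ext A) = T.len Γ + 1 := by
  simp [len, T.tw_ext, Tower.len]

theorem rTy_subst_idRaw {Γ : C.Ob} (A : C.Ty Γ) : (T.rTy A).subst (idRaw (T.len Γ)) = T.rTy A :=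
  (T.repTy A).subst_idRaw

theorem ctx_empty (i : ℕ) : T.ctx C.empty i = none := by simp [ctx, T.tw_empty, Tower.lookup]

theorem ctx_eq_none {Γ : C.Ob} {i : ℕ} : T.ctx Γ i = none ↔ T.len Γ ≤ i := by
  simp [ctx, Tower.lookup_eq_none, len]

/-- Variables are numbered from the start of the context, so weakening is the identity on raw
expressions and the types of earlier variables do not change. -/
theorem ctx_ext {Γ : C.Ob} (A : C.Ty Γ) (i : ℕ) :
    T.ctx (C.ext A) i = if i = T.len Γ then some (T.rTy A) else T.ctx Γ i := by
  unfold ctx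
  rw [T.tw_ext, Tower.lookup]
  split_ifs with h h' h'
  · simp only [Option.map_some, qEl, T.rTy_sub, T.rHom_p]
    exact congrArg some (T.rTy_subst_idRaw A)
  · exact absurd h h'
  · exact absurd h' h
  · rw [Option.map_map]
    congr 1
    funext e
    simp only [Function.comp, El.sub, T.rTy_sub, T.rHom_p]
    exact T.rTy_subst_idRaw e.1

theorem rTm_lookup {Γ : C.Ob} {i : ℕ} {e : C.El Γ} (h : (T.tw Γ).lookup i = some e) :
    T.rTm e.2 = .var i := by
  induction Γ using T.ob_induction with
  | empty => simp [T.tw_empty, Tower.lookup] at h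
  | ext Γ A ih =>
    rw [T.tw_ext, Tower.lookup] at h
    split_ifs at h with hi
    · cases h
      rw [hi]
      exact T.rTm_q A
    · obtain ⟨e', he', rfl⟩ := Option.map_eq_some_iff.1 h
      refine (T.rTm_sub _ rfl _).trans ?_
      rw [ih he', T.rHom_p]
      exact if_pos (Tower.lt_of_lookup he')

theorem rHom_apply {Γ Δ : C.Ob} (σ : Δ ⟶ Γ) {i : ℕ} {e : C.El Γ}
    (h : (T.tw Γ).lookup i = some e) : T.rHom σ i = T.rTm (e.sub σ).2 := by
  refine Eq.symm ((T.rTm_sub σ rfl _).trans ?_)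
  rw [T.rTm_lookup h]
  rfl

theorem rEl_injective {Γ : C.Ob} {e e' : C.El Γ} (h : T.rTm e.2 = T.rTm e'.2) : e = e' :=
  (T.repTm e.2).unique (h ▸ T.repTm e'.2)

theorem rTm_injective {Γ : C.Ob} {A : C.Ty Γ} {a a' : C.Tm A} (h : T.rTm a = T.rTm a') : a = a' :=
  eq_of_heq (Sigma.mk.inj (T.rEl_injective (e := ⟨A, a⟩) (e' := ⟨A, a'⟩) h)).2

theorem rTy_injective {Γ : C.Ob} {A A' : C.Ty Γ} (h : T.rTy A = T.rTy A') : A = A' :=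
  (T.repTy A).unique (h ▸ T.repTy A')

theorem rHom_injective {Γ Δ : C.Ob} {σ σ' : Δ ⟶ Γ} (h : T.rHom σ = T.rHom σ') : σ = σ' :=
  (T.repSub σ).unique (h ▸ T.repSub σ')

theorem rHom_eq_bad {Γ Δ : C.Ob} (σ : Δ ⟶ Γ) {i : ℕ} (h : T.len Γ ≤ i) : T.rHom σ i = .bad :=
  (T.repSub σ).eq_bad i h

theorem idRaw_subst_rHom {Γ Δ : C.Ob} (σ : Δ ⟶ Γ) :
    (fun i ↦ (idRaw (T.len Γ) i).subst (T.rHom σ)) = T.rHom σ :=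
  (T.repSub σ).idRaw_subst

/-- The signature of generators. -/
def sig : Signature (Label C) where
  valid k := match k with
    | @Label.ty _ Γ t A F => (⟨Γ, A⟩ : tyFunctor.obj C) ∈ Gty ∧
        T.rTy A = .app (.ty t A F) (idRaw (T.len Γ))
    | @Label.tm _ Γ t A a F => (⟨Γ, A, a⟩ : tmFunctor.obj C) ∈ G ∧
        T.rTm a = .app (.tm t A a F) (idRaw (T.len Γ))
  arity k := T.len k.ob
  ar k i := (T.ctx k.ob i).getD .bad
  out k := match k with
    | .ty _ _ _ => none
    | .tm _ A _ _ => some (T.rTy A)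

theorem hasSort_rTm {Γ : C.Ob} {A : C.Ty Γ} (a : C.Tm A) :
    T.sig.HasSort (T.ctx Γ) (T.rTm a) (some (T.rTy A)) := by
  have key {e : C.El Γ} {r : Raw (Label C) ℕ} (h : RepTm G (T.tw Γ) e r) (hr : r = T.rTm e.2) :
      T.sig.HasSort (T.ctx Γ) r (some (T.rTy e.1)) := by
    induction h with
    | var h => exact .var (by simp [ctx, h])
    | @app Γ' t' A a F σ args hG h hbad ih =>
      -- A representation could use a label with another tower or weight than the chosen one. By
      -- naturality `T` represents the same term by the chosen symbol applied to `T.rHom σ`; as `r`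
      -- is that expression, its label and arguments are the chosen ones.
      have hr' := hr.trans (T.rTm_sub σ rfl a)
      rw [T.gen_tm a hG, Raw.subst_app, ← len, T.idRaw_subst_rHom] at hr'
      have hgen := T.gen_tm a hG
      simp only [Raw.app.injEq, Label.tm.injEq, heq_eq_eq, true_and] at hr'
      obtain ⟨⟨rfl, rfl⟩, rfl⟩ := hr'
      refine .app ⟨hG, hgen⟩ (fun i hi ↦ ?_) (fun i hi ↦ hbad i hi) ?_
      · obtain ⟨e, he⟩ := Tower.exists_lookup (show i < (T.tw Γ').len from hi)
        have := ih i e he (T.rHom_apply σ he)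
        have h' (F) : T.sig.ar (.tm (T.tw Γ') A a F) i = T.rTy (Γ := Γ') e.1 := by
          simp [sig, Label.ob, ctx, he]
        rw [h', ← T.rTy_sub]
        exact this
      · simp [sig, El.sub, T.rTy_sub]
  exact key (T.repTm a) rfl

theorem hasSort_rHom {Γ Δ : C.Ob} (σ : Δ ⟶ Γ) {i : ℕ} {A : Raw (Label C) ℕ}
    (h : T.ctx Γ i = some A) :
    T.sig.HasSort (T.ctx Δ) (T.rHom σ i) (some (A.subst (T.rHom σ))) := by
  obtain ⟨e, he, rfl⟩ := Option.map_eq_some_iff.1 h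
  rw [T.rHom_apply σ he, ← T.rTy_sub]
  exact T.hasSort_rTm _

theorem hasSort_rTy {Γ : C.Ob} (A : C.Ty Γ) : T.sig.HasSort (T.ctx Γ) (T.rTy A) none := by
  obtain ⟨Γ', t', B, F, σ, args, hG, hσ, hA, hr⟩ := T.repTy A
  have hr' := hr
  have hgen := T.gen_ty B hG
  rw [hA, T.rTy_sub, hgen, Raw.subst_app, ← len, T.idRaw_subst_rHom] at hr'
  simp only [Raw.app.injEq, Label.ty.injEq, heq_eq_eq, true_and] at hr'
  obtain ⟨⟨rfl, rfl⟩, rfl⟩ := hr'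
  rw [hr]
  refine .app ⟨hG, hgen⟩ (fun i hi ↦ ?_) (fun i hi ↦ T.rHom_eq_bad σ hi) rfl
  obtain ⟨e, he⟩ := Tower.exists_lookup (show i < (T.tw Γ').len from hi)
  have h' : T.ctx Γ' i = some (T.rTy e.1) := by simp [ctx, he]
  have h'' (F) : T.sig.ar (.ty (T.tw Γ') B F) i = T.rTy (Γ := Γ') e.1 := by
    simp [sig, Label.ob, h']
  rw [h'']
  exact T.hasSort_rHom σ h'

/-- The morphism is built one variable at a time from the universal property of extensions.
Realizability of the arguments is a hypothesis because in `exists_of_hasSort` it comes from the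
induction hypotheses. -/
theorem exists_rHom_aux {Γ Δ : C.Ob} {args : ℕ → Raw (Label C) ℕ}
    (h : ∀ i A, T.ctx Γ i = some A → ∀ B : C.Ty Δ, A.subst args = T.rTy B →
      ∃ b : C.Tm B, T.rTm b = args i) (hbad : ∀ i, T.len Γ ≤ i → args i = .bad) :
    ∃ σ : Δ ⟶ Γ, T.rHom σ = args := by
  induction Γ using T.ob_induction generalizing args with
  | empty =>
    refine ⟨C.isTerminal.from Δ, funext fun i ↦ ?_⟩
    rw [hbad i (by simp [T.len_empty]), T.rHom_eq_bad _ (by simp [T.len_empty])]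
  | ext Γ A ih =>
    have htrunc {i : ℕ} (hi : i < T.len Γ) : (idRaw (T.len Γ) i).subst args = args i := by
      simp [idRaw, hi]
    have hsub (B : C.Ty Γ) : (T.rTy B).subst (fun i ↦ (idRaw (T.len Γ) i).subst args) =
        (T.rTy B).subst args := by
      rw [← Raw.subst_subst, T.rTy_subst_idRaw]
    obtain ⟨σ, hσ⟩ := ih (args := fun i ↦ (idRaw (T.len Γ) i).subst args) (fun i B hB ↦ by
      have hi : i < T.len Γ := by
        by_contra h'
        rw [T.ctx_eq_none.2 (not_lt.1 h')] at hB
        cases hB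
      have := h i B (by rw [T.ctx_ext, if_neg hi.ne, hB])
      obtain ⟨e, he, rfl⟩ := Option.map_eq_some_iff.1 hB
      rw [hsub, htrunc hi]
      exact this) (fun i hi ↦ by simp [idRaw, not_lt.2 hi])
    obtain ⟨b, hb⟩ := h (T.len Γ) (T.rTy A) (by simp [T.ctx_ext]) (C.tySub σ A) (by
      rw [T.rTy_sub, hσ, hsub])
    obtain ⟨k, ⟨hk, hk'⟩, -⟩ := existsUnique_ext A σ ⟨_, b⟩ rfl
    refine ⟨k, funext fun i ↦ ?_⟩
    rcases lt_trichotomy i (T.len Γ) with hi | rfl | hi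
    · rw [← htrunc hi, ← congrFun hσ i, ← hk, T.rHom_comp, T.rHom_p, idRaw,
        if_pos (by exact hi), Raw.subst_var]
    · have h₁ : (T.tw (C.ext A)).lookup (T.len Γ) = some (C.qEl A) := by
        rw [T.tw_ext]
        exact Tower.lookup_snoc_len _ _
      rw [T.rHom_apply k h₁, hk', hb]
    · have hi : T.len (C.ext A) ≤ i := by rw [T.len_ext]; omega
      rw [hbad i hi, T.rHom_eq_bad _ hi]

/-- Completeness of the syntax: the arguments of a symbol assemble into a morphism σ, and the
generator restricted along σ has the given expression. A term is realized in any type whose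
expression is its sort, since type expressions are faithful. -/
theorem exists_of_hasSort {Γ : C.Ob} {r : Raw (Label C) ℕ} {S : Option (Raw (Label C) ℕ)}
    (h : T.sig.HasSort (T.ctx Γ) r S) :
    (S = none → ∃ A : C.Ty Γ, T.rTy A = r) ∧
      ∀ A : C.Ty Γ, S = some (T.rTy A) → ∃ a : C.Tm A, T.rTm a = r := by
  induction h with
  | @var i B h =>
    refine ⟨(by rintro ⟨⟩), fun A hA ↦ ?_⟩
    obtain ⟨⟨B', b⟩, he, rfl⟩ := Option.map_eq_some_iff.1 h
    obtain rfl : B' = A := T.rTy_injective (Option.some.inj hA)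
    exact ⟨b, T.rTm_lookup he⟩
  | @app k args S hk hargs hbad hS ih =>
    obtain ⟨σ, rfl⟩ := T.exists_rHom_aux (Γ := k.ob) (Δ := Γ) (args := args) (fun i A hA B hB ↦ by
      have hi : i < T.len k.ob := by
        by_contra h'
        rw [T.ctx_eq_none.2 (not_lt.1 h')] at hA
        cases hA
      exact (ih i hi).2 B (by simp [sig, hA, hB])) hbad
    cases k with
    | @ty Γ' t B F =>
      change Γ ⟶ Γ' at σ
      refine ⟨fun _ ↦ ⟨C.tySub σ B, ?_⟩, (fun A hA ↦ by simp [hS, sig] at hA)⟩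
      rw [T.rTy_sub, hk.2, Raw.subst_app]
      congr 1
      exact T.idRaw_subst_rHom σ
    | @tm Γ' t B b F =>
      change Γ ⟶ Γ' at σ
      refine ⟨(fun h ↦ by simp [hS, sig] at h), fun A hA ↦ ?_⟩
      have hBA : C.tySub σ B = A := T.rTy_injective (by
        rw [T.rTy_sub]
        exact Option.some.inj (hS.symm.trans hA))
      refine ⟨C.fam.Tm.map σ hBA b, ?_⟩
      rw [T.rTm_sub, hk.2, Raw.subst_app]
      congr 1
      exact T.idRaw_subst_rHom σ

theorem exists_rTy {Γ : C.Ob} {r : Raw (Label C) ℕ} (h : T.sig.HasSort (T.ctx Γ) r none) :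
    ∃ A : C.Ty Γ, T.rTy A = r := (T.exists_of_hasSort h).1 rfl

theorem exists_rTm {Γ : C.Ob} {r : Raw (Label C) ℕ} {A : C.Ty Γ}
    (h : T.sig.HasSort (T.ctx Γ) r (some (T.rTy A))) : ∃ a : C.Tm A, T.rTm a = r :=
  (T.exists_of_hasSort h).2 A rfl

theorem exists_rHom {Γ Δ : C.Ob} {args : ℕ → Raw (Label C) ℕ}
    (h : ∀ i A, T.ctx Γ i = some A → T.sig.HasSort (T.ctx Δ) (args i) (some (A.subst args)))
    (hbad : ∀ i, T.len Γ ≤ i → args i = .bad) : ∃ σ : Δ ⟶ Γ, T.rHom σ = args :=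
  T.exists_rHom_aux (fun i A hA _ hB ↦ T.exists_rTm (hB ▸ h i A hA)) hbad

theorem lt_of_occurs_rTy {Γ : C.Ob} {A : C.Ty Γ} {j : ℕ} (h : (T.rTy A).Occurs j) :
    j < T.len Γ := by
  rw [← T.rTy_subst_idRaw] at h
  obtain ⟨v, -, hv⟩ := Raw.occurs_subst.1 h
  unfold idRaw at hv
  split_ifs at hv with h'
  · exact (show v = j from hv) ▸ h'
  · exact hv.elim

theorem lt_of_occurs_ctx {Γ : C.Ob} {i j : ℕ} {A : Raw (Label C) ℕ} (h : T.ctx Γ i = some A)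
    (hj : A.Occurs j) : j < i := by
  induction Γ using T.ob_induction with
  | empty => simp [T.ctx_empty] at h
  | ext Γ B ih =>
    rw [T.ctx_ext] at h
    split_ifs at h with hi
    · cases h
      rw [hi]
      exact T.lt_of_occurs_rTy hj
    · exact ih h

theorem hasSort_ctx {Γ : C.Ob} {i : ℕ} {A : Raw (Label C) ℕ} (h : T.ctx Γ i = some A) :
    T.sig.HasSort (T.ctx Γ) A none := by
  obtain ⟨e, he, rfl⟩ := Option.map_eq_some_iff.1 h
  exact T.hasSort_rTy e.1

theorem exists_ctx {Γ : C.Ob} {i : ℕ} (h : i < T.len Γ) : ∃ A, T.ctx Γ i = some A :=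
  Option.ne_none_iff_exists'.1 fun h' ↦ absurd (T.ctx_eq_none.1 h') (not_le.2 h)

theorem argCtx_eq (k : Label C) : T.sig.argCtx k = T.ctx k.ob := by
  funext i
  unfold Signature.argCtx
  split_ifs with h
  · obtain ⟨A, hA⟩ := T.exists_ctx h
    simp [sig, hA]
  · exact (T.ctx_eq_none.2 (not_lt.1 h)).symm

/-- A valid label is the one chosen for its generator, and for that one the recorded weight is the
explicit sum. -/
theorem measure_eq {k : Label C} (hk : T.sig.valid k) (m : ℕ → ℕ) :
    k.measure m = 1 + ∑ i ∈ Finset.range (T.sig.arity k), m i +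
      ((T.sig.out k).map fun A ↦ A.eval Label.measure m).getD 0 := by
  cases k with
  | ty t A F =>
    have h := hk.2.symm.trans (T.gen_ty A hk.1)
    simp only [Raw.app.injEq, Label.ty.injEq, heq_eq_eq, true_and] at h
    obtain ⟨⟨rfl, rfl⟩, -⟩ := h
    rfl
  | tm t A a F =>
    have h := hk.2.symm.trans (T.gen_tm a hk.1)
    simp only [Raw.app.injEq, Label.tm.injEq, heq_eq_eq, true_and] at h
    obtain ⟨⟨rfl, rfl⟩, -⟩ := h
    rfl

theorem out_eq_some {k : Label C} {A : Raw (Label C) ℕ} (h : T.sig.out k = some A) :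
    ∃ B : C.Ty k.ob, A = T.rTy B := by
  cases k with
  | ty => cases h
  | tm t B => exact ⟨B, (Option.some.inj h).symm⟩

theorem sig_isWf : T.sig.IsWf Label.measure where
  ar_occurs {k i j} _ hi hj := by
    obtain ⟨A, hA⟩ := T.exists_ctx hi
    simp only [sig, hA, Option.getD_some] at hj
    exact T.lt_of_occurs_ctx hA hj
  out_occurs {k A j} _ hA hj := by
    obtain ⟨B, rfl⟩ := T.out_eq_some hA
    exact T.lt_of_occurs_rTy hj
  ar_hasSort {k i} _ hi := by
    obtain ⟨A, hA⟩ := T.exists_ctx hi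
    rw [T.argCtx_eq]
    simpa [sig, hA] using T.hasSort_ctx hA
  out_hasSort {k A} _ hA := by
    obtain ⟨B, rfl⟩ := T.out_eq_some hA
    rw [T.argCtx_eq]
    exact T.hasSort_rTy B
  arg_lt {k i} m hk hi := by
    rw [T.measure_eq hk]
    have := Finset.single_le_sum (f := m) (fun _ _ ↦ Nat.zero_le _) (Finset.mem_range.2 hi)
    omega
  out_lt {k A} m hk hA := by
    rw [T.measure_eq hk, hA]
    simp only [Option.map_some, Option.getD_some]
    omega

end Presentation

end CwF

/-! ### Contexts with parameters over an object -/

namespace CwF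

open Signature

variable {C : CwF.{u}}

/-- The set of parameters. -/
abbrev params : Set (ℕ ⊕ ℕ) := Set.range Sum.inr

/-- Expressions without parameters, seen as expressions with parameters. -/
def up (r : Raw (Label C) ℕ) : Raw (Label C) (ℕ ⊕ ℕ) := r.subst fun i ↦ .var (.inl i)

/-- The substitution forgetting the parameters. -/
def down : ℕ ⊕ ℕ → Raw (Label C) ℕ := Sum.elim .var fun _ ↦ .bad

theorem subst_down_up (r : Raw (Label C) ℕ) : (up r).subst down = r := by
  rw [up, Raw.subst_subst]
  exact Raw.subst_eq_self fun _ _ ↦ rfl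

theorem up_injective : Function.Injective (up (C := C)) := fun r s h ↦ by
  rw [← subst_down_up r, h, subst_down_up]

theorem inl_notMem_params (i : ℕ) : Sum.inl i ∉ params := by simp [params]

theorem exists_of_base {r : Raw (Label C) (ℕ ⊕ ℕ)} (hr : Base params r) {v : ℕ ⊕ ℕ}
    (hv : r.Occurs v) : ∃ i, v = .inl i := by
  cases v with
  | inl i => exact ⟨i, rfl⟩
  | inr j => exact absurd ⟨j, rfl⟩ (hr _ hv)

theorem base_up (r : Raw (Label C) ℕ) : Base params (up r) := by
  intro v hv
  obtain ⟨i, -, hi⟩ := Raw.occurs_subst.1 hv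
  exact (show Sum.inl i = v from hi) ▸ inl_notMem_params i

theorem up_subst_down {r : Raw (Label C) (ℕ ⊕ ℕ)} (hr : Base params r) : up (r.subst down) = r := by
  rw [up, Raw.subst_subst]
  refine Raw.subst_eq_self fun v hv ↦ ?_
  obtain ⟨i, rfl⟩ := exists_of_base hr hv
  rfl

namespace Presentation

variable {Gty : Set (tyFunctor.obj C)} {G : Set (tmFunctor.obj C)} (T : Presentation Gty G)

/-- The context with parameters with the variables of an object and with given parameters. -/
def pctx (Θ : C.Ob) (E : ℕ → Option (Raw (Label C) (ℕ ⊕ ℕ))) :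
    ℕ ⊕ ℕ → Option (Raw (Label C) (ℕ ⊕ ℕ)) :=
  Sum.elim (fun i ↦ (T.ctx Θ i).map up) E

/-- The substitution between contexts with parameters given by a morphism. -/
def lift {Θ Θ' : C.Ob} (κ : Θ' ⟶ Θ) : ℕ ⊕ ℕ → Raw (Label C) (ℕ ⊕ ℕ) :=
  Sum.elim (fun i ↦ up (T.rHom κ i)) fun j ↦ .var (.inr j)

variable {Θ Θ' Θ'' : C.Ob} {E E' : ℕ → Option (Raw (Label C) (ℕ ⊕ ℕ))}

theorem lift_injective {κ κ' : Θ' ⟶ Θ} (h : T.lift κ = T.lift κ') : κ = κ' :=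
  T.rHom_injective (funext fun i ↦ up_injective (congrFun h (.inl i)))

theorem up_subst_lift (κ : Θ' ⟶ Θ) (r : Raw (Label C) ℕ) :
    (up r).subst (T.lift κ) = up (r.subst (T.rHom κ)) := by
  rw [up, up, Raw.subst_subst, Raw.subst_subst]
  rfl

theorem lift_comp (κ : Θ' ⟶ Θ) (κ' : Θ'' ⟶ Θ') :
    T.lift (κ' ≫ κ) = comp (T.lift κ) (T.lift κ') := by
  funext v
  cases v with
  | inl i =>
    change up _ = (up _).subst _
    rw [T.rHom_comp, up_subst_lift]
  | inr j => rfl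

theorem hasSort_up {r : Raw (Label C) ℕ} {S : Option (Raw (Label C) ℕ)}
    (h : T.sig.HasSort (T.ctx Θ) r S) : T.sig.HasSort (T.pctx Θ E) (up r) (S.map up) :=
  h.subst fun v _ A hA ↦ .var (by simp [pctx, hA, up])

theorem hasSort_down {r : Raw (Label C) (ℕ ⊕ ℕ)} {S : Option (Raw (Label C) (ℕ ⊕ ℕ))}
    (h : T.sig.HasSort (T.pctx Θ E) r S) (hr : Base params r) :
    T.sig.HasSort (T.ctx Θ) (r.subst down) (S.map (Raw.subst down)) :=
  h.subst fun v hv A hA ↦ by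
    obtain ⟨i, rfl⟩ := exists_of_base hr hv
    obtain ⟨A', hA', rfl⟩ := Option.map_eq_some_iff.1 hA
    rw [subst_down_up]
    exact .var hA'

theorem wfCtx_pctx (hE : ∀ j A, E j = some A → T.sig.HasSort (T.pctx Θ E) A none) :
    T.sig.WfCtx params (T.pctx Θ E) where
  finite := by
    refine ((Set.finite_Iio (T.len Θ)).image Sum.inl).subset ?_
    rintro (i | j) ⟨h, h'⟩
    · refine ⟨i, ?_, rfl⟩
      by_contra hi
      exact h' (by simp [pctx, T.ctx_eq_none.2 (not_lt.1 hi)])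
    · exact absurd ⟨j, rfl⟩ h
  hasSort v A hA := by
    cases v with
    | inl i =>
      obtain ⟨A', hA', rfl⟩ := Option.map_eq_some_iff.1 hA
      exact T.hasSort_up (T.hasSort_ctx hA')
    | inr j => exact hE j A hA
  base v hv A hA := by
    cases v with
    | inl i =>
      obtain ⟨A', hA', rfl⟩ := Option.map_eq_some_iff.1 hA
      exact base_up A'
    | inr j => exact absurd ⟨j, rfl⟩ hv

theorem mor_lift (κ : Θ' ⟶ Θ) (hE : ∀ j, E' j = (E j).map (Raw.subst (T.lift κ))) :
    T.sig.Mor params (T.pctx Θ' E') (T.pctx Θ E) (T.lift κ) where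
  param := by
    rintro _ ⟨j, rfl⟩
    rfl
  base v hv := by
    cases v with
    | inl i => exact base_up _
    | inr j => exact absurd ⟨j, rfl⟩ hv
  eq_bad v hv h := by
    cases v with
    | inl i =>
      have := T.ctx_eq_none.1 (Option.map_eq_none_iff.1 h)
      simp [lift, T.rHom_eq_bad κ this, up]
    | inr j => exact absurd ⟨j, rfl⟩ hv
  hasSort' v hv A hA := by
    cases v with
    | inl i =>
      obtain ⟨A', hA', rfl⟩ := Option.map_eq_some_iff.1 hA
      rw [up_subst_lift]
      exact T.hasSort_up (T.hasSort_rHom κ hA')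
    | inr j => exact absurd ⟨j, rfl⟩ hv
  map_param := by
    rintro _ ⟨j, rfl⟩
    exact hE j

/-- A morphism of contexts with parameters sends variables to parameter-free expressions. Forgetting
the parameters loses nothing, and completeness realizes the resulting sequence. -/
theorem exists_lift {f : ℕ ⊕ ℕ → Raw (Label C) (ℕ ⊕ ℕ)}
    (hf : T.sig.Mor params (T.pctx Θ' E') (T.pctx Θ E) f) : ∃ κ : Θ' ⟶ Θ, T.lift κ = f := by
  obtain ⟨κ, hκ⟩ := T.exists_rHom (Γ := Θ) (Δ := Θ') (args := fun i ↦ (f (.inl i)).subst down)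
    (fun i A hA ↦ by
      have := T.hasSort_down (hf.hasSort' (.inl i) (inl_notMem_params i) (up A)
        (by simp [pctx, hA]))
        (hf.base _ (inl_notMem_params i))
      simpa [up, Raw.subst_subst] using this)
    (fun i hi ↦ by
      rw [hf.eq_bad _ (inl_notMem_params i) (by simp [pctx, T.ctx_eq_none.2 hi]), Raw.subst_bad])
  refine ⟨κ, funext fun v ↦ ?_⟩
  cases v with
  | inl i =>
    simp only [lift, Sum.elim_inl, hκ]
    exact up_subst_down (hf.base _ (inl_notMem_params i))
  | inr j => exact (hf.param _ ⟨j, rfl⟩).symm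

/-! ### Realization of contexts by objects -/

/-- Contexts are well founded: the variables can be weighed such that every variable weighs more
than its type. -/
theorem exists_weight (Θ : C.Ob) :
    ∃ m : ℕ → ℕ, ∀ i A, T.ctx Θ i = some A → A.eval Label.measure m < m i := by
  induction Θ using T.ob_induction with
  | empty => exact ⟨0, fun i A h ↦ by simp [T.ctx_empty] at h⟩
  | ext Θ B ih =>
    obtain ⟨m, hm⟩ := ih
    -- No type in the context mentions the last variable, so its weight can be chosen without
    -- affecting the weights of the types.
    have key {i : ℕ} {A : Raw (Label C) ℕ} (h : T.ctx (C.ext B) i = some A) (hi : i ≤ T.len Θ) :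
        A.eval Label.measure (Function.update m (T.len Θ) ((T.rTy B).eval Label.measure m + 1)) =
          A.eval Label.measure m :=
      Raw.eval_congr _ fun v hv ↦ by
        have := T.lt_of_occurs_ctx h hv
        rw [Function.update_of_ne (by omega)]
    refine ⟨Function.update m (T.len Θ) ((T.rTy B).eval Label.measure m + 1), fun i A h ↦ ?_⟩
    have h' := h
    rw [T.ctx_ext] at h'
    split_ifs at h' with hi
    · cases h'
      rw [key h hi.le, hi, Function.update_self]
      omega
    · have hi' : i < T.len Θ := by
        by_contra h''
        rw [T.ctx_eq_none.2 (not_lt.1 h'')] at h'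
        cases h'
      rw [key h hi'.le, Function.update_of_ne hi]
      exact hm i A h'

variable {Γ₀ : ℕ ⊕ ℕ → Option (Raw (Label C) (ℕ ⊕ ℕ))}

/-- The rank of a variable is the weight of its image under `h`. If `i'` occurs in the type `A` of
`i`, its image weighs at most as much as the image of `A`, which weighs less than its term `h i`. -/
theorem exists_rank (hΓ₀ : T.sig.WfCtx params Γ₀) {h : ℕ ⊕ ℕ → Raw (Label C) (ℕ ⊕ ℕ)}
    (hh : T.sig.Mor params (T.pctx Θ E) Γ₀ h) :
    ∃ rank : ℕ → ℕ, ∀ i A, Γ₀ (.inl i) = some A → ∀ i', A.Occurs (.inl i') → rank i' < rank i := by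
  obtain ⟨m, hm⟩ := T.exists_weight Θ
  refine ⟨fun i ↦ ((h (.inl i)).subst down).eval Label.measure m, fun i A hA i' hi' ↦ ?_⟩
  have h₁ := (hΓ₀.hasSort _ A hA).le_eval T.sig_isWf
    (m := fun v ↦ ((h v).subst down).eval Label.measure m) hi'
  have h₂ := (T.hasSort_down (hh.hasSort hA) (hh.base _ (inl_notMem_params i))).eval_lt
    T.sig_isWf hm
  rw [Raw.subst_subst, Raw.eval_subst] at h₂
  exact h₁.trans_lt h₂

/-- Variables are added by increasing rank: the type of the new one lies over the object built so
far, and no type mentions a variable of maximal rank. The map `e` gives the position of a variable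
and `d` the variable at a position. -/
theorem exists_ob (hΓ₀ : T.sig.WfCtx params Γ₀) {rank : ℕ → ℕ}
    (hrank : ∀ i A, Γ₀ (.inl i) = some A → ∀ i', A.Occurs (.inl i') → rank i' < rank i)
    (s : Finset ℕ) (hs : ∀ i ∈ s, ∃ A, Γ₀ (.inl i) = some A)
    (hs' : ∀ i ∈ s, ∀ A, Γ₀ (.inl i) = some A → ∀ i', A.Occurs (.inl i') → i' ∈ s) :
    ∃ (Θ₀ : C.Ob) (e d : ℕ → ℕ), (∀ i ∈ s, e i < T.len Θ₀ ∧ d (e i) = i) ∧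
      (∀ k < T.len Θ₀, d k ∈ s ∧ e (d k) = k) ∧ ∀ i ∈ s, ∀ A, Γ₀ (.inl i) = some A →
        T.ctx Θ₀ (e i) = some (A.subst (Sum.elim (fun i ↦ .var (e i)) fun _ ↦ .bad)) := by
  induction s using Finset.induction_on_max_value rank with
  | empty => exact ⟨C.empty, id, id, by simp, by simp [T.len_empty], by simp⟩
  | insert a s ha hmax ih =>
    have hclosed : ∀ i ∈ insert a s, ∀ A, Γ₀ (.inl i) = some A → ∀ i', A.Occurs (.inl i') →
        i' ∈ s := by
      intro i hi A hA i' hi'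
      refine (Finset.mem_insert.1 (hs' i hi A hA i' hi')).resolve_left ?_
      rintro rfl
      have := hrank i A hA i' hi'
      rcases Finset.mem_insert.1 hi with rfl | hi
      · omega
      · have := hmax i hi
        omega
    obtain ⟨Θ₀, e, d, h₁, h₂, h₃⟩ := ih (fun i hi ↦ hs i (Finset.mem_insert_of_mem hi))
      fun i hi ↦ hclosed i (Finset.mem_insert_of_mem hi)
    obtain ⟨A, hA⟩ := hs a (Finset.mem_insert_self a s)
    have hAs := hclosed a (Finset.mem_insert_self a s) A hA
    obtain ⟨B, hB⟩ := T.exists_rTy ((hΓ₀.hasSort _ A hA).subst (Δ := T.ctx Θ₀)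
      (f := Sum.elim (fun i ↦ .var (e i)) fun _ ↦ .bad) fun v hv A' hA' ↦ by
        obtain ⟨i, rfl⟩ := exists_of_base (hΓ₀.base _ (inl_notMem_params a) A hA) hv
        exact .var (h₃ i (hAs i hv) A' hA'))
    have hne {i : ℕ} (hi : i ∈ s) : i ≠ a := fun h ↦ ha (h ▸ hi)
    have hsub {i : ℕ} (hi : i ∈ insert a s) {A : Raw (Label C) (ℕ ⊕ ℕ)}
        (hA : Γ₀ (.inl i) = some A) :
        A.subst (Sum.elim (fun i ↦ .var (Function.update e a (T.len Θ₀) i)) fun _ ↦ .bad) =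
          A.subst (W := ℕ) (Sum.elim (fun i ↦ .var (e i)) fun _ ↦ .bad) := by
      refine Raw.subst_congr fun v hv ↦ ?_
      obtain ⟨i', rfl⟩ := exists_of_base (hΓ₀.base _ (inl_notMem_params i) A hA) hv
      simp [hne (hclosed i hi A hA i' hv)]
    refine ⟨C.ext B, Function.update e a (T.len Θ₀), Function.update d (T.len Θ₀) a, ?_, ?_, ?_⟩
    · intro i hi
      rw [T.len_ext]
      rcases Finset.mem_insert.1 hi with rfl | hi
      · simp
      · have := h₁ i hi
        rw [Function.update_of_ne (hne hi), Function.update_of_ne this.1.ne]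
        exact ⟨by omega, this.2⟩
    · intro k hk
      rw [T.len_ext] at hk
      by_cases hk' : k = T.len Θ₀
      · simp [hk']
      · have := h₂ k (by omega)
        rw [Function.update_of_ne hk', Function.update_of_ne (hne this.1)]
        exact ⟨Finset.mem_insert_of_mem this.1, this.2⟩
    · intro i hi Ai hAi
      rw [hsub hi hAi, T.ctx_ext]
      rcases Finset.mem_insert.1 hi with rfl | hi
      · obtain rfl : A = Ai := Option.some.inj (hA.symm.trans hAi)
        simp [hB]
      · rw [Function.update_of_ne (hne hi), if_neg (h₁ i hi).1.ne]
        exact h₃ i hi Ai hAi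

/-- A well-formed context with parameters which admits a morphism from a context over an object is
itself isomorphic to a context over an object. -/
theorem exists_iso (hΓ₀ : T.sig.WfCtx params Γ₀) {h : ℕ ⊕ ℕ → Raw (Label C) (ℕ ⊕ ℕ)}
    (hh : T.sig.Mor params (T.pctx Θ E) Γ₀ h) :
    ∃ Θ₀ E₀ u v, T.sig.Mor params (T.pctx Θ₀ E₀) Γ₀ u ∧ T.sig.Mor params Γ₀ (T.pctx Θ₀ E₀) v ∧
      comp u v = idSub params Γ₀ ∧ comp v u = idSub params (T.pctx Θ₀ E₀) := by
  classical
  obtain ⟨rank, hrank⟩ := T.exists_rank hΓ₀ hh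
  have hfin : {i | Γ₀ (.inl i) ≠ none}.Finite :=
    (hΓ₀.finite.preimage Sum.inl_injective.injOn).subset fun i hi ↦ ⟨inl_notMem_params i, hi⟩
  have hmem {i : ℕ} : i ∈ hfin.toFinset ↔ ∃ A, Γ₀ (.inl i) = some A := by
    simp [Option.ne_none_iff_exists']
  obtain ⟨Θ₀, e, d, h₁, h₂, h₃⟩ := T.exists_ob hΓ₀ hrank hfin.toFinset (fun i hi ↦ hmem.1 hi)
    fun i _ A hA i' hi' ↦ hmem.2 ((hΓ₀.hasSort _ A hA).exists_of_occurs hi')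
  let u : ℕ ⊕ ℕ → Raw (Label C) (ℕ ⊕ ℕ) :=
    Sum.elim (fun i ↦ if Γ₀ (.inl i) ≠ none then .var (.inl (e i)) else .bad) fun j ↦ .var (.inr j)
  let v : ℕ ⊕ ℕ → Raw (Label C) (ℕ ⊕ ℕ) :=
    Sum.elim (fun k ↦ if k < T.len Θ₀ then .var (.inl (d k)) else .bad) fun j ↦ .var (.inr j)
  -- These parameter types are forced by the condition `map_param` on `u`.
  let E₀ (j : ℕ) : Option (Raw (Label C) (ℕ ⊕ ℕ)) := (Γ₀ (.inr j)).map (Raw.subst u)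
  have hpctx (i : ℕ) (hi : ∃ A, Γ₀ (.inl i) = some A) :
      T.pctx Θ₀ E₀ (.inl (e i)) = (Γ₀ (.inl i)).map (Raw.subst u) := by
    obtain ⟨A, hA⟩ := hi
    simp only [pctx, Sum.elim_inl, h₃ i (hmem.2 ⟨A, hA⟩) A hA, Option.map_some, hA, up,
      Raw.subst_subst, Option.some.injEq]
    refine Raw.subst_congr fun v hv ↦ ?_
    obtain ⟨i', rfl⟩ := exists_of_base (hΓ₀.base _ (inl_notMem_params i) A hA) hv
    obtain ⟨A', hA'⟩ := (hΓ₀.hasSort _ A hA).exists_of_occurs hv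
    simp [u, hA']
  have huv : comp u v = idSub params Γ₀ := by
    funext w
    cases w with
    | inl i =>
      by_cases hi : Γ₀ (.inl i) = none
      · simp [comp, u, idSub, hi]
      · have := h₁ i (by simpa using hi)
        simp [comp, u, v, idSub, hi, this]
    | inr j => simp [comp, u, v, idSub]
  have hsub {w : ℕ ⊕ ℕ} {A : Raw (Label C) (ℕ ⊕ ℕ)} (hA : Γ₀ w = some A) :
      (A.subst u).subst v = A := by
    rw [← subst_comp, huv, (hΓ₀.hasSort _ A hA).subst_idSub]
  refine ⟨Θ₀, E₀, u, v, ⟨⟨?_, ?_⟩, ?_, ?_, ?_⟩, ⟨⟨?_, ?_⟩, ?_, ?_, ?_⟩, huv, ?_⟩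
  · rintro _ ⟨j, rfl⟩
    rfl
  · rintro (i | j) hv
    · by_cases hi : Γ₀ (.inl i) = none
      · simp [u, hi, Base, Raw.Occurs]
      · simp [u, hi, Base, Raw.Occurs]
    · exact absurd ⟨j, rfl⟩ hv
  · rintro (i | j) hv hi
    · simp [u, hi]
    · exact absurd ⟨j, rfl⟩ hv
  · rintro (i | j) hv A hA
    · have := hpctx i ⟨A, hA⟩
      rw [hA] at this
      have hu : u (.inl i) = .var (.inl (e i)) := by simp [u, hA]
      rw [hu]
      exact .var this
    · exact absurd ⟨j, rfl⟩ hv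
  · rintro _ ⟨j, rfl⟩
    rfl
  · rintro _ ⟨j, rfl⟩
    rfl
  · rintro (k | j) hv
    · by_cases hk : k < T.len Θ₀
      · simp [v, hk, Base, Raw.Occurs]
      · simp [v, hk, Base, Raw.Occurs]
    · exact absurd ⟨j, rfl⟩ hv
  · rintro (k | j) hv hk
    · have := T.ctx_eq_none.1 (Option.map_eq_none_iff.1 hk)
      simp [v, not_lt.2 this]
    · exact absurd ⟨j, rfl⟩ hv
  · rintro (k | j) hv A hA
    · have hk : k < T.len Θ₀ := by
        by_contra hk
        simp [pctx, T.ctx_eq_none.2 (not_lt.1 hk)] at hA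
      obtain ⟨hd, hed⟩ := h₂ k hk
      have := hpctx (d k) (hmem.1 hd)
      rw [hed, hA] at this
      obtain ⟨A', hA', rfl⟩ := Option.map_eq_some_iff.1 this.symm
      rw [hsub hA']
      simp only [v, Sum.elim_inl, hk, if_true]
      exact .var hA'
    · exact absurd ⟨j, rfl⟩ hv
  · rintro _ ⟨j, rfl⟩
    simp only [pctx, Sum.elim_inr, E₀, Option.map_map]
    cases hj : Γ₀ (.inr j) with
    | none => rfl
    | some A => simp [hsub hj]
  · funext w
    cases w with
    | inl k =>
      by_cases hk : k < T.len Θ₀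
      · obtain ⟨A, hA⟩ := T.exists_ctx hk
        obtain ⟨hd, hed⟩ := h₂ k hk
        obtain ⟨B, hB⟩ := hmem.1 hd
        simp [comp, u, v, idSub, hk, pctx, hA, hed, hB]
      · simp [comp, v, idSub, hk, pctx, T.ctx_eq_none.2 (not_lt.1 hk)]
    | inr j => simp [comp, u, v, idSub]

end Presentation

end CwF

/-! ### Generic elements -/

/-- A criterion for familial representability: it suffices to find a generalization of every element
that is most general among all the elements which have a common instance with it. -/
theorem isFamiliallyRepresentable_of_exists {C : Type u} [Category.{u} C] {X : Cᵒᵖ ⥤ Type u}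
    (H : ∀ (Γ : C) (x : X.obj (op Γ)), ∃ (Γ₀ : C) (x₀ : X.obj (op Γ₀)),
      (∃ f : Γ ⟶ Γ₀, X.map f.op x₀ = x) ∧ ∀ (Δ W : C) (f : Δ ⟶ Γ₀) (g : Δ ⟶ W) (w : X.obj (op W)),
        X.map g.op w = X.map f.op x₀ → ∃! h : W ⟶ Γ₀, X.map h.op x₀ = w) :
    IsFamiliallyRepresentable X := by
  -- All generic elements of which `x` is an instance are collected. This set is the same for every
  -- restriction of `x`, so a choice depending only on the set is strictly natural, however
  -- arbitrary it is.
  let generic (Γ : C) (x : X.obj (op Γ)) : Set (Σ Γ₀ : C, X.obj (op Γ₀)) :=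
    {z | (∃ f : Γ ⟶ z.1, X.map f.op z.2 = x) ∧
      ∀ (Δ W : C) (f : Δ ⟶ z.1) (g : Δ ⟶ W) (w : X.obj (op W)),
        X.map g.op w = X.map f.op z.2 → ∃! h : W ⟶ z.1, X.map h.op z.2 = w}
  have hne (Γ : C) (x : X.obj (op Γ)) : (generic Γ x).Nonempty := by
    obtain ⟨Γ₀, x₀, h⟩ := H Γ x
    exact ⟨⟨Γ₀, x₀⟩, h⟩
  choose c hc using fun s : {s : Set (Σ Γ₀ : C, X.obj (op Γ₀)) // s.Nonempty} ↦ s.2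
  refine ⟨fun Γ x ↦ c ⟨generic Γ x, hne Γ x⟩, fun Γ Δ f x ↦ congrArg c (Subtype.ext ?_),
    fun Γ x ↦ ?_⟩
  · ext z
    refine and_congr_left fun hz ↦ ⟨?_, ?_⟩
    · rintro ⟨g, hg⟩
      exact (hz Δ Γ g f x hg.symm).exists
    · rintro ⟨g, hg⟩
      exact ⟨f ≫ g, map_comp_op hg rfl⟩
  · obtain ⟨⟨f, hf⟩, h⟩ := hc ⟨generic Γ x, hne Γ x⟩
    exact h Γ Γ f (𝟙 Γ) x ((map_id_op x).trans hf.symm)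

namespace DepPresheaf

variable {C : Type u} [Category.{u} C] {X : Cᵒᵖ ⥤ Type u} (Y : DepPresheaf X)

/-- An element `t₀` of `Y` over an instance of `x` is generic if it is most general among all the
elements which have a common instance with it. -/
def IsGeneric {Γ Θ₀ : C} (x : X.obj (op Γ)) (ρ₀ : Θ₀ ⟶ Γ) {y₀ : X.obj (op Θ₀)}
    (t₀ : Y.obj y₀) : Prop :=
  ∀ {Δ W : C} (f : Δ ⟶ Θ₀) (g : Δ ⟶ W) (ρ : W ⟶ Γ) {y : X.obj (op W)}, X.map ρ.op x = y →
    ∀ (t : Y.obj y) {z : X.obj (op Δ)} (hz : X.map g.op y = z) (hz' : X.map f.op y₀ = z),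
      g ≫ ρ = f ≫ ρ₀ → Y.map g hz t = Y.map f hz' t₀ →
        ∃! h : W ⟶ Θ₀, h ≫ ρ₀ = ρ ∧ ∃ e : X.map h.op y₀ = y, Y.map h e t₀ = t

/-- Every element of `Y` is an instance of a generic one. -/
def HasGenerics : Prop :=
  ∀ {Γ Θ : C} (x : X.obj (op Γ)) (ρ : Θ ⟶ Γ) {y : X.obj (op Θ)}, X.map ρ.op x = y →
    ∀ t : Y.obj y, ∃ (Θ₀ : C) (ρ₀ : Θ₀ ⟶ Γ) (y₀ : X.obj (op Θ₀)) (t₀ : Y.obj y₀) (k : Θ ⟶ Θ₀),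
      X.map ρ₀.op x = y₀ ∧ Y.IsGeneric x ρ₀ t₀ ∧ k ≫ ρ₀ = ρ ∧
        ∃ e : X.map k.op y₀ = y, Y.map k e t₀ = t

variable {Y}

/-- Both morphisms exhibit the same element as an instance of `t₀`, and an instance factors
uniquely. -/
theorem IsGeneric.hom_ext {Γ Θ₀ : C} {x : X.obj (op Γ)} {ρ₀ : Θ₀ ⟶ Γ} {y₀ : X.obj (op Θ₀)}
    {t₀ : Y.obj y₀} (ht₀ : Y.IsGeneric x ρ₀ t₀) (hy₀ : X.map ρ₀.op x = y₀) {Δ : C} {f g : Δ ⟶ Θ₀}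
    (h : f ≫ ρ₀ = g ≫ ρ₀) {z : X.obj (op Δ)} (hf : X.map f.op y₀ = z) (hg : X.map g.op y₀ = z)
    (h' : Y.map f hf t₀ = Y.map g hg t₀) : f = g :=
  (ht₀ g (𝟙 Δ) (g ≫ ρ₀) (map_comp_op hy₀ hg) (Y.map g hg t₀) (map_id_op z) hg (Category.id_comp _)
    (Y.map_id _ _)).unique ⟨h, hf, h'⟩ ⟨rfl, hg, rfl⟩

theorem HasGenerics.isLocallyFamiliallyRepresentable (hY : Y.HasGenerics) :
    Y.IsLocallyFamiliallyRepresentable := by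
  refine fun Γ x ↦ isFamiliallyRepresentable_of_exists fun ρ t ↦ ?_
  obtain ⟨Θ₀, ρ₀, _, t₀, k, rfl, ht₀, hk, e, rfl⟩ := hY x ρ.hom rfl t
  refine ⟨Over.mk ρ₀, t₀, ⟨Over.homMk k hk, rfl⟩, fun Δ W f g w hw ↦ ?_⟩
  obtain ⟨h, ⟨h₁, _, h₂⟩, hu⟩ := ht₀ f.left g.left W.hom rfl w (z := X.map Δ.hom.op x)
    (by rw [← Functor.map_comp_apply, ← op_comp, Over.w])
    (by rw [← Functor.map_comp_apply, ← op_comp]; exact congrArg (fun a ↦ X.map a.op x) (Over.w f))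
    ((Over.w g).trans (Over.w f).symm) hw
  refine ⟨Over.homMk h h₁, h₂, fun h' hh' ↦ ?_⟩
  ext
  exact hu h'.left ⟨Over.w h', _, hh'⟩

/-- A global element is the restriction of its value at the terminal object, and compatibility with
the maps to that object is automatic. -/
theorem HasGenerics.isFamiliallyRepresentable_atGlobal (hY : Y.HasGenerics) {E : C}
    (hE : IsTerminal E) (s : X.sections) : IsFamiliallyRepresentable (Y.atGlobal s) := by
  refine isFamiliallyRepresentable_of_exists fun Γ t ↦ ?_
  obtain ⟨Θ₀, ρ₀, y₀, t₀, k, hy₀, ht₀, -, e, h⟩ := hY (s.1 (op E)) (hE.from Γ) (s.2 _) t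
  obtain rfl : s.1 (op Θ₀) = y₀ := (s.2 ρ₀.op).symm.trans hy₀
  refine ⟨Θ₀, t₀, ⟨k, h⟩, fun Δ W f g w hw ↦ ?_⟩
  obtain ⟨h, ⟨-, _, h₂⟩, hu⟩ := ht₀ f g (hE.from W) (s.2 _) w (s.2 g.op) (s.2 f.op)
    (hE.hom_ext _ _) hw
  exact ⟨h, h₂, fun h' hh' ↦ hu h' ⟨hE.hom_ext _ _, _, hh'⟩⟩

end DepPresheaf

/-! ### Closure of generic elements under sums, dependent sums and telescopes. -/

namespace Family

variable {C : Type u} [Category.{u} C]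

theorem sum_map {ι : Type} (F : ι → Family C) {i : ι} {Γ Δ : C} (f : Δ ⟶ Γ)
    {x : (F i).Ty.obj (op Γ)} {y : (F i).Ty.obj (op Δ)} (h : (F i).Ty.map f.op x = y)
    (h' : (sum F).Ty.map f.op ⟨i, x⟩ = ⟨i, y⟩) (t : (F i).Tm.obj x) :
    (sum F).Tm.map (x := ⟨i, x⟩) (y := ⟨i, y⟩) f h' t = (F i).Tm.map f h t := by
  subst h
  rfl

theorem hasGenerics_sum {ι : Type} {F : ι → Family C} (hF : ∀ i, (F i).Tm.HasGenerics) :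
    (sum F).Tm.HasGenerics := by
  rintro Γ Θ ⟨i, x⟩ ρ _ rfl t
  obtain ⟨Θ₀, ρ₀, y₀, t₀, k, hy₀, ht₀, hk, e, rfl⟩ := hF i x ρ rfl t
  refine ⟨Θ₀, ρ₀, ⟨i, y₀⟩, t₀, k, congrArg (Sigma.mk i) hy₀, ?_, hk, congrArg (Sigma.mk i) e,
    sum_map F k e _ t₀⟩
  rintro Δ W f g ρ' _ rfl t' _ rfl hz' hg ht'
  have hz'' : (F i).Ty.map f.op y₀ = (F i).Ty.map g.op ((F i).Ty.map ρ'.op x) := by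
    rw [← hy₀, map_comp_op (X := (F i).Ty) rfl rfl |>.symm, ← hg, map_comp_op rfl rfl]
  have ht'' : (F i).Tm.map g rfl t' = (F i).Tm.map f hz'' t₀ :=
    ht'.trans (sum_map F f hz'' hz' t₀)
  obtain ⟨h, ⟨h₁, e', h₂⟩, hu⟩ := ht₀ f g ρ' rfl t' rfl hz'' hg ht''
  refine ⟨h, ⟨h₁, congrArg (Sigma.mk i) e', (sum_map F h e' _ t₀).trans h₂⟩, ?_⟩
  rintro h' ⟨h₁', e'', h₂'⟩
  have e''' : (F i).Ty.map h'.op y₀ = (F i).Ty.map ρ'.op x := by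
    rw [← hy₀, map_comp_op (X := (F i).Ty) rfl rfl |>.symm, h₁']
  exact hu h' ⟨h₁', e''', (sum_map F h' e''' e'' t₀).symm.trans h₂'⟩

theorem hasGenerics_single : (single ((Functor.const Cᵒᵖ).obj PUnit.{u + 1})).Tm.HasGenerics := by
  intro Γ Θ x ρ y hy t
  refine ⟨Γ, 𝟙 Γ, x, PUnit.unit, ρ, rfl, ?_, Category.comp_id ρ, rfl, rfl⟩
  intro Δ W f g ρ' y' hy' t' z hz hz' hg ht'
  exact ⟨ρ', ⟨Category.comp_id _, rfl, rfl⟩, fun h hh ↦ (Category.comp_id h).symm.trans hh.1⟩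

theorem sigma_map_eq_iff {F G : Family C} {Γ Δ : C} {f : Δ ⟶ Γ}
    {P : (F.arrow G.Ty).obj (op Γ)} {Q : (F.arrow G.Ty).obj (op Δ)}
    (h : (F.arrow G.Ty).map f.op P = Q) (s : (F.sigma G).Tm.obj P) (s' : (F.sigma G).Tm.obj Q) :
    (F.sigma G).Tm.map f h s = s' ↔ F.Tm.map f (arrow_fst h) s.1 = s'.1 ∧
      ∃ e : G.Ty.map f.op (P.2.app (𝟙 Γ) (map_id_op _) s.1) = Q.2.app (𝟙 Δ) (map_id_op _) s'.1,
        G.Tm.map f e s.2 = s'.2 := by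
  constructor
  · rintro rfl
    exact ⟨rfl, sigma_aux h s.1, rfl⟩
  · obtain ⟨t', a'⟩ := s'
    dsimp only
    rintro ⟨rfl, e, rfl⟩
    rfl

theorem Arrow.map_app {F : Family C} {B : Cᵒᵖ ⥤ Type u} {Γ Δ Θ : C} {x : F.Ty.obj (op Γ)}
    (A : F.Arrow B x) {ρ : Δ ⟶ Γ} {σ : Θ ⟶ Δ} {τ : Θ ⟶ Γ} (h : σ ≫ ρ = τ)
    {y : F.Ty.obj (op Δ)} {z : F.Ty.obj (op Θ)} (hρ : F.Ty.map ρ.op x = y)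
    (hσ : F.Ty.map σ.op y = z) (hτ : F.Ty.map τ.op x = z) (t : F.Tm.obj y) :
    B.map σ.op (A.app ρ hρ t) = A.app τ hτ (F.Tm.map σ hσ t) := by
  subst h
  exact (A.naturality ρ σ hρ hσ t).symm

/-- The first component `t` is generalized to `t₀` over `Θ₀`, and then the second one relative to
the sort `A(t₀)` over `Θ₀`. Generic elements relative to an arbitrary base are what makes this
second step possible. -/
theorem hasGenerics_sigma {F G : Family C} (hF : F.Tm.HasGenerics) (hG : G.Tm.HasGenerics) :
    (F.sigma G).Tm.HasGenerics := by
  rintro Γ Θ ⟨x, A⟩ ρ _ rfl ⟨t, a⟩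
  obtain ⟨Θ₀, ρ₀, y₀, t₀, k, hy₀, ht₀, rfl, e, rfl⟩ := hF x ρ rfl t
  obtain ⟨Θ₁, k₀, y₁, a₀, k₁, hy₁, ha₀, rfl, e₁, he₁⟩ := hG (A.app ρ₀ hy₀ t₀) k
    (A.map_app (Category.id_comp _).symm hy₀ e _ t₀) a
  have hz₁ : F.Ty.map k₀.op y₀ = F.Ty.map (k₀ ≫ ρ₀).op x := by
    rw [map_comp_op hy₀ rfl]
  obtain rfl := hy₁.symm.trans (A.map_app (Category.id_comp (k₀ ≫ ρ₀)).symm hy₀ hz₁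
    (map_comp_op rfl (map_id_op _)) t₀)
  refine ⟨Θ₁, k₀ ≫ ρ₀, _, ⟨F.Tm.map k₀ hz₁ t₀, a₀⟩, k₁, rfl, ?_, (Category.assoc _ _ _).symm,
    ?_, ?_⟩
  · rintro Δ W f g ρ' _ rfl ⟨t', a'⟩ _ rfl hz' hg ht'
    obtain ⟨ht, e₂, ha⟩ := (sigma_map_eq_iff rfl _ _).1 ht'
    have hfk := map_comp_op (X := F.Ty) hz₁ (arrow_fst hz')
    obtain ⟨h, ⟨rfl, e₃, rfl⟩, hu⟩ := ht₀ (f ≫ k₀) g ρ' rfl t' rfl hfk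
      (hg.trans (Category.assoc _ _ _).symm) (ht.trans (F.Tm.map_map ..))
    -- `h` is obtained from the first components alone. Genericity of `t₀` shows that the common
    -- instance maps to `Θ₀` in only one way, so the second components are compared over the same
    -- base.
    have hgh : g ≫ h = f ≫ k₀ := by
      refine ht₀.hom_ext hy₀ ?_ (map_comp_op e₃ rfl) hfk ?_
      · rw [Category.assoc, hg, Category.assoc]
      · exact (F.Tm.map_map ..).symm.trans (ht.trans (F.Tm.map_map ..))
    obtain ⟨h', ⟨rfl, e₄, rfl⟩, hu'⟩ := ha₀ f g h
      (A.map_app (Category.id_comp _).symm hy₀ e₃ _ t₀) a' e₂ _ hgh ha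
    refine ⟨h', ⟨(Category.assoc _ _ _).symm, (map_comp_op (X := F.arrow G.Ty) rfl rfl).symm.trans
      (congrArg (fun a ↦ (F.arrow G.Ty).map a.op _) (Category.assoc _ _ _).symm),
      (sigma_map_eq_iff _ _ _).2 ⟨F.Tm.map_map .., e₄, rfl⟩⟩, ?_⟩
    rintro h'' ⟨h₁, e₅, h₂⟩
    obtain ⟨h₃, e₆, h₄⟩ := (sigma_map_eq_iff _ _ _).1 h₂
    refine hu' h'' ⟨?_, e₆, h₄⟩
    exact hu (h'' ≫ k₀) ⟨(Category.assoc _ _ _).trans h₁, map_comp_op hz₁ (arrow_fst e₅),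
      (F.Tm.map_map ..).symm.trans h₃⟩
  · exact (map_comp_op (X := F.arrow G.Ty) rfl rfl).symm.trans
      (congrArg (fun a ↦ (F.arrow G.Ty).map a.op _) (Category.assoc _ _ _).symm)
  · exact (sigma_map_eq_iff _ _ _).2 ⟨F.Tm.map_map .., e₁, he₁⟩

theorem hasGenerics_telescope {F : Family C} (hF : F.Tm.HasGenerics) :
    F.telescope.Tm.HasGenerics := by
  refine hasGenerics_sum fun n ↦ ?_
  induction n with
  | zero => exact hasGenerics_single
  | succ n ih => exact hasGenerics_sigma ih hF

end Family

/-! ### Transport of generic expressions along isomorphisms of contexts. -/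

namespace Signature

open Raw

variable {K : Type u} {Sg : Signature K} {V : Type} {P : Set V}
  {Γ Γ₀ Γ₁ : V → Option (Raw K V)} {S : Option (Raw K V)} {g u v : V → Raw K V} {r₀ : Raw K V}

/-- Generic expressions are stable under isomorphism. -/
theorem IsGeneric.of_iso (h : Sg.IsGeneric P Γ S Γ₀ g r₀) (hΓ₁ : Sg.WfCtx P Γ₁)
    (hu : Sg.Mor P Γ₁ Γ₀ u) (hv : Sg.Mor P Γ₀ Γ₁ v) (huv : comp u v = idSub P Γ₀)
    (hvu : comp v u = idSub P Γ₁) : Sg.IsGeneric P Γ S Γ₁ (comp g u) (r₀.subst u) where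
  wf := hΓ₁
  mor := h.mor.comp hu
  hasSort := by
    have := h.hasSort.map hu
    rw [Option.map_map] at this
    convert this using 2
    funext r
    exact subst_comp _ _ _
  univ W ρ w hW hρ hw hsim := by
    obtain ⟨f, f', hf, hf', e⟩ := hsim
    obtain ⟨k, ⟨hk, rfl, rfl⟩, hku⟩ := h.univ W ρ w hW hρ hw
      ⟨f, comp u f', hf, hu.toPSub.comp hf', e.trans (subst_comp _ _ _).symm⟩
    have hk' : comp u (comp v k) = k := by rw [← comp_assoc, huv, hk.idSub_comp]
    refine ⟨comp v k, ⟨hv.comp hk, by rw [comp_assoc, hk'], by rw [← subst_comp, hk']⟩, ?_⟩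
    rintro k' ⟨h₁, h₂, h₃⟩
    rw [← hku (comp u k') ⟨hu.comp h₁, by rw [h₂, comp_assoc], by rw [subst_comp, h₃]⟩,
      ← comp_assoc, hvu, h₁.idSub_comp]

end Signature

/-! ### Generic elements of presheaves encoded by expressions. -/

namespace CwF.Presentation

open Signature

variable {C : CwF.{u}} {Gty : Set (tyFunctor.obj C)} {G : Set (tmFunctor.obj C)}
  (T : Presentation Gty G)

/-- The context with parameters over `Θ` obtained from parameters over `Γ` by substitution along
a morphism `ρ : Θ ⟶ Γ`. -/
def pctxSub (D : ℕ → Option (Raw (Label C) (ℕ ⊕ ℕ))) {Γ Θ : C.Ob} (ρ : Θ ⟶ Γ) :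
    ℕ ⊕ ℕ → Option (Raw (Label C) (ℕ ⊕ ℕ)) :=
  T.pctx Θ fun j ↦ (D j).map (Raw.subst (T.lift ρ))

/-- The elements of a dependent presheaf `Y` over instances of `x` are encoded by expressions of
sort `S` in the context over `Γ` with parameters `D`. -/
structure Encodes {X : C.Obᵒᵖ ⥤ Type u} (Y : DepPresheaf X) {Γ : C.Ob} (x : X.obj (op Γ))
    (D : ℕ → Option (Raw (Label C) (ℕ ⊕ ℕ))) (S : Option (Raw (Label C) (ℕ ⊕ ℕ)))
    (raw : ∀ {Θ : C.Ob} {y : X.obj (op Θ)}, Y.obj y → Raw (Label C) (ℕ ⊕ ℕ)) : Prop where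
  hasSort_param : ∀ j A, D j = some A → T.sig.HasSort (T.pctx Γ D) A none
  hasSort_sort : ∀ A, S = some A → T.sig.HasSort (T.pctx Γ D) A none
  injective : ∀ {Θ : C.Ob} {y : X.obj (op Θ)} (t t' : Y.obj y), raw t = raw t' → t = t'
  hasSort : ∀ {Θ : C.Ob} (ρ : Θ ⟶ Γ) {y : X.obj (op Θ)} (_ : X.map ρ.op x = y) (t : Y.obj y),
    T.sig.HasSort (T.pctxSub D ρ) (raw t) (S.map (Raw.subst (T.lift ρ)))
  surjective : ∀ {Θ : C.Ob} (ρ : Θ ⟶ Γ) {y : X.obj (op Θ)} (_ : X.map ρ.op x = y)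
    (r : Raw (Label C) (ℕ ⊕ ℕ)), T.sig.HasSort (T.pctxSub D ρ) r (S.map (Raw.subst (T.lift ρ))) →
      ∃ t : Y.obj y, raw t = r
  map : ∀ {Θ Θ' : C.Ob} (f : Θ' ⟶ Θ) {y : X.obj (op Θ)} {z : X.obj (op Θ')}
    (h : X.map f.op y = z) (t : Y.obj y), raw (Y.map f h t) = (raw t).subst (T.lift f)

theorem exists_fresh (s : Set (ℕ ⊕ ℕ)) (hs : s.Finite) : ∃ z ∉ params, z ∉ s := by
  obtain ⟨i, hi⟩ := (hs.preimage (f := Sum.inl) Sum.inl_injective.injOn).exists_notMem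
  exact ⟨.inl i, inl_notMem_params i, hi⟩

variable {T}

/-- The generic expression of `raw t` lives in a context that receives a morphism from an actual
one, so it can be moved to an object `Θ₀`. There the encoding turns expressions and substitutions
back into elements and morphisms. -/
theorem Encodes.exists_generic {X : C.Obᵒᵖ ⥤ Type u} {Y : DepPresheaf X} {Γ : C.Ob}
    {x : X.obj (op Γ)} {D : ℕ → Option (Raw (Label C) (ℕ ⊕ ℕ))}
    {S : Option (Raw (Label C) (ℕ ⊕ ℕ))}
    {raw : ∀ {Θ : C.Ob} {y : X.obj (op Θ)}, Y.obj y → Raw (Label C) (ℕ ⊕ ℕ)}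
    (H : T.Encodes Y x D S raw) {Θ : C.Ob} (ρ : Θ ⟶ Γ) {y : X.obj (op Θ)}
    (hy : X.map ρ.op x = y) (t : Y.obj y) :
    ∃ (Θ₀ : C.Ob) (ρ₀ : Θ₀ ⟶ Γ) (y₀ : X.obj (op Θ₀)) (t₀ : Y.obj y₀) (k : Θ ⟶ Θ₀),
      X.map ρ₀.op x = y₀ ∧ Y.IsGeneric x ρ₀ t₀ ∧ k ≫ ρ₀ = ρ ∧
        ∃ e : X.map k.op y₀ = y, Y.map k e t₀ = t := by
  have hmor {Θ : C.Ob} (ρ : Θ ⟶ Γ) :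
      T.sig.Mor params (T.pctxSub D ρ) (T.pctx Γ D) (T.lift ρ) := T.mor_lift ρ fun _ ↦ rfl
  have hwf {Θ : C.Ob} (ρ : Θ ⟶ Γ) : T.sig.WfCtx params (T.pctxSub D ρ) :=
    T.wfCtx_pctx fun j A hA ↦ by
      obtain ⟨A', hA', rfl⟩ := Option.map_eq_some_iff.1 hA
      exact (H.hasSort_param j A' hA').map (hmor ρ)
  obtain ⟨Γ₀, g, r₀, h, hgen, hh, e, e'⟩ := exists_isGeneric T.sig_isWf exists_fresh
    (T.wfCtx_pctx H.hasSort_param) H.hasSort_sort (hwf ρ) (hmor ρ) (H.hasSort ρ hy t)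
  obtain ⟨Θ₀, E₀, u, v, hu, hv, huv, hvu⟩ := T.exists_iso hgen.wf hh
  obtain ⟨ρ₀, hρ₀⟩ := T.exists_lift (hgen.mor.comp hu)
  -- Since `ρ₀` underlies a morphism to the context over `Γ`, the parameters over `Θ₀` are those of
  -- `Γ` restricted along `ρ₀`.
  obtain rfl : (fun j ↦ (D j).map (Raw.subst (T.lift ρ₀))) = E₀ := by
    funext j
    rw [hρ₀]
    exact ((hgen.mor.comp hu).map_param (.inr j) ⟨j, rfl⟩).symm
  replace hgen := hgen.of_iso (hwf ρ₀) hu hv huv hvu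
  rw [← hρ₀] at hgen
  obtain ⟨t₀, ht₀⟩ := H.surjective ρ₀ rfl _ hgen.hasSort
  rw [← ht₀] at hgen
  obtain ⟨k, hk⟩ := T.exists_lift (hv.comp hh)
  have hk' : comp u (comp v h) = h := by rw [← comp_assoc, huv, hh.idSub_comp]
  have hkρ : k ≫ ρ₀ = ρ := T.lift_injective (by
    rw [T.lift_comp, hρ₀, hk, e, comp_assoc, hk'])
  refine ⟨Θ₀, ρ₀, _, t₀, k, rfl, ?_, hkρ, ?_, ?_⟩
  · rintro Δ W a b ρ' _ rfl t' z hz hz' hab ht'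
    obtain ⟨l, ⟨hl, hl₁, hl₂⟩, hlu⟩ := hgen.univ _ _ _ (hwf ρ') (hmor ρ') (H.hasSort ρ' rfl t')
      -- The property `PSub` does not involve the contexts, so empty parameter contexts suffice.
      ⟨T.lift b, T.lift a, (T.mor_lift (E := fun _ ↦ none) b fun _ ↦ rfl).toPSub,
        (T.mor_lift (E := fun _ ↦ none) a fun _ ↦ rfl).toPSub, by rw [← H.map b hz, ht', H.map]⟩
    obtain ⟨l, rfl⟩ := T.exists_lift hl
    rw [← T.lift_comp] at hl₁
    obtain rfl := T.lift_injective hl₁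
    refine ⟨l, ⟨rfl, (map_comp_op rfl rfl).symm, H.injective _ _ (by rw [H.map, hl₂])⟩, ?_⟩
    rintro l' ⟨h₁, e₁, h₂⟩
    refine T.lift_injective (hlu _ ⟨T.mor_lift l' fun j ↦ ?_, ?_, ?_⟩)
    · rw [← h₁, T.lift_comp, Option.map_map]
      congr 1
      funext r
      exact subst_comp _ _ _
    · rw [← h₁, T.lift_comp]
    · rw [← H.map l' e₁, h₂]
  · rw [← hy, ← hkρ, map_comp_op rfl rfl]
  · refine H.injective _ _ ?_
    rw [H.map, ht₀, hk, ← subst_comp, hk', e']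

end CwF.Presentation

namespace CwF.Presentation

open Family

variable {C : CwF.{u}} {Gty : Set (tyFunctor.obj C)} {G : Set (tmFunctor.obj C)}
  (T : Presentation Gty G)

/-! ### Raw expressions for telescopes -/

/-- A family whose elements are sequences of terms, with representing objects which extend
contexts by the appropriate number of variables. -/
structure Comprehension (F : Family C.Ob) where
  size : ∀ {Θ : C.Ob}, F.Ty.obj (op Θ) → ℕ
  raw : ∀ {Θ : C.Ob} {x : F.Ty.obj (op Θ)}, F.Tm.obj x → ℕ → Raw (Label C) ℕ
  tot : ∀ {Θ : C.Ob}, F.Ty.obj (op Θ) → C.Ob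
  π : ∀ {Θ : C.Ob} (x : F.Ty.obj (op Θ)), tot x ⟶ Θ
  gen : ∀ {Θ : C.Ob} (x : F.Ty.obj (op Θ)), F.Tm.obj (F.Ty.map (π x).op x)
  size_map : ∀ {Θ Δ : C.Ob} {f : Δ ⟶ Θ} {x : F.Ty.obj (op Θ)} {y : F.Ty.obj (op Δ)},
    F.Ty.map f.op x = y → size y = size x
  raw_map : ∀ {Θ Δ : C.Ob} (f : Δ ⟶ Θ) {x : F.Ty.obj (op Θ)} {y : F.Ty.obj (op Δ)}
    (h : F.Ty.map f.op x = y) (t : F.Tm.obj x) (j : ℕ),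
    raw (F.Tm.map f h t) j = (raw t j).subst (T.rHom f)
  raw_injective : ∀ {Θ : C.Ob} {x : F.Ty.obj (op Θ)} (t t' : F.Tm.obj x), raw t = raw t' → t = t'
  raw_eq_bad : ∀ {Θ : C.Ob} {x : F.Ty.obj (op Θ)} (t : F.Tm.obj x) {j : ℕ}, size x ≤ j →
    raw t j = .bad
  len_tot : ∀ {Θ : C.Ob} (x : F.Ty.obj (op Θ)), T.len (tot x) = T.len Θ + size x
  rHom_π : ∀ {Θ : C.Ob} (x : F.Ty.obj (op Θ)), T.rHom (π x) = idRaw (T.len Θ)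
  raw_gen : ∀ {Θ : C.Ob} (x : F.Ty.obj (op Θ)) {j : ℕ}, j < size x →
    raw (gen x) j = .var (T.len Θ + j)
  exists_hom : ∀ {Θ Δ : C.Ob} (σ : Δ ⟶ Θ) {x : F.Ty.obj (op Θ)} {y : F.Ty.obj (op Δ)}
    (_ : F.Ty.map σ.op x = y) (t : F.Tm.obj y), ∃ h : Δ ⟶ tot x, h ≫ π x = σ ∧
      ∃ e : F.Ty.map h.op (F.Ty.map (π x).op x) = y, F.Tm.map h e (gen x) = t

theorem rHom_id (Γ : C.Ob) : T.rHom (𝟙 Γ) = idRaw (T.len Γ) := by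
  funext i
  unfold idRaw
  split_ifs with h
  · obtain ⟨e, he⟩ := Tower.exists_lookup h
    rw [T.rHom_apply _ he, El.sub_id, T.rTm_lookup he]
  · exact T.rHom_eq_bad _ (not_lt.1 h)

/-- The comprehension of the family of empty telescopes. -/
def comprehensionSingle : T.Comprehension (single ((Functor.const _).obj PUnit.{u + 1})) where
  size _ := 0
  raw _ _ := .bad
  tot {Θ} _ := Θ
  π _ := 𝟙 _
  gen _ := PUnit.unit
  size_map _ := rfl
  raw_map _ _ _ _ _ _ := rfl
  raw_injective _ _ _ := rfl
  raw_eq_bad _ _ _ := rfl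
  len_tot _ := rfl
  rHom_π _ := T.rHom_id _
  raw_gen _ _ h := absurd h (Nat.not_lt_zero _)
  exists_hom σ _ _ _ _ := ⟨σ, Category.comp_id σ, rfl, rfl⟩

variable {T} in
/-- The comprehension of the family of telescopes with an additional component. -/
def Comprehension.snoc {F : Family C.Ob} (K : T.Comprehension F) :
    T.Comprehension (F.sigma C.fam) where
  size P := K.size P.1 + 1
  raw {_ P} s j := if j = K.size P.1 then T.rTm s.2 else K.raw s.1 j
  tot P := C.ext (P.2.app (K.π P.1) rfl (K.gen P.1))
  π P := C.p _ ≫ K.π P.1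
  gen P := ⟨F.Tm.map (C.p (P.2.app (K.π P.1) rfl (K.gen P.1))) (map_comp_op rfl rfl).symm
      (K.gen P.1), C.fam.Tm.map (𝟙 _) ((map_id_op _).trans (P.2.map_app (Category.id_comp _).symm
        rfl (map_comp_op rfl rfl).symm (map_comp_op rfl (map_id_op _)) (K.gen P.1))) (C.q _)⟩
  size_map h := congrArg (· + 1) (K.size_map (arrow_fst h))
  raw_map f P Q h s j := by
    rw [K.size_map (arrow_fst h)]
    split_ifs
    · exact T.rTm_sub ..
    · exact K.raw_map ..
  raw_injective {_ P} s s' h := by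
    obtain ⟨t, a⟩ := s
    obtain ⟨t', a'⟩ := s'
    obtain rfl : t = t' := by
      refine K.raw_injective _ _ (funext fun j ↦ ?_)
      by_cases hj : j = K.size P.1
      · rw [K.raw_eq_bad _ hj.ge, K.raw_eq_bad _ hj.ge]
      · simpa [hj] using congrFun h j
    obtain rfl : a = a' := T.rTm_injective (by simpa using congrFun h (K.size P.1))
    rfl
  raw_eq_bad {_ P} s j hj := by
    rw [if_neg (by omega), K.raw_eq_bad _ (by omega)]
  len_tot P := by rw [T.len_ext, K.len_tot, Nat.add_assoc]
  rHom_π {Θ} P := by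
    funext i
    rw [T.rHom_comp, K.rHom_π, T.rHom_p]
    unfold idRaw
    split_ifs with h
    · have hlen : T.len (K.tot P.1) = T.len Θ + K.size P.1 := K.len_tot P.1
      rw [Raw.subst_var, if_pos]
      exact lt_of_lt_of_le h (hlen.ge.trans' (Nat.le_add_right _ _))
    · rfl
  raw_gen {Θ} P j hj := by
    have hlen : T.len (K.tot P.1) = T.len Θ + K.size P.1 := K.len_tot P.1
    have hsize : K.size (F.Ty.map (C.p (P.2.app (K.π P.1) rfl (K.gen P.1)) ≫ K.π P.1).op P.1) =
      K.size P.1 := K.size_map rfl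
    refine (if_congr (Eq.congr_right hsize) rfl rfl).trans ?_
    split_ifs with h
    · refine (T.rTm_sub (𝟙 _) _ _).trans ?_
      rw [T.rTm_q, T.rHom_id, Raw.subst_var, ← len, idRaw, T.len_ext, if_pos (Nat.lt_succ_self _),
        hlen, h]
    · refine (K.raw_map _ _ _ j).trans ?_
      have hj' : j < K.size P.1 := by omega
      rw [K.raw_gen _ hj', T.rHom_p, Raw.subst_var, idRaw, ← len, hlen]
      exact if_pos (Nat.add_lt_add_left hj' _)
  exists_hom {Θ Δ} σ P Q hσ s := by
    subst hσ
    obtain ⟨t, a⟩ := s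
    obtain ⟨h, rfl, e, rfl⟩ := K.exists_hom σ rfl t
    have ha := P.2.map_app (Category.id_comp (h ≫ K.π P.1)).symm rfl e
      (map_comp_op rfl (map_id_op _)) (K.gen P.1)
    obtain ⟨k, ⟨rfl, hkq⟩, -⟩ := existsUnique_ext (P.2.app (K.π P.1) rfl (K.gen P.1)) h ⟨_, a⟩
      ha.symm
    refine ⟨k, (Category.assoc _ _ _).symm, (map_comp_op rfl rfl).symm.trans
      (congrArg (fun a ↦ (F.arrow C.fam.Ty).map a.op _) (Category.assoc _ _ _).symm),
      (sigma_map_eq_iff _ _ _).2 ⟨F.Tm.map_map .., ?_⟩⟩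
    have hgen := P.2.map_app (Category.id_comp
      (C.p (P.2.app (K.π P.1) rfl (K.gen P.1)) ≫ K.π P.1)).symm rfl
      (map_comp_op rfl rfl).symm (map_comp_op rfl (map_id_op _)) (K.gen P.1)
    refine ⟨(congrArg (C.tySub k) hgen.symm).trans ((map_comp_op rfl rfl).symm.trans ha),
      (C.fam.Tm.map_map ..).trans (eq_of_heq (Sigma.mk.inj ((El.mk_map _ _ _).trans ?_)).2)⟩
    rw [Category.comp_id]
    exact hkq

/-- The comprehension of the family of telescopes of length `n`. -/
def comprehensionOfLength : ∀ n, T.Comprehension (C.fam.telescopeOfLength n)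
  | 0 => T.comprehensionSingle
  | n + 1 => (comprehensionOfLength n).snoc

/-- The comprehension of the family of telescopes. -/
def comprehension : T.Comprehension C.fam.telescope where
  size x := (T.comprehensionOfLength x.1).size x.2
  raw {_ x} t := (T.comprehensionOfLength x.1).raw t
  tot x := (T.comprehensionOfLength x.1).tot x.2
  π x := (T.comprehensionOfLength x.1).π x.2
  gen x := (T.comprehensionOfLength x.1).gen x.2
  size_map {_ _ f x y} h := by
    subst h
    exact (T.comprehensionOfLength x.1).size_map rfl
  raw_map f x _ h t j := by
    subst h
    exact (T.comprehensionOfLength x.1).raw_map f rfl t j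
  raw_injective {_ x} := (T.comprehensionOfLength x.1).raw_injective
  raw_eq_bad {_ x} := (T.comprehensionOfLength x.1).raw_eq_bad
  len_tot x := (T.comprehensionOfLength x.1).len_tot x.2
  rHom_π x := (T.comprehensionOfLength x.1).rHom_π x.2
  raw_gen x := (T.comprehensionOfLength x.1).raw_gen x.2
  exists_hom σ x _ hσ t := by
    subst hσ
    obtain ⟨h, h₁, e, h₂⟩ := (T.comprehensionOfLength x.1).exists_hom σ rfl t
    exact ⟨h, h₁, congrArg (Sigma.mk x.1) e, (sum_map _ h e _ _).trans h₂⟩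

/-! ### Raw expressions for basic sorts -/

/-- The raw sort of a basic sort. -/
def rSort {Θ : C.Ob} : C.basicSort.Ty.obj (op Θ) → Option (Raw (Label C) ℕ)
  | ⟨.ty, _⟩ => none
  | ⟨.tm, A⟩ => some (T.rTy A)

/-- The raw expression of an element of a basic sort. -/
def rElem {Θ : C.Ob} : {b : C.basicSort.Ty.obj (op Θ)} → C.basicSort.Tm.obj b → Raw (Label C) ℕ
  | ⟨.ty, _⟩, A => T.rTy (Γ := Θ) A
  | ⟨.tm, A⟩, a => T.rTm (A := A) a

variable {Θ Δ : C.Ob}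

theorem rSort_map (f : Δ ⟶ Θ) {b : C.basicSort.Ty.obj (op Θ)} {b' : C.basicSort.Ty.obj (op Δ)}
    (h : C.basicSort.Ty.map f.op b = b') : T.rSort b' = (T.rSort b).map (Raw.subst (T.rHom f)) := by
  subst h
  obtain ⟨_ | _, A⟩ := b
  · rfl
  · exact congrArg some (T.rTy_sub f A)

theorem rElem_map (f : Δ ⟶ Θ) {b : C.basicSort.Ty.obj (op Θ)} {b' : C.basicSort.Ty.obj (op Δ)}
    (h : C.basicSort.Ty.map f.op b = b') (t : C.basicSort.Tm.obj b) :
    T.rElem (C.basicSort.Tm.map f h t) = (T.rElem t).subst (T.rHom f) := by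
  subst h
  obtain ⟨_ | _, A⟩ := b
  · exact T.rTy_sub f t
  · exact T.rTm_sub f rfl t

theorem rElem_injective {b : C.basicSort.Ty.obj (op Θ)} {t t' : C.basicSort.Tm.obj b}
    (h : T.rElem t = T.rElem t') : t = t' := by
  obtain ⟨_ | _, A⟩ := b
  · exact T.rTy_injective h
  · exact T.rTm_injective h

theorem hasSort_rElem {b : C.basicSort.Ty.obj (op Θ)} (t : C.basicSort.Tm.obj b) :
    T.sig.HasSort (T.ctx Θ) (T.rElem t) (T.rSort b) := by
  obtain ⟨_ | _, A⟩ := b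
  · exact T.hasSort_rTy t
  · exact T.hasSort_rTm t

theorem exists_rElem {b : C.basicSort.Ty.obj (op Θ)} {r : Raw (Label C) ℕ}
    (h : T.sig.HasSort (T.ctx Θ) r (T.rSort b)) : ∃ t : C.basicSort.Tm.obj b, T.rElem t = r := by
  obtain ⟨_ | _, A⟩ := b
  · exact T.exists_rTy h
  · exact T.exists_rTm h

theorem hasSort_of_rSort {b : C.basicSort.Ty.obj (op Θ)} {A : Raw (Label C) ℕ}
    (h : T.rSort b = some A) : T.sig.HasSort (T.ctx Θ) A none := by
  obtain ⟨_ | _, B⟩ := b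
  · cases h
  · cases h
    exact T.hasSort_rTy B

end CwF.Presentation

namespace CwF.Presentation

open Family Signature

variable {C : CwF.{u}} {Gty : Set (tyFunctor.obj C)} {G : Set (tmFunctor.obj C)}
  {T : Presentation Gty G}

/-! ### Raw expressions for monomial sorts -/

theorem lt_of_occurs {Θ : C.Ob} {r : Raw (Label C) ℕ} {S : Option (Raw (Label C) ℕ)}
    (h : T.sig.HasSort (T.ctx Θ) r S) {i : ℕ} (hi : r.Occurs i) : i < T.len Θ := by
  obtain ⟨A, hA⟩ := h.exists_of_occurs hi
  by_contra h'
  rw [T.ctx_eq_none.2 (not_lt.1 h')] at hA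
  cases hA

theorem ctx_of_hasSort_var {Θ : C.Ob} {i : ℕ} {A : Raw (Label C) ℕ}
    (h : T.sig.HasSort (T.ctx Θ) (.var i) (some A)) : T.ctx Θ i = some A := by
  cases h with | var h => exact h

/-- The renaming which turns all the variables beyond the first `n` into parameters. -/
def split (n i : ℕ) : Raw (Label C) (ℕ ⊕ ℕ) :=
  .var (if i < n then .inl i else .inr (i - n))

/-- The renaming which turns the parameters into variables beyond the first `n`. -/
def merge (n : ℕ) : ℕ ⊕ ℕ → Raw (Label C) ℕ :=
  Sum.elim .var fun j ↦ .var (n + j)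

theorem subst_split_merge (n : ℕ) (r : Raw (Label C) ℕ) :
    (r.subst (split n)).subst (merge n) = r := by
  rw [Raw.subst_subst]
  refine Raw.subst_eq_self fun i _ ↦ ?_
  unfold split merge
  split_ifs with h
  · rfl
  · simp only [Raw.subst_var, Sum.elim_inr, Raw.var.injEq]
    omega

theorem subst_split_eq_up {Θ : C.Ob} {r : Raw (Label C) ℕ} (h : ∀ i, r.Occurs i → i < T.len Θ) :
    r.subst (split (T.len Θ)) = up r :=
  Raw.subst_congr fun i hi ↦ by simp [split, h i hi]

namespace Comprehension

variable {F : Family C.Ob} (K : T.Comprehension F) {Θ Δ : C.Ob}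

theorem rHom_of_lt {x : F.Ty.obj (op Θ)} (h : Δ ⟶ K.tot x) {i : ℕ} (hi : i < T.len Θ) :
    T.rHom h i = T.rHom (h ≫ K.π x) i := by
  rw [T.rHom_comp, K.rHom_π, idRaw, if_pos hi, Raw.subst_var]

theorem rHom_add {x : F.Ty.obj (op Θ)} (h : Δ ⟶ K.tot x) {y : F.Ty.obj (op Δ)}
    (e : F.Ty.map h.op (F.Ty.map (K.π x).op x) = y) {j : ℕ} (hj : j < K.size x) :
    T.rHom h (T.len Θ + j) = K.raw (F.Tm.map h e (K.gen x)) j := by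
  rw [K.raw_map, K.raw_gen x hj, Raw.subst_var]

/-- By position, the raw components of a morphism to `K.tot x` are those of its composite with the
projection, then the terms of the sequence it classifies, then `bad`. -/
theorem hom_ext {x : F.Ty.obj (op Θ)} {h h' : Δ ⟶ K.tot x} (hπ : h ≫ K.π x = h' ≫ K.π x)
    {y : F.Ty.obj (op Δ)} (e : F.Ty.map h.op (F.Ty.map (K.π x).op x) = y)
    (e' : F.Ty.map h'.op (F.Ty.map (K.π x).op x) = y)
    (hgen : F.Tm.map h e (K.gen x) = F.Tm.map h' e' (K.gen x)) : h = h' := by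
  refine T.rHom_injective (funext fun i ↦ ?_)
  by_cases hi : i < T.len Θ
  · rw [K.rHom_of_lt h hi, K.rHom_of_lt h' hi, hπ]
  · obtain ⟨j, rfl⟩ := Nat.exists_eq_add_of_le (not_lt.1 hi)
    by_cases hj : j < K.size x
    · rw [K.rHom_add h e hj, K.rHom_add h' e' hj, hgen]
    · have := K.len_tot x
      rw [T.rHom_eq_bad h (by omega), T.rHom_eq_bad h' (by omega)]

/-- The i-th component of the projection is the variable `i` itself. That it is well typed as a
component determines the type of this variable in the extended context. -/
theorem ctx_tot_of_lt (x : F.Ty.obj (op Θ)) {i : ℕ} (hi : i < T.len Θ) :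
    T.ctx (K.tot x) i = T.ctx Θ i := by
  obtain ⟨A, hA⟩ := T.exists_ctx hi
  have := T.hasSort_rHom (K.π x) hA
  rw [K.rHom_π, idRaw, if_pos hi] at this
  rw [ctx_of_hasSort_var this, hA, Raw.subst_eq_self]
  intro v hv
  exact if_pos ((T.lt_of_occurs_ctx hA hv).trans hi)

/-- The parameters of the context with parameters of a telescope. -/
def params (x : F.Ty.obj (op Θ)) (j : ℕ) : Option (Raw (Label C) (ℕ ⊕ ℕ)) :=
  (T.ctx (K.tot x) (T.len Θ + j)).map (Raw.subst (split (T.len Θ)))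

/-- With `hasSort_merge`, this identifies expressions over the extension with expressions over `Θ`
with parameters, up to renaming. -/
theorem hasSort_split {x : F.Ty.obj (op Θ)} {r : Raw (Label C) ℕ} {S : Option (Raw (Label C) ℕ)}
    (h : T.sig.HasSort (T.ctx (K.tot x)) r S) :
    T.sig.HasSort (T.pctx Θ (K.params x)) (r.subst (split (T.len Θ)))
      (S.map (Raw.subst (split (T.len Θ)))) := by
  refine h.subst fun i _ A hA ↦ .var ?_
  split_ifs with hi
  · rw [K.ctx_tot_of_lt x hi] at hA
    rw [subst_split_eq_up fun _ hj ↦ lt_of_occurs (T.hasSort_ctx hA) hj]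
    simp [pctx, hA]
  · obtain ⟨j, rfl⟩ := Nat.exists_eq_add_of_le (not_lt.1 hi)
    simp [pctx, params, hA]

theorem hasSort_merge {x : F.Ty.obj (op Θ)} {r : Raw (Label C) (ℕ ⊕ ℕ)}
    {S : Option (Raw (Label C) (ℕ ⊕ ℕ))} (h : T.sig.HasSort (T.pctx Θ (K.params x)) r S) :
    T.sig.HasSort (T.ctx (K.tot x)) (r.subst (merge (T.len Θ)))
      (S.map (Raw.subst (merge (T.len Θ)))) := by
  refine h.subst fun v _ A hA ↦ ?_
  cases v with
  | inl i =>
    obtain ⟨A, hA', rfl⟩ := Option.map_eq_some_iff.1 hA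
    have hlt {j : ℕ} (hj : A.Occurs j) : j < T.len Θ := lt_of_occurs (T.hasSort_ctx hA') hj
    have hi : i < T.len Θ := by
      by_contra h'
      rw [T.ctx_eq_none.2 (not_lt.1 h')] at hA'
      cases hA'
    rw [← subst_split_eq_up fun _ hj ↦ hlt hj, subst_split_merge]
    exact .var ((K.ctx_tot_of_lt x hi).trans hA')
  | inr j =>
    obtain ⟨A, hA', rfl⟩ := Option.map_eq_some_iff.1 hA
    rw [subst_split_merge]
    exact .var hA'

theorem subst_merge_split {x : F.Ty.obj (op Θ)} {r : Raw (Label C) (ℕ ⊕ ℕ)}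
    {S : Option (Raw (Label C) (ℕ ⊕ ℕ))} (h : T.sig.HasSort (T.pctx Θ (K.params x)) r S) :
    (r.subst (merge (T.len Θ))).subst (split (T.len Θ)) = r := by
  rw [Raw.subst_subst]
  refine Raw.subst_eq_self fun v hv ↦ ?_
  obtain ⟨A, hA⟩ := h.exists_of_occurs hv
  cases v with
  | inl i =>
    obtain ⟨A, hA', rfl⟩ := Option.map_eq_some_iff.1 hA
    have hi : i < T.len Θ := by
      by_contra h'
      rw [T.ctx_eq_none.2 (not_lt.1 h')] at hA'
      cases hA'
    simp [merge, split, hi]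
  | inr j => simp [merge, split]

/-- The morphism `k` is the action of `f` on the extended contexts. It matches the new variables
position by position, so after splitting it becomes `T.lift f`, which fixes the parameters. -/
theorem exists_map (f : Δ ⟶ Θ) {x : F.Ty.obj (op Θ)} {y : F.Ty.obj (op Δ)}
    (h : F.Ty.map f.op x = y) :
    ∃ k : K.tot y ⟶ K.tot x, k ≫ K.π x = K.π y ≫ f ∧
      (∃ e : F.Ty.map k.op (F.Ty.map (K.π x).op x) = F.Ty.map (K.π y).op y,
        F.Tm.map k e (K.gen x) = K.gen y) ∧
      (∀ j < K.size x, T.rHom k (T.len Θ + j) = .var (T.len Δ + j)) ∧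
      ∀ {r S}, T.sig.HasSort (T.ctx (K.tot x)) r S →
        (r.subst (T.rHom k)).subst (split (T.len Δ)) =
          (r.subst (split (T.len Θ))).subst (T.lift f) := by
  obtain ⟨k, h₁, e, h₂⟩ := K.exists_hom (K.π y ≫ f) (map_comp_op h rfl) (K.gen y)
  have h₃ : ∀ j < K.size x, T.rHom k (T.len Θ + j) = .var (T.len Δ + j) := fun j hj ↦ by
    rw [K.rHom_add k e hj, h₂, K.raw_gen y (by rwa [K.size_map h])]
  refine ⟨k, h₁, ⟨e, h₂⟩, h₃, fun {r S} hr ↦ ?_⟩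
  rw [Raw.subst_subst, Raw.subst_subst]
  refine Raw.subst_congr fun i hi ↦ ?_
  have hi' := lt_of_occurs hr hi
  rw [K.len_tot] at hi'
  by_cases hi'' : i < T.len Θ
  · obtain ⟨A, hA⟩ := T.exists_ctx hi''
    have hlt (j : ℕ) (hj : (T.rHom f i).Occurs j) : j < T.len Δ :=
      lt_of_occurs (T.hasSort_rHom f hA) hj
    rw [K.rHom_of_lt k hi'', h₁, T.rHom_comp, K.rHom_π, Raw.subst_eq_self (f := idRaw _)
      fun j hj ↦ if_pos (hlt j hj), subst_split_eq_up hlt]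
    simp [split, hi'', lift]
  · obtain ⟨j, rfl⟩ := Nat.exists_eq_add_of_le (not_lt.1 hi'')
    rw [h₃ j (by omega)]
    simp [split, lift]

/-- The j-th new variable over `Δ` is a component of `k`, so typing of components gives its type.
Beyond the size of the telescope both sides are undefined. -/
theorem params_map (f : Δ ⟶ Θ) {x : F.Ty.obj (op Θ)} {y : F.Ty.obj (op Δ)}
    (h : F.Ty.map f.op x = y) (j : ℕ) :
    K.params y j = (K.params x j).map (Raw.subst (T.lift f)) := by
  obtain ⟨k, -, -, h₃, h₄⟩ := K.exists_map f h
  unfold params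
  by_cases hj : j < K.size x
  · obtain ⟨A, hA⟩ := T.exists_ctx (Γ := K.tot x) (i := T.len Θ + j) (by rw [K.len_tot]; omega)
    have := T.hasSort_rHom k hA
    rw [h₃ j hj] at this
    rw [ctx_of_hasSort_var this, hA]
    simp [h₄ (T.hasSort_ctx hA)]
  · rw [T.ctx_eq_none.2, T.ctx_eq_none.2]
    · rfl
    · rw [K.len_tot]
      omega
    · rw [K.len_tot, K.size_map h]
      omega

/-- Elements of the family `F.pi B` are determined by their value at the generic element. -/
theorem pi_ext {B : Family C.Ob} {P : (F.pi B).Ty.obj (op Θ)} {s s' : (F.pi B).Tm.obj P}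
    (h : s.app (K.π P.1) rfl (K.gen P.1) = s'.app (K.π P.1) rfl (K.gen P.1)) : s = s' := by
  refine Pi.ext ?_
  funext Δ ρ y hy t
  obtain ⟨k, rfl, e, rfl⟩ := K.exists_hom ρ hy t
  rw [s.naturality (K.π P.1) k rfl e, s'.naturality (K.π P.1) k rfl e, h]

theorem exists_pi {B : Family C.Ob} {P : (F.pi B).Ty.obj (op Θ)}
    (b : B.Tm.obj (P.2.app (K.π P.1) rfl (K.gen P.1))) :
    ∃ s : (F.pi B).Tm.obj P, s.app (K.π P.1) rfl (K.gen P.1) = b := by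
  -- The value at `t` is `b` restricted along the morphism classifying `t`. Naturality follows from
  -- uniqueness of classifying morphisms.
  choose k hk e he using fun {Δ : C.Ob} (ρ : Δ ⟶ Θ) {y : F.Ty.obj (op Δ)}
    (hy : F.Ty.map ρ.op P.1 = y) (t : F.Tm.obj y) ↦ K.exists_hom ρ hy t
  refine ⟨⟨fun ρ _ hy t ↦ B.Tm.map (k ρ hy t) ((P.2.map_app (hk ρ hy t) rfl (e ρ hy t) hy _).trans
    (congrArg (P.2.app ρ hy) (he ρ hy t))) b, fun {_ _} ρ σ {_ _} hρ hσ t ↦ ?_⟩, ?_⟩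
  · refine Eq.trans ?_ (B.Tm.map_map ..).symm
    refine B.Tm.map_congr (K.hom_ext ?_ (e _ _ _) (map_comp_op (e _ _ _) hσ) ?_) _ _ b
    · rw [hk, Category.assoc, hk]
    · rw [he, ← F.Tm.map_map _ σ (e ρ hρ t) hσ, he]
  · refine (B.Tm.map_congr (K.hom_ext ?_ (e _ _ _) (map_id_op _) ?_) _ (map_id_op _) b).trans
      (B.Tm.map_id _ b)
    · rw [hk, Category.id_comp]
    · rw [he, F.Tm.map_id]

/-- The raw sort of a monomial sort. -/
def rMonomial (P : (F.pi C.basicSort).Ty.obj (op Θ)) : Option (Raw (Label C) (ℕ ⊕ ℕ)) :=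
  (T.rSort (P.2.app (K.π P.1) rfl (K.gen P.1))).map (Raw.subst (split (T.len Θ)))

/-- The raw expression of an element of a monomial sort. -/
def rPi {P : (F.pi C.basicSort).Ty.obj (op Θ)} (s : (F.pi C.basicSort).Tm.obj P) :
    Raw (Label C) (ℕ ⊕ ℕ) :=
  (T.rElem (s.app (K.π P.1) rfl (K.gen P.1))).subst (split (T.len Θ))

theorem rMonomial_map (f : Δ ⟶ Θ) {P : (F.pi C.basicSort).Ty.obj (op Θ)}
    {Q : (F.pi C.basicSort).Ty.obj (op Δ)} (h : (F.pi C.basicSort).Ty.map f.op P = Q) :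
    K.rMonomial Q = (K.rMonomial P).map (Raw.subst (T.lift f)) := by
  obtain ⟨k, h₁, ⟨e, h₂⟩, -, h₄⟩ := K.exists_map f (arrow_fst h)
  have := P.2.map_app h₁ rfl e (map_comp_op (arrow_fst h) rfl) (K.gen P.1)
  rw [h₂, arrow_snd h (K.π Q.1) rfl] at this
  unfold rMonomial
  rw [T.rSort_map k this]
  cases hS : T.rSort (P.2.app (K.π P.1) rfl (K.gen P.1)) with
  | none => rfl
  | some A => exact congrArg some (h₄ (T.hasSort_of_rSort hS))

theorem rPi_map (f : Δ ⟶ Θ) {P : (F.pi C.basicSort).Ty.obj (op Θ)}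
    {Q : (F.pi C.basicSort).Ty.obj (op Δ)} (h : (F.pi C.basicSort).Ty.map f.op P = Q)
    (s : (F.pi C.basicSort).Tm.obj P) :
    K.rPi ((F.pi C.basicSort).Tm.map f h s) = (K.rPi s).subst (T.lift f) := by
  obtain ⟨k, h₁, ⟨e, h₂⟩, -, h₄⟩ := K.exists_map f (arrow_fst h)
  have key {τ : K.tot Q.1 ⟶ Θ} (hτ : k ≫ K.π P.1 = τ) {t : F.Tm.obj (F.Ty.map (K.π Q.1).op Q.1)}
      (ht : F.Tm.map k e (K.gen P.1) = t) (hy : F.Ty.map τ.op P.1 = F.Ty.map (K.π Q.1).op Q.1) :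
      T.rElem (s.app τ hy t) = (T.rElem (s.app (K.π P.1) rfl (K.gen P.1))).subst (T.rHom k) := by
    subst hτ ht
    rw [s.naturality (K.π P.1) k rfl e, T.rElem_map]
  unfold rPi
  rw [← h₄ (T.hasSort_rElem _), ← key h₁ h₂ (map_comp_op (arrow_fst h) rfl)]
  -- Substitution in `pi` contains a transport along `𝟙`; on expressions this is `idRaw`, which
  -- fixes all variables of the context.
  refine congrArg _ ((T.rElem_map (𝟙 _) _ _).trans ?_)
  rw [T.rHom_id]
  exact Raw.subst_eq_self fun i hi ↦ if_pos (lt_of_occurs (T.hasSort_rElem _) hi)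

/-- Evaluation at the generic element turns dependent functions into elements of a basic sort over
the extension, and splitting turns the new variables into parameters. Surjectivity combines
`exists_pi` with completeness of the syntax. -/
theorem encodes {Γ : C.Ob} (P : (F.pi C.basicSort).Ty.obj (op Γ)) :
    T.Encodes (F.pi C.basicSort).Tm P (K.params P.1) (K.rMonomial P) K.rPi := by
  have hctx {Θ : C.Ob} (ρ : Θ ⟶ Γ) {Q : (F.pi C.basicSort).Ty.obj (op Θ)}
      (h : (F.pi C.basicSort).Ty.map ρ.op P = Q) :
      T.pctxSub (K.params P.1) ρ = T.pctx Θ (K.params Q.1) :=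
    congrArg (T.pctx Θ) (funext fun j ↦ (K.params_map ρ (arrow_fst h) j).symm)
  refine ⟨fun j A hA ↦ ?_, fun A hA ↦ ?_, fun {Θ y} s s' h ↦ ?_, fun {Θ} ρ {Q} h s ↦ ?_,
    fun {Θ} ρ {Q} h r hr ↦ ?_, K.rPi_map⟩
  · obtain ⟨A', hA', rfl⟩ := Option.map_eq_some_iff.1 hA
    exact K.hasSort_split (T.hasSort_ctx hA')
  · obtain ⟨A', hA', rfl⟩ := Option.map_eq_some_iff.1 hA
    exact K.hasSort_split (T.hasSort_of_rSort hA')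
  · refine K.pi_ext (T.rElem_injective ?_)
    rw [← subst_split_merge (T.len Θ) (T.rElem _)]
    exact (congrArg (Raw.subst _) h).trans (subst_split_merge _ _)
  · rw [hctx ρ h, ← K.rMonomial_map ρ h]
    exact K.hasSort_split (T.hasSort_rElem _)
  · rw [hctx ρ h, ← K.rMonomial_map ρ h] at hr
    have hr' := K.hasSort_merge hr
    rw [rMonomial, Option.map_map, show Raw.subst (merge (T.len Θ)) ∘ Raw.subst (split (T.len Θ)) =
      id from funext fun r ↦ subst_split_merge _ r, Option.map_id_fun, id] at hr'
    obtain ⟨b, hb⟩ := T.exists_rElem hr'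
    obtain ⟨s, rfl⟩ := K.exists_pi b
    refine ⟨s, ?_⟩
    rw [rPi, hb, K.subst_merge_split hr]

end Comprehension

theorem hasGenerics_monomialSort (T : Presentation Gty G) : C.monomialSort.Tm.HasGenerics :=
  fun P ρ _ hy t ↦ (T.comprehension.encodes P).exists_generic ρ hy t

end CwF.Presentation

theorem theorem2 (C : CwF.{u}) (hC : C.IsCellular) :
    C.HasLocallyFamiliallyRepresentablePolynomialSorts ∧
      C.HasFamiliallyRepresentablePolynomialSorts := by
  obtain ⟨_, _, ⟨T⟩⟩ := hC.exists_presentation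
  have h : C.polynomialSort.Tm.HasGenerics :=
    Family.hasGenerics_telescope T.hasGenerics_monomialSort
  exact ⟨h.isLocallyFamiliallyRepresentable,
    fun P ↦ h.isFamiliallyRepresentable_atGlobal C.isTerminal P⟩
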